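/- Let $k$ be a field and let $A$ be the connected cochain DG $k$-algebra whose underlying graded algebra is the free algebra $A^{\#}=k\langle x,y\rangle$ with $|x|=|y|=1$, with differential determined by $\partial x=y^2$, $\partial y=0$ and the Leibniz rule $\partial(ab)=(\partial a)b+(-1)^{|a|}a\,\partial b$. Let $A^e=A\otimes_k A^{op}$ be its enveloping DG algebra (with the Koszul sign rule). A DG module $F$ is semi-free if it has a filtration $0=F(-1)\subseteq F(0)\subseteq F(1)\subseteq\cdots$ by DG submodules with union $F$ such that each $F(i)/F(i-1)$ is DG free, i.e. a direct sum of suspensions of the DG algebra. Its DG free class is the least $n\ge 0$ such that it has a strictly increasing such filtration of length $n$, i.e. $n$ is the least index with $F(n)=F$ (and $+\infty$ if there is none). The cone length $\mathrm{cl}\,M$ of a DG module $M$ is the infimum of the DG free classes of its semi-free resolutions $F\xrightarrow{\simeq}M$, and $l.\mathrm{Gl.dim}\,A=\sup_M \mathrm{cl}_A M$ over all left DG $A$-modules $M$. Then: 1. $A$ is Koszul: the trivial DG module ${}_Ak$ has a minimal semi-free resolution with a semi-basis concentrated in degree $0$. 2. $A$ is homologically smooth: $A$ is a compact DG $A^e$-module,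 i.e. $\mathrm{Hom}_{D(A^e)}(A,-)$ preserves coproducts. 3. $l.\mathrm{Gl.dim}\,A=2$, $\mathrm{cl}_A k=2$ and $\mathrm{cl}_{A^e}A=2$. 4. There is an isomorphism of graded $k$-algebras $k[Y,V]/(Y^2)\cong H(A)$, where $k[Y,V]$ is the commutative polynomial algebra with $|Y|=1$, $|V|=2$, sending $Y$ and $V$ to the cohomology classes of $y$ and $xy+yx$. 5. The graded algebra $H(A)$ has infinite global dimension: the supremum of the projective dimensions of graded left $H(A)$-modules is $+\infty$. -/

import Mathlib

open scoped DirectSum TensorProduct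

universe u

namespace DGA

noncomputable section

section Linear

variable {k : Type u} [Field k] {M : Type u} [AddCommGroup M] [Module k M]

/-- The linear map `m ↦ (-1) ^ (n * i) • m` on homogeneous elements `m` of degree `i`. -/
def twist (ℳ : ℤ → Submodule k M) [DirectSum.Decomposition ℳ] (n : ℤ) : M →ₗ[k] M :=
  DirectSum.toModule k ℤ M (fun i => (-1 : k) ^ (n * i) • (ℳ i).subtype) ∘ₗ
    (DirectSum.decomposeLinearEquiv ℳ).toLinearMap

theorem twist_of_mem (ℳ : ℤ → Submodule k M) [DirectSum.Decomposition ℳ] (n : ℤ) {i : ℤ} {m : M}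
    (hm : m ∈ ℳ i) : twist ℳ n m = (-1 : k) ^ (n * i) • m := by
  lift m to ℳ i using hm
  simp [twist]

/-- The projection onto the component of degree `n`. -/
def proj (ℳ : ℤ → Submodule k M) [DirectSum.Decomposition ℳ] (n : ℤ) : M →ₗ[k] M :=
  (ℳ n).subtype ∘ₗ DirectSum.component k ℤ (fun i => ℳ i) n ∘ₗ
    (DirectSum.decomposeLinearEquiv ℳ).toLinearMap

theorem proj_apply (ℳ : ℤ → Submodule k M) [DirectSum.Decomposition ℳ] (n : ℤ) (m : M) :
    proj ℳ n m = (DirectSum.decompose ℳ m n : M) := rfl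

theorem proj_mem (ℳ : ℤ → Submodule k M) [DirectSum.Decomposition ℳ] (n : ℤ) (m : M) :
    proj ℳ n m ∈ ℳ n := by rw [proj_apply]; exact Subtype.property _

theorem proj_same (ℳ : ℤ → Submodule k M) [DirectSum.Decomposition ℳ] {n : ℤ} {m : M}
    (hm : m ∈ ℳ n) : proj ℳ n m = m := DirectSum.decompose_of_mem_same ℳ hm

theorem proj_ne (ℳ : ℤ → Submodule k M) [DirectSum.Decomposition ℳ] {n i : ℤ} {m : M}
    (hm : m ∈ ℳ i) (h : i ≠ n) : proj ℳ n m = 0 := DirectSum.decompose_of_mem_ne ℳ hm h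

/-- Induction on homogeneous elements. -/
@[elab_as_elim]
theorem hom_induction (ℳ : ℤ → Submodule k M) [DirectSum.Decomposition ℳ] {p : M → Prop}
    (h0 : p 0) (hadd : ∀ a b, p a → p b → p (a + b)) (hh : ∀ i, ∀ m ∈ ℳ i, p m) (m : M) : p m :=
  DirectSum.Decomposition.inductionOn ℳ h0 (fun m => hh _ m.1 m.2) hadd m

/-- A family of submodules that spans and is separated by projections is a decomposition. -/
abbrev decompositionOfProj (ℳ : ℤ → Submodule k M) (p : ℤ → M →ₗ[k] M)
    (hsame : ∀ n, ∀ m ∈ ℳ n, p n m = m) (hne : ∀ i n, i ≠ n → ∀ m ∈ ℳ i, p n m = 0)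
    (hsup : ∀ m : M, m ∈ ⨆ n, ℳ n) : DirectSum.Decomposition ℳ :=
  DirectSum.IsInternal.chooseDecomposition ℳ <| by
    have key : ∀ (n : ℤ) (x : ⨁ i, ℳ i), p n (DirectSum.coeAddMonoidHom ℳ x) = x n := by
      intro n x
      induction x using DirectSum.induction_on with
      | zero => simp
      | of i m =>
        rw [DirectSum.coeAddMonoidHom_of]
        by_cases h : i = n
        · subst h
          rw [hsame _ _ m.2, DirectSum.of_eq_same]
        · rw [hne i n h _ m.2, DirectSum.of_eq_of_ne _ _ _ (Ne.symm h)]; rfl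
      | add x y hx hy => rw [map_add, map_add, hx, hy]; rfl
    constructor
    · intro x y hxy
      apply DFinsupp.ext
      intro n
      apply Subtype.ext
      rw [← key, ← key, hxy]
    · intro m
      refine Submodule.iSup_induction ℳ (motive := fun m => ∃ x, DirectSum.coeAddMonoidHom ℳ x = m)
        (hsup m) (fun i m hm => ⟨DirectSum.of (fun i => ℳ i) i ⟨m, hm⟩, by simp⟩) ⟨0, by simp⟩ ?_
      rintro a b ⟨x, rfl⟩ ⟨y, rfl⟩
      exact ⟨x + y, by simp⟩

theorem mem_iSup_of_decomp (ℳ : ℤ → Submodule k M) [DirectSum.Decomposition ℳ] (m : M) :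
    m ∈ ⨆ n, ℳ n := by
  refine hom_induction ℳ (Submodule.zero_mem _) (fun _ _ => Submodule.add_mem _) ?_ m
  exact fun i m hm => Submodule.mem_iSup_of_mem i hm

theorem sgn_add (i j : ℤ) : (-1 : k) ^ (i + j) = (-1 : k) ^ i * (-1 : k) ^ j :=
  zpow_add₀ (neg_ne_zero.2 one_ne_zero) i j

theorem sgn_sq (i : ℤ) : (-1 : k) ^ i * (-1 : k) ^ i = 1 := by
  rw [← mul_zpow]; simp

theorem units_smul_eq (i : ℤ) (m : M) : ((-1 : ℤˣ) ^ i) • m = ((-1 : k) ^ i) • m := by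
  rcases Int.even_or_odd i with h | h
  · rw [h.neg_one_zpow, h.neg_one_zpow, one_smul, one_smul]
  · rw [h.neg_one_zpow, h.neg_one_zpow, neg_smul, one_smul, Units.neg_smul, one_smul]

end Linear

/-- A `ℤ`-graded associative unital algebra over the field `k`. -/
structure GrAlg (k : Type u) [Field k] where
  carrier : Type u
  [ring : Ring carrier]
  [algebra : Algebra k carrier]
  grading : ℤ → Submodule k carrier
  [graded : GradedAlgebra grading]

attribute [instance] GrAlg.ring GrAlg.algebra GrAlg.graded

/-- A differential graded algebra (cohomological grading). -/
structure DGAlg (k : Type u) [Field k] extends GrAlg k where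
  d : carrier →ₗ[k] carrier
  d_mem : ∀ (n : ℤ) (a : carrier), a ∈ grading n → d a ∈ grading (n + 1)
  d_d : ∀ a, d (d a) = 0
  leibniz : ∀ (n : ℤ) (a b : carrier), a ∈ grading n →
    d (a * b) = d a * b + (-1 : k) ^ n • (a * d b)

/-- A graded left module over a graded algebra. -/
structure GrMod {k : Type u} [Field k] (R : GrAlg k) where
  carrier : Type u
  [addCommGroup : AddCommGroup carrier]
  [modk : Module k carrier]
  [mod : Module R.carrier carrier]
  [tower : IsScalarTower k R.carrier carrier]
  grading : ℤ → Submodule k carrier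
  [decomp : DirectSum.Decomposition grading]
  smul_mem : ∀ (i j : ℤ) (a : R.carrier) (m : carrier), a ∈ R.grading i → m ∈ grading j →
    a • m ∈ grading (i + j)

attribute [instance] GrMod.addCommGroup GrMod.modk GrMod.mod GrMod.tower GrMod.decomp

/-- A left DG module over a DG algebra. -/
structure DGMod {k : Type u} [Field k] (A : DGAlg k) extends GrMod A.toGrAlg where
  d : carrier →ₗ[k] carrier
  d_mem : ∀ (n : ℤ) (m : carrier), m ∈ grading n → d m ∈ grading (n + 1)
  d_d : ∀ m, d (d m) = 0
  leibniz : ∀ (n : ℤ) (a : A.carrier) (m : carrier), a ∈ A.grading n →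
    d (a • m) = A.d a • m + (-1 : k) ^ n • (a • d m)

variable {k : Type u} [Field k]

/-! ### The opposite algebra -/

section Op

/-- The underlying space of the opposite algebra. -/
def OpCarrier (A : GrAlg k) : Type u := A.carrier

instance (A : GrAlg k) : AddCommGroup (OpCarrier A) := inferInstanceAs (AddCommGroup A.carrier)
instance (A : GrAlg k) : Module k (OpCarrier A) := inferInstanceAs (Module k A.carrier)

/-- The bilinear map with `(a, b) ↦ (-1) ^ (|a| * |b|) • (b * a)` on homogeneous elements. -/
def opMul (A : GrAlg k) : A.carrier →ₗ[k] A.carrier →ₗ[k] A.carrier :=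
  DirectSum.toModule k ℤ (A.carrier →ₗ[k] A.carrier)
    (fun i => ((LinearMap.mul k A.carrier).flip ∘ₗ (A.grading i).subtype).compl₂
      (twist A.grading i)) ∘ₗ (DirectSum.decomposeLinearEquiv A.grading).toLinearMap

theorem opMul_left (A : GrAlg k) {i : ℤ} {a b : A.carrier} (ha : a ∈ A.grading i) :
    opMul A a b = twist A.grading i b * a := by
  lift a to A.grading i using ha
  simp [opMul]

theorem opMul_eq (A : GrAlg k) {i j : ℤ} {a b : A.carrier} (ha : a ∈ A.grading i)
    (hb : b ∈ A.grading j) : opMul A a b = (-1 : k) ^ (i * j) • (b * a) := by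
  rw [opMul_left A ha, twist_of_mem _ _ hb, smul_mul_assoc]

theorem one_mem' (A : GrAlg k) : (1 : A.carrier) ∈ A.grading 0 := SetLike.GradedOne.one_mem

theorem mul_mem' (A : GrAlg k) {i j : ℤ} {a b : A.carrier} (ha : a ∈ A.grading i)
    (hb : b ∈ A.grading j) : a * b ∈ A.grading (i + j) := SetLike.GradedMul.mul_mem ha hb

theorem opMul_mem (A : GrAlg k) {i j : ℤ} {a b : A.carrier} (ha : a ∈ A.grading i)
    (hb : b ∈ A.grading j) : opMul A a b ∈ A.grading (i + j) := by
  rw [opMul_eq A ha hb, add_comm]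
  exact Submodule.smul_mem _ _ (mul_mem' A hb ha)

theorem opMul_assoc (A : GrAlg k) (a b c : A.carrier) :
    opMul A (opMul A a b) c = opMul A a (opMul A b c) := by
  induction a using hom_induction A.grading with
  | h0 => simp
  | hadd x y hx hy => simp [hx, hy]
  | hh i a ha =>
    induction b using hom_induction A.grading with
    | h0 => simp
    | hadd x y hx hy => simp [hx, hy]
    | hh j b hb =>
      induction c using hom_induction A.grading with
      | h0 => simp
      | hadd x y hx hy => simp [hx, hy]
      | hh l c hc =>
        rw [opMul_eq A (opMul_mem A ha hb) hc, opMul_eq A ha (opMul_mem A hb hc), opMul_eq A ha hb,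
          opMul_eq A hb hc, mul_smul_comm, smul_mul_assoc, smul_smul, smul_smul, mul_assoc,
          ← sgn_add, ← sgn_add]
        congr 2; ring

theorem opMul_one_left (A : GrAlg k) (a : A.carrier) : opMul A 1 a = a := by
  induction a using hom_induction A.grading with
  | h0 => simp
  | hadd x y hx hy => simp [hx, hy]
  | hh i a ha =>
    rw [opMul_eq A (one_mem' A) ha]; simp

theorem opMul_one_right (A : GrAlg k) (a : A.carrier) : opMul A a 1 = a := by
  induction a using hom_induction A.grading with
  | h0 => simp
  | hadd x y hx hy => simp [hx, hy]
  | hh i a ha =>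
    rw [opMul_eq A ha (one_mem' A)]; simp

instance (A : GrAlg k) : Ring (OpCarrier A) :=
  { (inferInstance : AddCommGroup (OpCarrier A)) with
    mul := fun a b => opMul A a b
    one := (1 : A.carrier)
    left_distrib := fun a b c => map_add (opMul A a) b c
    right_distrib := fun a b c => LinearMap.map_add₂ (opMul A) a b c
    zero_mul := fun a => LinearMap.map_zero₂ (opMul A) a
    mul_zero := fun a => map_zero (opMul A a)
    mul_assoc := opMul_assoc A
    one_mul := opMul_one_left A
    mul_one := opMul_one_right A }

instance (A : GrAlg k) : Algebra k (OpCarrier A) :=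
  Algebra.ofModule (fun r a b => LinearMap.map_smul₂ (opMul A) r a b)
    (fun r a b => map_smul (opMul A a) r b)

/-- The opposite graded algebra: `a · b = (-1) ^ (|a| * |b|) • (b * a)`. -/
def GrAlg.op (A : GrAlg k) : GrAlg k where
  carrier := OpCarrier A
  grading := A.grading
  graded :=
    { one_mem := one_mem' A
      mul_mem := fun _ _ _ _ ha hb => opMul_mem A ha hb
      toDecomposition := A.graded.toDecomposition }

theorem opMul_leibniz (A : DGAlg k) {n : ℤ} {a : A.carrier} (ha : a ∈ A.grading n)
    (b : A.carrier) : A.d (opMul A.toGrAlg a b) =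
      opMul A.toGrAlg (A.d a) b + (-1 : k) ^ n • opMul A.toGrAlg a (A.d b) := by
  induction b using hom_induction A.grading with
  | h0 => simp
  | hadd x y hx hy => simp only [map_add, hx, hy, smul_add]; abel
  | hh j b hb =>
    rw [opMul_eq _ ha hb, opMul_eq _ (A.d_mem _ _ ha) hb, opMul_eq _ ha (A.d_mem _ _ hb), map_smul,
      A.leibniz j b a hb, smul_add, smul_smul, smul_smul, add_comm, ← sgn_add, ← sgn_add]
    have h1 : n + n * (j + 1) = n * j + 2 * n := by ring
    have h2 : n * j + j = (n + 1) * j := by ring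
    rw [h1, h2, sgn_add (n * j), zpow_mul (-1 : k) 2 n]
    simp

/-- The opposite DG algebra. -/
abbrev DGAlg.op (A : DGAlg k) : DGAlg k where
  toGrAlg := A.toGrAlg.op
  d := A.d
  d_mem := A.d_mem
  d_d := A.d_d
  leibniz := fun _ _ b ha => opMul_leibniz A ha b

end Op

/-! ### Tensor products and the enveloping algebra -/

section Tensor

/-- The underlying space of `A ⊗ B`, multiplied by
`(a ⊗ b) * (a' ⊗ b') = (-1) ^ (|b| * |a'|) • (a * a') ⊗ (b * b')`. -/
abbrev TCarrier (A B : GrAlg k) : Type u := A.grading ᵍ⊗[k] B.grading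

theorem tmul_mul_tmul (A B : GrAlg k) {i j : ℤ} (a : A.carrier) {b : B.carrier}
    (hb : b ∈ B.grading j) {a' : A.carrier} (ha' : a' ∈ A.grading i) (b' : B.carrier) :
    (a ᵍ⊗ₜ[k] b * a' ᵍ⊗ₜ[k] b' : TCarrier A B) =
      (-1 : k) ^ (j * i) • ((a * a') ᵍ⊗ₜ[k] (b * b') : TCarrier A B) := by
  have := GradedTensorProduct.tmul_coe_mul_coe_tmul (R := k) A.grading B.grading a ⟨b, hb⟩
    ⟨a', ha'⟩ b'
  rw [← units_smul_eq]
  exact this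

/-- The degree `n` part of `A ⊗ B` is spanned by the `a ⊗ b` with `|a| + |b| = n`. -/
def tGrading (A B : GrAlg k) (n : ℤ) : Submodule k (TCarrier A B) :=
  Submodule.span k {t | ∃ i j : ℤ, i + j = n ∧ ∃ a ∈ A.grading i, ∃ b ∈ B.grading j,
    t = a ᵍ⊗ₜ[k] b}

theorem tmul_mem (A B : GrAlg k) {i j : ℤ} {a : A.carrier} {b : B.carrier}
    (ha : a ∈ A.grading i) (hb : b ∈ B.grading j) :
    (a ᵍ⊗ₜ[k] b : TCarrier A B) ∈ tGrading A B (i + j) :=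
  Submodule.subset_span ⟨i, j, rfl, a, ha, b, hb, rfl⟩

theorem t_induction (A B : GrAlg k) {p : TCarrier A B → Prop} (h0 : p 0)
    (hadd : ∀ s t, p s → p t → p (s + t))
    (hh : ∀ i j, ∀ a ∈ A.grading i, ∀ b ∈ B.grading j, p (a ᵍ⊗ₜ[k] b)) (t : TCarrier A B) :
    p t := by
  refine TensorProduct.induction_on (motive := fun t => p (GradedTensorProduct.of k _ _ t))
    ((GradedTensorProduct.of k _ _).symm t) (by simpa using h0) ?_ ?_
  · intro a b
    induction a using hom_induction A.grading with
    | h0 => simpa using h0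
    | hadd x y hx hy => simpa [TensorProduct.add_tmul] using hadd _ _ hx hy
    | hh i a ha =>
      induction b using hom_induction B.grading with
      | h0 => simpa using h0
      | hadd x y hx hy => simpa [TensorProduct.tmul_add] using hadd _ _ hx hy
      | hh j b hb => exact hh i j a ha b hb
  · intro s t hs ht
    simpa using hadd _ _ hs ht

theorem t_induction_deg (A B : GrAlg k) {n : ℤ} {p : TCarrier A B → Prop} (h0 : p 0)
    (hadd : ∀ s t, p s → p t → p (s + t)) (hsmul : ∀ (r : k) t, p t → p (r • t))
    (hh : ∀ i j, i + j = n → ∀ a ∈ A.grading i, ∀ b ∈ B.grading j, p (a ᵍ⊗ₜ[k] b))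
    (t : TCarrier A B) (ht : t ∈ tGrading A B n) : p t := by
  refine Submodule.span_induction (p := fun t _ => p t) ?_ h0 (fun s t _ _ => hadd s t)
    (fun r t _ => hsmul r t) ht
  rintro _ ⟨i, j, h, a, ha, b, hb, rfl⟩
  exact hh i j h a ha b hb

/-- The projection of `A ⊗ B` onto its degree `n` part. -/
def tProj (A B : GrAlg k) (n : ℤ) : TCarrier A B →ₗ[k] TCarrier A B :=
  (GradedTensorProduct.of k A.grading B.grading).toLinearMap ∘ₗ
    TensorProduct.lift (DirectSum.toModule k ℤ _ (fun i =>
      (TensorProduct.mk k A.carrier B.carrier ∘ₗ (A.grading i).subtype).compl₂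
        (proj B.grading (n - i))) ∘ₗ (DirectSum.decomposeLinearEquiv A.grading).toLinearMap) ∘ₗ
    (GradedTensorProduct.of k A.grading B.grading).symm.toLinearMap

theorem tProj_tmul (A B : GrAlg k) (n : ℤ) {i : ℤ} {a : A.carrier} (ha : a ∈ A.grading i)
    (b : B.carrier) : tProj A B n (a ᵍ⊗ₜ[k] b) = a ᵍ⊗ₜ[k] (proj B.grading (n - i) b) := by
  lift a to A.grading i using ha
  simp [tProj]

instance (A B : GrAlg k) : GradedAlgebra (tGrading A B) where
  one_mem := by
    have := tmul_mem A B (one_mem' A) (one_mem' B)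
    rwa [add_zero] at this
  mul_mem := by
    intro m n s t hs ht
    refine t_induction_deg A B (p := fun s => s * t ∈ tGrading A B (m + n)) (by simp)
      (fun x y hx hy => by rw [add_mul]; exact add_mem hx hy)
      (fun r x hx => by rw [smul_mul_assoc]; exact Submodule.smul_mem _ _ hx) ?_ s hs
    intro i j hij a ha b hb
    refine t_induction_deg A B (p := fun t => _ * t ∈ tGrading A B (m + n)) (by simp)
      (fun x y hx hy => by rw [mul_add]; exact add_mem hx hy)
      (fun r x hx => by rw [mul_smul_comm]; exact Submodule.smul_mem _ _ hx) ?_ t ht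
    intro i' j' hij' a' ha' b' hb'
    rw [tmul_mul_tmul A B a hb ha' b']
    have := tmul_mem A B (mul_mem' A ha ha') (mul_mem' B hb hb')
    have e : m + n = i + i' + (j + j') := by omega
    rw [e]
    exact Submodule.smul_mem _ _ this
  toDecomposition := decompositionOfProj (tGrading A B) (tProj A B)
    (by
      intro n t ht
      refine t_induction_deg A B (p := fun t => tProj A B n t = t) (by simp)
        (fun x y hx hy => by rw [map_add, hx, hy]) (fun r x hx => by rw [map_smul, hx]) ?_ t ht
      intro i j hij a ha b hb
      rw [tProj_tmul A B n ha, proj_same]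
      rwa [← hij, add_sub_cancel_left])
    (by
      intro m n hmn t ht
      refine t_induction_deg A B (p := fun t => tProj A B n t = 0) (by simp)
        (fun x y hx hy => by rw [map_add, hx, hy, add_zero])
        (fun r x hx => by rw [map_smul, hx, smul_zero]) ?_ t ht
      intro i j hij a ha b hb
      rw [tProj_tmul A B n ha, proj_ne B.grading hb (by omega)]
      simp)
    (by
      intro t
      refine t_induction A B (Submodule.zero_mem _) (fun _ _ => Submodule.add_mem _) ?_ t
      intro i j a ha b hb
      exact Submodule.mem_iSup_of_mem (i + j) (tmul_mem A B ha hb))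

/-- The tensor product of graded algebras. -/
abbrev GrAlg.tensor (A B : GrAlg k) : GrAlg k where
  carrier := TCarrier A B
  grading := tGrading A B

/-- The differential `a ⊗ b ↦ d a ⊗ b + (-1) ^ |a| • a ⊗ d b`. -/
def tDiff (A B : DGAlg k) : TCarrier A.toGrAlg B.toGrAlg →ₗ[k] TCarrier A.toGrAlg B.toGrAlg :=
  (GradedTensorProduct.of k A.grading B.grading).toLinearMap ∘ₗ
    (TensorProduct.map A.d LinearMap.id + TensorProduct.map (twist A.grading 1) B.d) ∘ₗ
    (GradedTensorProduct.of k A.grading B.grading).symm.toLinearMap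

theorem tDiff_tmul (A B : DGAlg k) {i : ℤ} {a : A.carrier} (ha : a ∈ A.grading i)
    (b : B.carrier) : tDiff A B (a ᵍ⊗ₜ[k] b) =
      A.d a ᵍ⊗ₜ[k] b + (-1 : k) ^ i • (a ᵍ⊗ₜ[k] B.d b) := by
  simp only [tDiff, LinearMap.comp_apply, LinearEquiv.coe_coe, GradedTensorProduct.tmul,
    LinearEquiv.symm_apply_apply, LinearMap.add_apply, TensorProduct.map_tmul, LinearMap.id_apply,
    twist_of_mem _ _ ha, one_mul, map_add, ← TensorProduct.smul_tmul', map_smul]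

/-- The tensor product of DG algebras. -/
abbrev DGAlg.tensor (A B : DGAlg k) : DGAlg k where
  toGrAlg := A.toGrAlg.tensor B.toGrAlg
  d := tDiff A B
  d_mem := by
    intro n t ht
    refine t_induction_deg A.toGrAlg B.toGrAlg
      (p := fun t => tDiff A B t ∈ tGrading A.toGrAlg B.toGrAlg (n + 1)) (by simp)
      (fun x y hx hy => by rw [map_add]; exact add_mem hx hy)
      (fun r x hx => by rw [map_smul]; exact Submodule.smul_mem _ _ hx) ?_ t ht
    intro i j hij a ha b hb
    rw [tDiff_tmul A B ha]
    have h1 := tmul_mem A.toGrAlg B.toGrAlg (A.d_mem _ _ ha) hb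
    have h2 := tmul_mem A.toGrAlg B.toGrAlg ha (B.d_mem _ _ hb)
    have e1 : i + 1 + j = n + 1 := by omega
    have e2 : i + (j + 1) = n + 1 := by omega
    rw [e1] at h1
    rw [e2] at h2
    exact add_mem h1 (Submodule.smul_mem _ _ h2)
  d_d := by
    intro t
    refine t_induction A.toGrAlg B.toGrAlg (p := fun t => tDiff A B (tDiff A B t) = 0) (by simp)
      (fun x y hx hy => by rw [map_add, map_add, hx, hy, add_zero]) ?_ t
    intro i j a ha b hb
    rw [tDiff_tmul A B ha, map_add, map_smul, tDiff_tmul A B ha,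
      tDiff_tmul A B (A.d_mem _ _ ha), A.d_d, B.d_d, sgn_add]
    simp [GradedTensorProduct.tmul]
  leibniz := by
    intro n s (t : TCarrier A.toGrAlg B.toGrAlg) hs
    change tDiff A B (s * t) = tDiff A B s * t + (-1 : k) ^ n • (s * tDiff A B t)
    refine t_induction_deg A.toGrAlg B.toGrAlg (p := fun s => tDiff A B (s * t) =
      tDiff A B s * t + (-1 : k) ^ n • (s * tDiff A B t)) (by simp)
      (fun x y hx hy => by simp only [add_mul, map_add, hx, hy, smul_add]; abel)
      (fun r x hx => by
        simp only [smul_mul_assoc, map_smul, hx, smul_add]; rw [smul_comm r]) ?_ s hs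
    intro i j hij a ha b hb
    refine t_induction A.toGrAlg B.toGrAlg (p := fun t => tDiff A B (_ * t) =
      tDiff A B _ * t + (-1 : k) ^ n • (_ * tDiff A B t)) (by simp)
      (fun x y hx hy => by simp only [mul_add, map_add, hx, hy, smul_add]; abel) ?_ t
    intro i' j' a' ha' b' hb'
    rw [tmul_mul_tmul _ _ a hb ha' b', map_smul, tDiff_tmul A B (mul_mem' A.toGrAlg ha ha'),
      tDiff_tmul A B ha, tDiff_tmul A B ha', A.leibniz i a a' ha, B.leibniz j b b' hb,
      add_mul, mul_add, smul_mul_assoc, mul_smul_comm,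
      tmul_mul_tmul _ _ _ hb ha' _, tmul_mul_tmul _ _ _ (B.d_mem _ _ hb) ha' _,
      tmul_mul_tmul _ _ _ hb (A.d_mem _ _ ha') _, tmul_mul_tmul _ _ _ hb ha' _]
    have hj := sgn_sq (k := k) j
    simp only [GradedTensorProduct.tmul, TensorProduct.add_tmul, TensorProduct.tmul_add, map_add,
      TensorProduct.tmul_smul, ← TensorProduct.smul_tmul', map_smul, ← hij, sgn_add, mul_add,
      add_mul, mul_one, one_mul]
    match_scalars
    · ring
    · linear_combination (-(-1 : k) ^ (j * i') * (-1 : k) ^ i) * hj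
    · ring
    · ring

/-- The enveloping DG algebra `A ⊗ A^op`. -/
abbrev DGAlg.env (A : DGAlg k) : DGAlg k := A.tensor A.op

/-- The action `(a ⊗ b) • m = (-1) ^ (|b| * |m|) • (a * m * b)` of the enveloping algebra. -/
def envAct (A : GrAlg k) : TCarrier A A.op →ₐ[k] Module.End k A.carrier :=
  GradedTensorProduct.lift A.grading A.op.grading (Algebra.lmul k A.carrier)
    (AlgHom.ofLinearMap (A := OpCarrier A) (opMul A) (LinearMap.ext (opMul_one_left A))
      (fun b b' => LinearMap.ext (opMul_assoc A b b')))
    (by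
      rintro i j ⟨a, ha⟩ ⟨(b : A.carrier), (hb : b ∈ A.grading j)⟩
      refine LinearMap.ext fun m => ?_
      change a * opMul A b m = ((-1 : ℤˣ) ^ (j * i) • (opMul A b * Algebra.lmul k A.carrier a)) m
      rw [units_smul_eq (k := k)]
      change a * opMul A b m = (-1 : k) ^ (j * i) • (opMul A b (a * m))
      rw [opMul_left A hb, opMul_left A hb]
      induction m using hom_induction A.grading with
      | h0 => simp
      | hadd x y hx hy => simp only [map_add, mul_add, add_mul, hx, hy, smul_add]
      | hh l m hm =>
        rw [twist_of_mem _ _ hm, twist_of_mem _ _ (mul_mem' A ha hm), smul_mul_assoc,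
          smul_mul_assoc, smul_smul, mul_smul_comm, mul_add, sgn_add, ← mul_assoc, ← mul_assoc,
          sgn_sq, one_mul])

theorem envAct_tmul (A : GrAlg k) (a b m : A.carrier) :
    envAct A (GradedTensorProduct.tmul k (𝒜 := A.grading) (ℬ := A.op.grading) a b) m =
      a * opMul A b m := rfl

/-- The DG algebra `A` as a DG module over its enveloping algebra. -/
def DGMod.diag (A : DGAlg k) : DGMod A.env :=
  letI : Module (TCarrier A.toGrAlg A.toGrAlg.op) A.carrier :=
    Module.compHom A.carrier (envAct A.toGrAlg).toRingHom
  { carrier := A.carrier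
    mod := this
    tower := ⟨fun r t m => by
      change envAct A.toGrAlg (r • t) m = r • envAct A.toGrAlg t m
      rw [map_smul]; rfl⟩
    grading := A.grading
    decomp := A.graded.toDecomposition
    smul_mem := by
      intro n l t m ht hm
      change envAct A.toGrAlg t m ∈ A.grading (n + l)
      refine t_induction_deg A.toGrAlg A.toGrAlg.op
        (p := fun t => envAct A.toGrAlg t m ∈ A.grading (n + l)) (by simp)
        (fun x y hx hy => by rw [map_add]; exact add_mem hx hy)
        (fun r x hx => by rw [map_smul]; exact Submodule.smul_mem _ _ hx) ?_ t ht
      intro i j hij a ha b hb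
      change a * opMul A.toGrAlg b m ∈ A.grading (n + l)
      rw [← hij, add_assoc]
      exact mul_mem' _ ha (opMul_mem _ hb hm)
    d := A.d
    d_mem := A.d_mem
    d_d := A.d_d
    leibniz := by
      intro n t m ht
      change A.d (envAct A.toGrAlg t m) = envAct A.toGrAlg (tDiff A A.op t) m +
        (-1 : k) ^ n • envAct A.toGrAlg t (A.d m)
      refine t_induction_deg A.toGrAlg A.toGrAlg.op (p := fun t => A.d (envAct A.toGrAlg t m) =
        envAct A.toGrAlg (tDiff A A.op t) m + (-1 : k) ^ n • envAct A.toGrAlg t (A.d m)) (by simp)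
        (fun x y hx hy => by simp only [map_add, LinearMap.add_apply, hx, hy, smul_add]; abel)
        (fun r x hx => by
          simp only [map_smul, LinearMap.smul_apply, hx, smul_add]; rw [smul_comm r]) ?_ t ht
      intro i j hij a ha b hb
      rw [tDiff_tmul A A.op ha, map_add, map_smul, LinearMap.add_apply, LinearMap.smul_apply]
      erw [envAct_tmul, envAct_tmul, envAct_tmul, envAct_tmul]
      rw [A.leibniz i _ _ ha, opMul_leibniz A hb, ← hij, sgn_add, mul_add, smul_add,
        mul_smul_comm, smul_smul, add_assoc]
      rfl }

end Tensor

/-! ### Homomorphisms, cohomology and homotopy -/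

section Modules

variable {A : DGAlg k}

/-- The group of morphisms of DG modules: linear maps of degree `0` commuting with `d`. -/
def dgHom (M N : DGMod A) : AddSubgroup (M.carrier →ₗ[A.carrier] N.carrier) where
  carrier := {f | (∀ n, ∀ m ∈ M.grading n, f m ∈ N.grading n) ∧ ∀ m, f (M.d m) = N.d (f m)}
  zero_mem' := ⟨fun _ _ _ => Submodule.zero_mem _, fun _ => by simp⟩
  add_mem' := fun hf hg => ⟨fun n m hm => Submodule.add_mem _ (hf.1 n m hm) (hg.1 n m hm),
    fun m => by simp [hf.2 m, hg.2 m]⟩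
  neg_mem' := fun hf => ⟨fun n m hm => Submodule.neg_mem _ (hf.1 n m hm),
    fun m => by simp [hf.2 m]⟩

/-- The subgroup of null-homotopic morphisms: `f = d σ + σ d` for some homomorphism `σ` of
degree `-1`, that is `σ (a • m) = (-1) ^ |a| • (a • σ m)`. -/
def nullHomotopic (M N : DGMod A) : AddSubgroup (dgHom M N) where
  carrier := {f | ∃ σ : M.carrier →ₗ[k] N.carrier,
    (∀ n, ∀ m ∈ M.grading n, σ m ∈ N.grading (n - 1)) ∧
    (∀ (n : ℤ), ∀ a ∈ A.grading n, ∀ m, σ (a • m) = (-1 : k) ^ n • (a • σ m)) ∧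
    ∀ m, f.1 m = N.d (σ m) + σ (M.d m)}
  zero_mem' := ⟨0, by simp⟩
  add_mem' := by
    rintro f g ⟨σ, h1, h2, h3⟩ ⟨τ, h1', h2', h3'⟩
    refine ⟨σ + τ, fun n m hm => Submodule.add_mem _ (h1 n m hm) (h1' n m hm),
      fun n a ha m => by simp [h2 n a ha, h2' n a ha], fun m => ?_⟩
    simp only [AddSubgroup.coe_add, LinearMap.add_apply, h3, h3', map_add]
    abel
  neg_mem' := by
    rintro f ⟨σ, h1, h2, h3⟩
    refine ⟨-σ, fun n m hm => Submodule.neg_mem _ (h1 n m hm),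
      fun n a ha m => by simp [h2 n a ha], fun m => ?_⟩
    simp only [AddSubgroup.coe_neg, LinearMap.neg_apply, h3, map_neg]
    abel

/-- Homotopy classes of morphisms, `H⁰(Hom_A(M, N))`. -/
abbrev HoHom (M N : DGMod A) : Type u := dgHom M N ⧸ nullHomotopic M N

/-- Composition of homotopy classes with a morphism `g : N → N'`. -/
def HoHom.comp (M : DGMod A) {N N' : DGMod A} (g : dgHom N N') : HoHom M N →+ HoHom M N' :=
  QuotientAddGroup.map (nullHomotopic M N) (nullHomotopic M N')
    { toFun := fun f => ⟨g.1 ∘ₗ f.1, fun n m hm => g.2.1 n _ (f.2.1 n m hm),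
        fun m => by simp [f.2.2 m, g.2.2]⟩
      map_zero' := by ext; simp
      map_add' := fun f f' => by ext; simp }
    (by
      rintro f ⟨σ, h1, h2, h3⟩
      refine ⟨(g.1.restrictScalars k) ∘ₗ σ, fun n m hm => g.2.1 _ _ (h1 n m hm),
        fun n a ha m => ?_, fun m => ?_⟩
      · simp [h2 n a ha]
      · have h := congrArg g.1 (h3 m)
        rw [map_add, g.2.2] at h
        exact h)

/-- The cohomology of a DG module. -/
abbrev DGMod.H (M : DGMod A) : Type u :=
  LinearMap.ker M.d ⧸ (LinearMap.range M.d).submoduleOf (LinearMap.ker M.d)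

/-- The map induced by a morphism on cohomology. -/
def hMap {M N : DGMod A} (f : dgHom M N) : M.H →ₗ[k] N.H :=
  Submodule.mapQ _ _ ((f.1.restrictScalars k).restrict (fun m hm => by
      rw [LinearMap.mem_ker] at hm ⊢
      change N.d (f.1 m) = 0
      rw [← f.2.2, hm, map_zero])) (by
    rintro ⟨m, hm⟩ ⟨m', h⟩
    exact ⟨f.1 m', by rw [← f.2.2, h]; rfl⟩)

/-- A quasi-isomorphism induces a bijection on cohomology. -/
def IsQuasiIso {M N : DGMod A} (f : dgHom M N) : Prop := Function.Bijective (hMap f)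

/-- The direct sum of a family of DG modules. -/
def DGMod.sum {I : Type u} (N : I → DGMod A) : DGMod A where
  carrier := ⨁ i, (N i).carrier
  grading := fun n =>
    { carrier := {x | ∀ i, x i ∈ (N i).grading n}
      zero_mem' := fun i => Submodule.zero_mem _
      add_mem' := fun hx hy i => Submodule.add_mem _ (hx i) (hy i)
      smul_mem' := fun r x hx i => Submodule.smul_mem _ r (hx i) }
  decomp := decompositionOfProj _ (fun n => DirectSum.lmap (fun i => proj (N i).grading n))
    (fun n x hx => DFinsupp.ext fun i => by
      rw [DirectSum.lmap_apply, proj_same _ (hx i)])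
    (fun j n hjn x hx => DFinsupp.ext fun i => by
      rw [DirectSum.lmap_apply, proj_ne _ (hx i) hjn]; rfl)
    (by
      classical
      intro x
      induction x using DirectSum.induction_on with
      | zero => exact Submodule.zero_mem _
      | add x y hx hy => exact Submodule.add_mem _ hx hy
      | of i m =>
        induction m using hom_induction (N i).grading with
        | h0 => rw [map_zero]; exact Submodule.zero_mem _
        | hadd a b ha hb => rw [map_add]; exact Submodule.add_mem _ ha hb
        | hh n m hm =>
          refine Submodule.mem_iSup_of_mem n fun j => ?_
          by_cases h : j = i
          · subst h; rw [DirectSum.of_eq_same]; exact hm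
          · rw [DirectSum.of_eq_of_ne _ _ _ h]; exact Submodule.zero_mem _)
  smul_mem := fun i j a x ha hx l => (N l).smul_mem i j a _ ha (hx l)
  d := DirectSum.lmap fun i => (N i).d
  d_mem := fun n x hx i => by
    rw [DirectSum.lmap_apply]; exact (N i).d_mem _ _ (hx i)
  d_d := fun x => DFinsupp.ext fun i => by
    rw [DirectSum.lmap_apply, DirectSum.lmap_apply, (N i).d_d]; rfl
  leibniz := fun n a x ha => DFinsupp.ext fun i => by
    rw [DirectSum.lmap_apply]
    change (N i).d (a • x i) = A.d a • x i +
      (-1 : k) ^ n • (a • (DirectSum.lmap (fun i => (N i).d) x) i)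
    rw [DirectSum.lmap_apply, (N i).leibniz n a _ ha]

open scoped Classical in
/-- The inclusion of a summand. -/
def DGMod.incl {I : Type u} (N : I → DGMod A) (i : I) : dgHom (N i) (DGMod.sum N) :=
  ⟨DirectSum.lof A.carrier I (fun i => (N i).carrier) i, by
    constructor
    · intro n m hm j
      change DirectSum.of (fun i => (N i).carrier) i m j ∈ _
      by_cases h : j = i
      · subst h; rw [DirectSum.of_eq_same]; exact hm
      · rw [DirectSum.of_eq_of_ne _ _ _ h]; exact Submodule.zero_mem _
    · intro m
      change DirectSum.lof k I (fun i => (N i).carrier) i ((N i).d m) =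
        DirectSum.lmap (fun i => (N i).d) (DirectSum.lof k I (fun i => (N i).carrier) i m)
      rw [DirectSum.lmap_lof]⟩

open scoped Classical in
/-- The canonical map `⨁ H⁰(Hom(F, N i)) → H⁰(Hom(F, ⨁ N i))`. -/
def coprodMap (F : DGMod A) {I : Type u} (N : I → DGMod A) :
    (⨁ i, HoHom F (N i)) →+ HoHom F (DGMod.sum N) :=
  DirectSum.toAddMonoid fun i => HoHom.comp F (DGMod.incl N i)

/-! ### Semi-free modules, cone length, compactness -/

/-- A semi-free filtration `0 = F(-1) ⊆ F(0) ⊆ F(1) ⊆ ⋯` by DG submodules, where `G i` stands for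
`F(i - 1)`. The last condition says that each quotient `G (i + 1) / G i` is DG free: it has a basis
consisting of (the classes of) homogeneous elements that are cocycles in the quotient. -/
structure IsSemifreeFiltration (F : DGMod A) (G : ℕ → Submodule A.carrier F.carrier) : Prop where
  zero : G 0 = ⊥
  mono : Monotone G
  exhaust : ∀ x, ∃ i, x ∈ G i
  homogeneous : ∀ i n, ∀ x ∈ G i, proj F.grading n x ∈ G i
  d_mem : ∀ i, ∀ x ∈ G i, F.d x ∈ G i
  free : ∀ i, ∃ (ι : Type u) (e : ι → F.carrier), (∀ j, ∃ n, e j ∈ F.grading n) ∧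
    (∀ j, F.d (e j) ∈ G i) ∧ LinearIndependent A.carrier (fun j => (G i).mkQ (e j)) ∧
    G i ⊔ Submodule.span A.carrier (Set.range e) = G (i + 1)

/-- A DG module is semi-free if it has a semi-free filtration. -/
def IsSemifree (F : DGMod A) : Prop := ∃ G, IsSemifreeFiltration F G

/-- The filtration increases strictly until it reaches the whole module. -/
def IsStrictlyIncreasing {F : DGMod A} (G : ℕ → Submodule A.carrier F.carrier) : Prop :=
  ∀ i, G i ≠ ⊤ → G i ≠ G (i + 1)

/-- The filtration has length `n`: `n` is the least natural number with `F(n) = F`. -/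
def HasLength {F : DGMod A} (G : ℕ → Submodule A.carrier F.carrier) (n : ℕ) : Prop :=
  IsLeast {m : ℕ | G (m + 1) = ⊤} n

/-- The DG free class of a semi-free DG module. -/
def dgFreeClass (F : DGMod A) : ℕ∞ :=
  sInf {c : ℕ∞ | ∃ (G : ℕ → Submodule A.carrier F.carrier) (n : ℕ), IsSemifreeFiltration F G ∧
    IsStrictlyIncreasing G ∧ HasLength G n ∧ c = n}

/-- `f : F → M` is a semi-free resolution of `M`. -/
def IsSemifreeResolution {F M : DGMod A} (f : dgHom F M) : Prop := IsSemifree F ∧ IsQuasiIso f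

/-- The cone length of a DG module. -/
def coneLength (M : DGMod A) : ℕ∞ :=
  sInf {c : ℕ∞ | ∃ (F : DGMod A) (f : dgHom F M), IsSemifreeResolution f ∧ c = dgFreeClass F}

/-- The left global dimension of a DG algebra. -/
def leftGlobalDim (A : DGAlg k) : ℕ∞ := ⨆ M : DGMod A, coneLength M

/-- A DG module `M` is compact if `Hom_{D(A)}(M, -)` preserves coproducts, where
`Hom_{D(A)}(M, N) = H⁰(RHom_A(M, N))` is computed by a semi-free resolution of `M`. -/
def IsCompactDG (M : DGMod A) : Prop :=
  ∃ (F : DGMod A) (f : dgHom F M), IsSemifreeResolution f ∧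
    ∀ (I : Type u) (N : I → DGMod A), Function.Bijective (coprodMap F N)

/-- A DG algebra `A` is homologically smooth if it is a compact DG module over `A ⊗ A^op`. -/
def IsHomologicallySmooth (A : DGAlg k) : Prop := IsCompactDG (DGMod.diag A)

/-- A semi-basis: a basis of homogeneous elements with a rank function `r` such that the
differential of a basis element of rank `u` is a combination of basis elements of rank `< u`. -/
def IsSemibasis {F : DGMod A} {ι : Type u} (b : Module.Basis ι A.carrier F.carrier)
    (r : ι → ℕ) : Prop :=
  (∀ i, ∃ n, b i ∈ F.grading n) ∧
    ∀ i, F.d (b i) ∈ Submodule.span A.carrier {x | ∃ j, r j < r i ∧ x = b j}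

/-- Minimality over a connected DG algebra: `d F ⊆ 𝔪 F`, where `𝔪` is the sum of the components of
positive degree. -/
def IsMinimalDG (F : DGMod A) : Prop :=
  ∀ x, F.d x ∈ Submodule.span k {y | ∃ n > 0, ∃ a ∈ A.grading n, ∃ z, y = a • z}

end Modules

/-! ### Connected algebras -/

section Connected

/-- A connected graded algebra: `A` is nonzero, `A^n = 0` for `n < 0` and `A^0 = k`. -/
structure IsConnected (A : GrAlg k) : Prop where
  nontrivial : Nontrivial A.carrier
  neg : ∀ n < 0, A.grading n = ⊥
  zero : A.grading 0 = Submodule.span k {1}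

theorem exists_unique_aug {A : GrAlg k} (hA : IsConnected A) (a : A.carrier) :
    ∃! r : k, algebraMap k A.carrier r = proj A.grading 0 a := by
  have := hA.nontrivial
  have h := proj_mem A.grading 0 a
  rw [hA.zero, Submodule.mem_span_singleton] at h
  obtain ⟨r, hr⟩ := h
  refine ⟨r, (Algebra.algebraMap_eq_smul_one r).trans hr, fun s hs => ?_⟩
  apply (algebraMap k A.carrier).injective
  change _ = _ at hs
  rw [hs, ← hr, Algebra.algebraMap_eq_smul_one]

/-- The coefficient of the degree `0` component. -/
def augFun {A : GrAlg k} (hA : IsConnected A) (a : A.carrier) : k :=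
  (exists_unique_aug hA a).choose

theorem algebraMap_augFun {A : GrAlg k} (hA : IsConnected A) (a : A.carrier) :
    algebraMap k A.carrier (augFun hA a) = proj A.grading 0 a :=
  (exists_unique_aug hA a).choose_spec.1

theorem augFun_eq {A : GrAlg k} (hA : IsConnected A) {a : A.carrier} {r : k}
    (h : algebraMap k A.carrier r = proj A.grading 0 a) : augFun hA a = r :=
  (exists_unique_aug hA a).unique (algebraMap_augFun hA a) h

theorem augFun_add {A : GrAlg k} (hA : IsConnected A) (a b : A.carrier) :
    augFun hA (a + b) = augFun hA a + augFun hA b :=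
  augFun_eq hA (by rw [map_add, map_add, algebraMap_augFun, algebraMap_augFun])

theorem augFun_algebraMap {A : GrAlg k} (hA : IsConnected A) (r : k) :
    augFun hA (algebraMap k A.carrier r) = r :=
  augFun_eq hA (by
    rw [proj_same]
    rw [Algebra.algebraMap_eq_smul_one]
    exact Submodule.smul_mem _ _ (one_mem' A))

theorem augFun_zero {A : GrAlg k} (hA : IsConnected A) : augFun hA 0 = 0 := by
  rw [← map_zero (algebraMap k A.carrier), augFun_algebraMap]

theorem augFun_of_ne {A : GrAlg k} (hA : IsConnected A) {n : ℤ} (hn : n ≠ 0) {a : A.carrier}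
    (ha : a ∈ A.grading n) : augFun hA a = 0 :=
  augFun_eq hA (by rw [proj_ne _ ha hn, map_zero])

theorem augFun_mul {A : GrAlg k} (hA : IsConnected A) (a b : A.carrier) :
    augFun hA (a * b) = augFun hA a * augFun hA b := by
  induction a using hom_induction A.grading with
  | h0 => simp [augFun_zero]
  | hadd x y hx hy => rw [add_mul, augFun_add, augFun_add, hx, hy, add_mul]
  | hh i a ha =>
    induction b using hom_induction A.grading with
    | h0 => simp [augFun_zero]
    | hadd x y hx hy => rw [mul_add, augFun_add, augFun_add, hx, hy, mul_add]
    | hh j b hb =>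
      rcases lt_or_ge i 0 with hi | hi
      · rw [hA.neg i hi, Submodule.mem_bot] at ha
        simp [ha, augFun_zero]
      rcases lt_or_ge j 0 with hj | hj
      · rw [hA.neg j hj, Submodule.mem_bot] at hb
        simp [hb, augFun_zero]
      by_cases hi0 : i = 0
      · subst hi0
        by_cases hj0 : j = 0
        · subst hj0
          have h := mul_mem' A ha hb
          rw [add_zero] at h
          refine augFun_eq hA ?_
          rw [proj_same _ h, map_mul, algebraMap_augFun, algebraMap_augFun, proj_same _ ha,
            proj_same _ hb]
        · rw [augFun_of_ne hA (by omega) (mul_mem' A ha hb), augFun_of_ne hA hj0 hb, mul_zero]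
      · rw [augFun_of_ne hA (by omega) (mul_mem' A ha hb), augFun_of_ne hA hi0 ha, zero_mul]

/-- The augmentation `A → k` of a connected graded algebra. -/
def aug {A : GrAlg k} (hA : IsConnected A) : A.carrier →ₐ[k] k where
  toFun := augFun hA
  map_one' := by rw [← map_one (algebraMap k A.carrier), augFun_algebraMap]
  map_mul' := augFun_mul hA
  map_zero' := augFun_zero hA
  map_add' := augFun_add hA
  commutes' := augFun_algebraMap hA

/-- The trivial DG module `k` (in degree `0`) over a connected DG algebra. -/
def DGMod.trivial {A : DGAlg k} (hA : IsConnected A.toGrAlg) : DGMod A :=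
  letI : Module A.carrier k := Module.compHom k (aug hA).toRingHom
  { carrier := k
    mod := this
    tower := ⟨fun r a c => by
      change aug hA (r • a) * c = r * (aug hA a * c)
      rw [map_smul, smul_eq_mul, mul_assoc]⟩
    grading := fun n => if n = 0 then ⊤ else ⊥
    decomp := decompositionOfProj _ (fun n => if n = 0 then LinearMap.id else 0)
      (fun n m hm => by
        split_ifs at hm ⊢ with h
        · rfl
        · exact ((Submodule.mem_bot k).1 hm).symm)
      (fun i n hin m hm => by
        split_ifs at hm ⊢ with h1 h2
        · exact absurd (h2.trans h1.symm) hin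
        · exact (Submodule.mem_bot k).1 hm
        · rfl
        · rfl)
      (fun m => Submodule.mem_iSup_of_mem 0 (by simp))
    smul_mem := fun i j a m ha hm => by
      change aug hA a * m ∈ _
      by_cases hj : j = 0
      · subst hj
        by_cases hi : i = 0
        · subst hi; simp
        · have : aug hA a = 0 := augFun_of_ne hA hi ha
          rw [this, zero_mul]; exact Submodule.zero_mem _
      · rw [if_neg hj, Submodule.mem_bot] at hm
        rw [hm, mul_zero]; exact Submodule.zero_mem _
    d := 0
    d_mem := fun _ _ _ => Submodule.zero_mem _
    d_d := fun _ => rfl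
    leibniz := fun n a m ha => by
      change (0 : k) = aug hA (A.d a) * m + (-1 : k) ^ n • (aug hA a * 0)
      have : aug hA (A.d a) = 0 := by
        by_cases hn : n + 1 = 0
        · rw [hA.neg n (by omega), Submodule.mem_bot] at ha
          rw [ha, map_zero, map_zero]
        · exact augFun_of_ne hA hn (A.d_mem n a ha)
      rw [this]; simp }

/-- A connected DG algebra is Koszul if the trivial module `k` has a minimal semi-free resolution
with a semi-basis concentrated in degree `0`. -/
def IsKoszul {A : DGAlg k} (hA : IsConnected A.toGrAlg) : Prop :=
  ∃ (F : DGMod A) (f : dgHom F (DGMod.trivial hA)), IsSemifreeResolution f ∧ IsMinimalDG F ∧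
    ∃ (ι : Type u) (b : Module.Basis ι A.carrier F.carrier) (r : ι → ℕ), IsSemibasis b r ∧
      ∀ i, b i ∈ F.grading 0

end Connected

/-! ### The cohomology algebra -/

section CohomologyAlgebra

theorem leibniz' (A : DGAlg k) (a b : A.carrier) :
    A.d (a * b) = A.d a * b + twist A.grading 1 a * A.d b := by
  induction a using hom_induction A.grading with
  | h0 => simp
  | hadd x y hx hy => simp only [add_mul, map_add, hx, hy]; abel
  | hh i a ha => rw [A.leibniz i a b ha, twist_of_mem _ _ ha, one_mul, smul_mul_assoc]

theorem d_one (A : DGAlg k) : A.d 1 = 0 := by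
  have := A.leibniz 0 1 1 (one_mem' A.toGrAlg)
  simpa using this

theorem d_twist (A : DGAlg k) (a : A.carrier) :
    A.d (twist A.grading 1 a) = - twist A.grading 1 (A.d a) := by
  induction a using hom_induction A.grading with
  | h0 => simp
  | hadd x y hx hy => simp only [map_add, hx, hy]; abel
  | hh i a ha =>
    rw [twist_of_mem _ _ ha, twist_of_mem _ _ (A.d_mem _ _ ha), map_smul, one_mul, one_mul, sgn_add]
    simp

theorem twist_twist (A : DGAlg k) (a : A.carrier) :
    twist A.grading 1 (twist A.grading 1 a) = a := by
  induction a using hom_induction A.grading with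
  | h0 => simp
  | hadd x y hx hy => simp only [map_add, hx, hy]
  | hh i a ha => rw [twist_of_mem _ _ ha, map_smul, twist_of_mem _ _ ha, smul_smul, sgn_sq, one_smul]

theorem d_proj (A : DGAlg k) (n : ℤ) (a : A.carrier) :
    A.d (proj A.grading n a) = proj A.grading (n + 1) (A.d a) := by
  induction a using hom_induction A.grading with
  | h0 => simp
  | hadd x y hx hy => simp only [map_add, hx, hy]
  | hh i a ha =>
    by_cases h : i = n
    · subst h; rw [proj_same _ ha, proj_same _ (A.d_mem _ _ ha)]
    · rw [proj_ne _ ha h, proj_ne _ (A.d_mem _ _ ha) (by omega), map_zero]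

/-- The subalgebra of cocycles. -/
def cocycles (A : DGAlg k) : Subalgebra k A.carrier where
  carrier := {z | A.d z = 0}
  mul_mem' := fun {a b} (ha : A.d a = 0) (hb : A.d b = 0) => by
    change A.d (a * b) = 0
    rw [leibniz', ha, hb]; simp
  add_mem' := fun {a b} (ha : A.d a = 0) (hb : A.d b = 0) => by
    change A.d (a + b) = 0
    rw [map_add, ha, hb, add_zero]
  algebraMap_mem' := fun r => by
    change A.d _ = 0
    rw [Algebra.algebraMap_eq_smul_one, map_smul, d_one, smul_zero]

/-- The two-sided ideal of coboundaries in the algebra of cocycles. -/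
def coboundaries (A : DGAlg k) : Ideal (cocycles A) where
  carrier := {z | ∃ a, A.d a = z.1}
  zero_mem' := ⟨0, by simp⟩
  add_mem' := by
    rintro z w ⟨a, ha⟩ ⟨b, hb⟩
    exact ⟨a + b, by rw [map_add, ha, hb]; rfl⟩
  smul_mem' := by
    rintro ⟨z, (hz : A.d z = 0)⟩ w ⟨b, hb⟩
    refine ⟨twist A.grading 1 z * b, ?_⟩
    rw [leibniz', d_twist, hz, twist_twist, hb]
    simp

instance (A : DGAlg k) : (coboundaries A).IsTwoSided where
  mul_mem_of_left := by
    rintro z ⟨w, (hw : A.d w = 0)⟩ ⟨a, ha⟩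
    refine ⟨a * w, ?_⟩
    rw [leibniz', hw, ha]
    simp

/-- The underlying ring of the cohomology algebra. -/
abbrev HCarrier (A : DGAlg k) : Type u := cocycles A ⧸ coboundaries A

/-- The cohomology class of a cocycle. -/
def cls {A : DGAlg k} (a : A.carrier) (ha : A.d a = 0) : HCarrier A :=
  Ideal.Quotient.mk (coboundaries A) ⟨a, ha⟩

/-- The degree `n` part of the cohomology consists of the classes of cocycles of degree `n`. -/
def hGrading (A : DGAlg k) (n : ℤ) : Submodule k (HCarrier A) :=
  ((A.grading n).comap (cocycles A).val.toLinearMap).map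
    (Ideal.Quotient.mkₐ k (coboundaries A)).toLinearMap

/-- The projection of cocycles onto their degree `n` component. -/
def zProj (A : DGAlg k) (n : ℤ) : cocycles A →ₗ[k] cocycles A :=
  ((proj A.grading n) ∘ₗ (cocycles A).val.toLinearMap).codRestrict
    (Subalgebra.toSubmodule (cocycles A)) (by
      rintro ⟨z, (hz : A.d z = 0)⟩
      change A.d (proj A.grading n z) = 0
      rw [d_proj, hz, map_zero])

/-- The projection of the cohomology onto its degree `n` part. -/
def hProj (A : DGAlg k) (n : ℤ) : HCarrier A →ₗ[k] HCarrier A :=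
  ((coboundaries A).restrictScalars k).liftQ
    ((Ideal.Quotient.mkₐ k (coboundaries A)).toLinearMap ∘ₗ zProj A n) (by
      rintro ⟨z, hz⟩ ⟨a, (ha : A.d a = z)⟩
      rw [LinearMap.mem_ker]
      refine Ideal.Quotient.eq_zero_iff_mem.2 ⟨proj A.grading (n - 1) a, ?_⟩
      rw [d_proj, sub_add_cancel, ha]
      rfl) ∘ₗ (Submodule.Quotient.restrictScalarsEquiv k (coboundaries A)).symm.toLinearMap

theorem hProj_mk (A : DGAlg k) (n : ℤ) (z : cocycles A) :
    hProj A n (Ideal.Quotient.mk (coboundaries A) z) =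
      Ideal.Quotient.mk (coboundaries A) (zProj A n z) := rfl

instance (A : DGAlg k) : GradedAlgebra (hGrading A) where
  one_mem := ⟨1, one_mem' A.toGrAlg, map_one (Ideal.Quotient.mkₐ k (coboundaries A))⟩
  mul_mem := by
    rintro m n _ _ ⟨z, hz, rfl⟩ ⟨w, hw, rfl⟩
    exact ⟨z * w, mul_mem' A.toGrAlg hz hw, map_mul (Ideal.Quotient.mkₐ k (coboundaries A)) z w⟩
  toDecomposition := decompositionOfProj (hGrading A) (hProj A)
    (by
      rintro n _ ⟨z, hz, rfl⟩
      change hProj A n (Ideal.Quotient.mk (coboundaries A) z) = Ideal.Quotient.mk _ z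
      rw [hProj_mk]
      congr 1
      exact Subtype.ext (proj_same A.grading hz))
    (by
      rintro i n hin _ ⟨z, hz, rfl⟩
      change hProj A n (Ideal.Quotient.mk (coboundaries A) z) = 0
      rw [hProj_mk]
      have : zProj A n z = 0 := Subtype.ext (proj_ne A.grading hz hin)
      rw [this, map_zero])
    (by
      classical
      intro x
      obtain ⟨z, rfl⟩ := Ideal.Quotient.mk_surjective x
      have : z = ∑ i ∈ (DirectSum.decompose A.grading z.1).support, zProj A i z := by
        apply Subtype.ext
        rw [AddSubmonoidClass.coe_finsetSum]
        exact (DirectSum.sum_support_decompose A.grading z.1).symm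
      rw [this, map_sum]
      exact Submodule.sum_mem _ fun i _ => Submodule.mem_iSup_of_mem i
        ⟨zProj A i z, proj_mem A.grading i z.1, rfl⟩)

/-- The cohomology algebra of a DG algebra. -/
abbrev DGAlg.H (A : DGAlg k) : GrAlg k where
  carrier := HCarrier A
  grading := hGrading A

end CohomologyAlgebra

/-! ### Global dimension of graded algebras -/

section GlobalDimension

variable {R : GrAlg k}

/-- Morphisms of graded modules preserve degrees. -/
def IsGrHom {M N : GrMod R} (f : M.carrier →ₗ[R.carrier] N.carrier) : Prop :=
  ∀ n, ∀ m ∈ M.grading n, f m ∈ N.grading n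

/-- Projective objects of the category of graded modules. -/
def IsGrProjective (P : GrMod R) : Prop :=
  ∀ (M N : GrMod R) (g : M.carrier →ₗ[R.carrier] N.carrier)
    (f : P.carrier →ₗ[R.carrier] N.carrier), IsGrHom g → IsGrHom f → Function.Surjective g →
    ∃ h : P.carrier →ₗ[R.carrier] M.carrier, IsGrHom h ∧ g ∘ₗ h = f

/-- `M` has a graded projective resolution `0 → P_n → ⋯ → P_0 → M → 0`. -/
def HasGrProjDimLE : ℕ → GrMod R → Prop
  | 0, M => IsGrProjective M
  | n + 1, M => ∃ (K P : GrMod R) (i : K.carrier →ₗ[R.carrier] P.carrier)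
      (q : P.carrier →ₗ[R.carrier] M.carrier), IsGrProjective P ∧ IsGrHom i ∧ IsGrHom q ∧
      Function.Injective i ∧ Function.Exact i q ∧ Function.Surjective q ∧ HasGrProjDimLE n K

/-- The projective dimension of a graded module. -/
def grProjDim (M : GrMod R) : ℕ∞ := sInf {c : ℕ∞ | ∃ n : ℕ, HasGrProjDimLE n M ∧ c = n}

/-- The (left) global dimension of a graded algebra. -/
def grGlobalDim (R : GrAlg k) : ℕ∞ := ⨆ M : GrMod R, grProjDim M

end GlobalDimension

/-! ### The algebra `k⟨x, y⟩` with `d x = y ^ 2` and `d y = 0` -/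

section Example

variable (k)

/-- The free algebra `k⟨x, y⟩`. -/
abbrev FA : Type u := FreeAlgebra k (Fin 2)

/-- The generator `x`. -/
abbrev gx : FA k := FreeAlgebra.ι k 0

/-- The generator `y`. -/
abbrev gy : FA k := FreeAlgebra.ι k 1

/-- The degree `n` part of `k⟨x, y⟩` is spanned by the words of length `n`. -/
def faGrading (n : ℤ) : Submodule k (FA k) :=
  Submodule.span k {w | ∃ l : List (Fin 2), (l.length : ℤ) = n ∧
    w = (l.map (FreeAlgebra.ι k)).prod}

variable {k}

theorem word_mem (l : List (Fin 2)) : (l.map (FreeAlgebra.ι k)).prod ∈ faGrading k l.length :=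
  Submodule.subset_span ⟨l, rfl, rfl⟩

theorem ι_mem (i : Fin 2) : FreeAlgebra.ι k i ∈ faGrading k 1 := by
  simpa using word_mem (k := k) [i]

instance : SetLike.GradedMonoid (faGrading k) where
  one_mem := by simpa using word_mem (k := k) []
  mul_mem := by
    intro m n a b ha hb
    have h := Submodule.mul_mem_mul ha hb
    rw [faGrading, faGrading, Submodule.span_mul_span] at h
    refine Submodule.span_mono ?_ h
    rintro _ ⟨_, ⟨l, hl, rfl⟩, _, ⟨l', hl', rfl⟩, rfl⟩
    exact ⟨l ++ l', by simp [hl, hl'], by simp⟩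

/-- The decomposition of words by their length. -/
def faDecomp : FA k →ₐ[k] ⨁ n, faGrading k n :=
  FreeAlgebra.lift k fun i => DirectSum.of (fun n => faGrading k n) 1 ⟨FreeAlgebra.ι k i, ι_mem i⟩

theorem faDecomp_word (l : List (Fin 2)) :
    faDecomp (l.map (FreeAlgebra.ι k)).prod =
      DirectSum.of (fun n => faGrading k n) l.length ⟨_, word_mem l⟩ := by
  induction l with
  | nil => simp only [List.map_nil, List.prod_nil, map_one]; rfl
  | cons i l ih =>
    simp only [List.map_cons, List.prod_cons, map_mul]
    rw [ih, faDecomp, FreeAlgebra.lift_ι_apply, DirectSum.of_mul_of]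
    refine DirectSum.of_eq_of_gradedMonoid_eq (Sigma.subtype_ext ?_ ?_)
    · change (1 : ℤ) + l.length = ((l.length + 1 : ℕ) : ℤ)
      push_cast; ring
    · rfl

instance : GradedAlgebra (faGrading k) :=
  GradedAlgebra.ofAlgHom _ faDecomp
    (by
      ext i
      simp [faDecomp])
    (by
      rintro n ⟨w, hw⟩
      change faDecomp w = _
      induction hw using Submodule.span_induction with
      | mem w h =>
        obtain ⟨l, rfl, rfl⟩ := h
        exact faDecomp_word l
      | zero => rw [map_zero]; exact (map_zero (DirectSum.of (fun n => faGrading k n) n)).symm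
      | add x y hx hy ihx ihy => rw [map_add, ihx, ihy, ← map_add]; rfl
      | smul r x hx ih =>
        rw [map_smul, ih, ← DirectSum.lof_eq_of k, ← DirectSum.lof_eq_of k, ← map_smul]; rfl)

/-- The algebra map `a ↦ [[(-1) ^ |a| a, d a], [0, a]]` encoding the twisted derivation `d`. -/
def faMat : FA k →ₐ[k] Matrix (Fin 2) (Fin 2) (FA k) :=
  FreeAlgebra.lift k ![!![-gx k, gy k ^ 2; 0, gx k], !![-gy k, 0; 0, gy k]]

theorem faMat_mul (i j : Fin 2) (a b : FA k) :
    faMat (a * b) i j = faMat a i 0 * faMat b 0 j + faMat a i 1 * faMat b 1 j := by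
  rw [map_mul, Matrix.mul_apply, Fin.sum_univ_two]

theorem faMat_ι (i : Fin 2) : faMat (FreeAlgebra.ι k i) =
    (![!![-gx k, gy k ^ 2; 0, gx k], !![-gy k, 0; 0, gy k]] i : Matrix _ _ (FA k)) := by
  rw [faMat, FreeAlgebra.lift_ι_apply]

theorem faMat_one_zero (a : FA k) : faMat a 1 0 = 0 := by
  induction a using FreeAlgebra.induction with
  | grade0 r => rw [AlgHom.commutes, Matrix.algebraMap_matrix_apply]; simp
  | grade1 i => rw [faMat_ι]; fin_cases i <;> simp
  | mul a b ha hb => rw [faMat_mul, ha, hb]; simp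
  | add a b ha hb => rw [map_add, Matrix.add_apply, ha, hb, add_zero]

theorem faMat_one_one (a : FA k) : faMat a 1 1 = a := by
  induction a using FreeAlgebra.induction with
  | grade0 r => rw [AlgHom.commutes, Matrix.algebraMap_matrix_apply]; simp
  | grade1 i => rw [faMat_ι]; fin_cases i <;> simp
  | mul a b ha hb => rw [faMat_mul, ha, hb, faMat_one_zero]; simp
  | add a b ha hb => rw [map_add, Matrix.add_apply, ha, hb]

variable (k) in
/-- The differential of `k⟨x, y⟩` with `d x = y ^ 2` and `d y = 0`. -/
def faD : FA k →ₗ[k] FA k where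
  toFun a := faMat a 0 1
  map_add' a b := by rw [map_add, Matrix.add_apply]
  map_smul' r a := by rw [map_smul, Matrix.smul_apply]; rfl

theorem faD_x : faD k (gx k) = gy k ^ 2 := by
  change faMat (gx k) 0 1 = _
  rw [faMat_ι]; simp

theorem faD_y : faD k (gy k) = 0 := by
  change faMat (gy k) 0 1 = _
  rw [faMat_ι]; simp

theorem faMat_zero_zero (n : ℤ) (a : FA k) (ha : a ∈ faGrading k n) :
    faMat a 0 0 = (-1 : k) ^ n • a := by
  induction ha using Submodule.span_induction with
  | mem w h =>
    obtain ⟨l, rfl, rfl⟩ := h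
    induction l with
    | nil => simp
    | cons i l ih =>
      simp only [List.map_cons, List.prod_cons, List.length_cons]
      rw [faMat_mul, ih, faMat_one_zero]
      have h : faMat (FreeAlgebra.ι k i) 0 0 = - FreeAlgebra.ι k i := by
        rw [faMat_ι]; fin_cases i <;> simp
      rw [h]
      push_cast
      rw [sgn_add]
      simp
  | zero => simp
  | add x y hx hy ihx ihy => rw [map_add, Matrix.add_apply, ihx, ihy, smul_add]
  | smul r x hx ih => rw [map_smul, Matrix.smul_apply, ih, smul_comm]

theorem faD_mul (n : ℤ) (a b : FA k) (ha : a ∈ faGrading k n) :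
    faD k (a * b) = faD k a * b + (-1 : k) ^ n • (a * faD k b) := by
  change faMat (a * b) 0 1 = faMat a 0 1 * b + (-1 : k) ^ n • (a * faMat b 0 1)
  rw [faMat_mul, faMat_zero_zero n a ha, faMat_one_one, smul_mul_assoc, add_comm]

theorem faD_ι_mem (i : Fin 2) : faD k (FreeAlgebra.ι k i) ∈ faGrading k (1 + 1) := by
  fin_cases i
  · change faD k (gx k) ∈ _
    rw [faD_x, pow_two]
    exact SetLike.GradedMul.mul_mem (ι_mem 1) (ι_mem 1)
  · change faD k (gy k) ∈ _
    rw [faD_y]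
    exact Submodule.zero_mem _

theorem faD_ι_ι (i : Fin 2) : faD k (faD k (FreeAlgebra.ι k i)) = 0 := by
  fin_cases i
  · change faD k (faD k (gx k)) = _
    rw [faD_x, pow_two, faD_mul 1 _ _ (ι_mem 1), faD_y]
    simp
  · change faD k (faD k (gy k)) = _
    rw [faD_y, map_zero]

theorem faD_one : faD k 1 = 0 := by
  change faMat 1 0 1 = 0
  rw [map_one]; simp

theorem faD_mem (n : ℤ) (a : FA k) (ha : a ∈ faGrading k n) : faD k a ∈ faGrading k (n + 1) := by
  induction ha using Submodule.span_induction with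
  | mem w h =>
    obtain ⟨l, rfl, rfl⟩ := h
    induction l with
    | nil => simp only [List.map_nil, List.prod_nil, faD_one]; exact Submodule.zero_mem _
    | cons i l ih =>
      simp only [List.map_cons, List.prod_cons, List.length_cons]
      rw [faD_mul 1 _ _ (ι_mem i)]
      have h1 := SetLike.GradedMul.mul_mem (faD_ι_mem (k := k) i) (word_mem l)
      have h2 := SetLike.GradedMul.mul_mem (ι_mem (k := k) i) ih
      have e1 : (1 + 1 + l.length : ℤ) = ((l.length + 1 : ℕ) : ℤ) + 1 := by push_cast; ring
      have e2 : (1 + (l.length + 1) : ℤ) = ((l.length + 1 : ℕ) : ℤ) + 1 := by push_cast; ring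
      rw [e1] at h1
      rw [e2] at h2
      exact Submodule.add_mem _ h1 (Submodule.smul_mem _ _ h2)
  | zero => rw [map_zero]; exact Submodule.zero_mem _
  | add x y hx hy ihx ihy => rw [map_add]; exact Submodule.add_mem _ ihx ihy
  | smul r x hx ih => rw [map_smul]; exact Submodule.smul_mem _ _ ih

theorem faD_faD (a : FA k) : faD k (faD k a) = 0 := by
  induction a using hom_induction (faGrading k) with
  | h0 => simp
  | hadd x y hx hy => rw [map_add, map_add, hx, hy, add_zero]
  | hh n a ha =>
    induction ha using Submodule.span_induction with
    | mem w h =>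
      obtain ⟨l, rfl, rfl⟩ := h
      induction l with
      | nil => simp [faD_one]
      | cons i l ih =>
        simp only [List.map_cons, List.prod_cons]
        rw [faD_mul 1 _ _ (ι_mem i), map_add, map_smul, faD_mul 1 _ _ (ι_mem i),
          faD_mul _ _ _ (faD_ι_mem i), ih, faD_ι_ι]
        simp
    | zero => simp
    | add x y hx hy ihx ihy => rw [map_add, map_add, ihx, ihy, add_zero]
    | smul r x hx ih => rw [map_smul, map_smul, ih, smul_zero]

variable (k) in
/-- The DG algebra `k⟨x, y⟩` with `|x| = |y| = 1`, `d x = y ^ 2` and `d y = 0`. -/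
def exDG : DGAlg k where
  carrier := FA k
  grading := faGrading k
  d := faD k
  d_mem := faD_mem
  d_d := faD_faD
  leibniz := faD_mul

theorem exDG_connected : IsConnected (exDG k).toGrAlg where
  nontrivial := inferInstanceAs (Nontrivial (FreeAlgebra k (Fin 2)))
  neg := by
    intro n hn
    change faGrading k n = ⊥
    rw [faGrading, Submodule.span_eq_bot]
    rintro _ ⟨l, hl, rfl⟩
    omega
  zero := by
    change faGrading k 0 = _
    rw [faGrading]
    congr 1
    ext w
    constructor
    · rintro ⟨l, hl, rfl⟩
      have : l = [] := List.length_eq_zero_iff.1 (by omega)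
      subst this
      simp
      rfl
    · rintro (rfl : w = 1)
      exact ⟨[], by simp, by simp⟩

theorem exDG_d_y : (exDG k).d (gy k) = 0 := faD_y

theorem exDG_d_v : (exDG k).d (gx k * gy k + gy k * gx k) = 0 := by
  change faD k (gx k * gy k + gy k * gx k) = 0
  rw [map_add, faD_mul 1 _ _ (ι_mem 0), faD_mul 1 _ _ (ι_mem 1), faD_x, faD_y]
  simp only [mul_zero, smul_zero, zero_mul, zpow_one, neg_smul, one_smul]
  noncomm_ring

end Example

end

end DGA

open DGA

/-! Upper bounds. A module $H$ over a free algebra has the two-term resolution $0\to A\otimes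
V\otimes H\to A\otimes H\to H\to 0$, where $V$ is spanned by the generators; the Fox derivatives
contract it (`fox_koszulSum`, `koszulSum_fox`). This lifts to DG modules. A DG module $M$ contracts
onto its cohomology $H$ by a homotopy $s$ (`exists_splitting`), and $y$ and $x+ysy$ induce operators
$Y$ and $X$ on $H$. A resolution of $M$ has three cells $e_h, e^y_h, e^x_h$ for each basis element
$h$ of $H$, all in the degree of $h$, with $de_h=0$, $de^y_h=ye_h-e_{Yh}$ and
$de^x_h=xe_h-e_{Xh}+ye^y_h-e^y_{Yh}$. Here $d^2=0$ because $Y^2=0$, which holds because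
$y^2=\partial x$. Modulo the internal differential and the lower-order term of $de^x$ this is the
standard resolution, so it is a quasi-isomorphism (`isQuasiIso_of_cells`). The ranks are 0, 1, 2, so
every cone length is at most 2. For $M=k$ both operators vanish, which gives the Koszul property.
The same pattern with the elements $v\otimes1-1\otimes v$ gives a resolution of $A$ over $A^e$ with
three cells, hence smoothness.

Lower bounds. A map out of a semi-free module of class at most 1 is null-homotopic if it is a
composite of two maps that vanish on cohomology (`exists_homotopy_of_ghost`). In a five-dimensional
test module the map $k\to\langle n\rangle$ is such a composite, through $\langle n,p,q\rangle$. In a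
resolution of $k$ there are $u,v,w$ with $du=0$, $dv=yu$, $dw=xu+yv$, where $u$ lifts $1$, and
evaluating a null-homotopy on them is contradictory (`two_le_coneLength`). The map $A^e\to A$,
$a\otimes b\mapsto\varepsilon(b)a$, transports the argument to the bimodule $A$.

Cohomology. An element of positive degree is uniquely $xa+yb$, and $d$ sends $(a,b)$ to
$(-da,\,ya-db)$. Induction on the degree shows that $H^n$ is one-dimensional, spanned by $y^{n\bmod
2}v^{\lfloor n/2\rfloor}$ with $v=xy+yx$ (`cohomology_gv_pow`). Since $y^2=dx$ and $yv-vy=d(x^2)$,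
this is $k[Y,V]/(Y^2)$.

Infinite global dimension. On $k[Y,V]/(Y^2)$ the kernel of $Y$ equals its image. This passes to
projectives and then to all modules of finite projective dimension (`HasGrProjDimLE.isExactAt`), but
it fails for $k$, where $Y$ acts as zero. -/

namespace DGA

noncomputable section

variable {k : Type u} [Field k]

/-! ### Signs -/

section Signs

variable {M : Type u} [AddCommGroup M] [Module k M]

theorem twist_mem (ℳ : ℤ → Submodule k M) [DirectSum.Decomposition ℳ] {n : ℤ} {m : M}
    (hm : m ∈ ℳ n) : twist ℳ 1 m ∈ ℳ n := by
  rw [twist_of_mem _ _ hm]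
  exact Submodule.smul_mem _ _ hm

theorem twist_one_one (ℳ : ℤ → Submodule k M) [DirectSum.Decomposition ℳ] {m : M}
    (hm : m ∈ ℳ 1) : twist ℳ 1 m = -m := by
  rw [twist_of_mem _ _ hm]; simp

theorem twist_one_zero (ℳ : ℤ → Submodule k M) [DirectSum.Decomposition ℳ] {m : M}
    (hm : m ∈ ℳ 0) : twist ℳ 1 m = m := by
  rw [twist_of_mem _ _ hm]; simp

theorem twist_mul (A : GrAlg k) (a b : A.carrier) :
    twist A.grading 1 (a * b) = twist A.grading 1 a * twist A.grading 1 b := by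
  induction a using hom_induction A.grading with
  | h0 => simp
  | hadd x y hx hy => simp only [add_mul, map_add, hx, hy]
  | hh i a ha =>
    induction b using hom_induction A.grading with
    | h0 => simp
    | hadd x y hx hy => simp only [mul_add, map_add, hx, hy]
    | hh j b hb =>
      rw [twist_of_mem _ _ ha, twist_of_mem _ _ hb, twist_of_mem _ _ (mul_mem' A ha hb),
        smul_mul_smul_comm, ← sgn_add]
      congr 2; ring

/-- With the sign absorbed into `twist`, the Leibniz rule is linear in the coefficient, so later
computations need not split it into homogeneous parts. -/
theorem DGMod.d_smul {A : DGAlg k} (M : DGMod A) (a : A.carrier) (m : M.carrier) :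
    M.d (a • m) = A.d a • m + twist A.grading 1 a • M.d m := by
  induction a using hom_induction A.grading with
  | h0 => simp
  | hadd x y hx hy => simp only [add_smul, map_add, hx, hy]; abel
  | hh i a ha => rw [M.leibniz i a m ha, twist_of_mem _ _ ha, one_mul, smul_assoc]

theorem DGMod.d_proj {A : DGAlg k} (M : DGMod A) (n : ℤ) (m : M.carrier) :
    M.d (proj M.grading n m) = proj M.grading (n + 1) (M.d m) := by
  induction m using hom_induction M.grading with
  | h0 => simp
  | hadd x y hx hy => simp only [map_add, hx, hy]
  | hh i a ha =>
    by_cases h : i = n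
    · subst h; rw [proj_same _ ha, proj_same _ (M.d_mem _ _ ha)]
    · rw [proj_ne _ ha h, proj_ne _ (M.d_mem _ _ ha) (by omega), map_zero]

theorem dgHom_proj {A : DGAlg k} {M N : DGMod A} (f : dgHom M N) (n : ℤ) (m : M.carrier) :
    f.1 (proj M.grading n m) = proj N.grading n (f.1 m) := by
  induction m using hom_induction M.grading with
  | h0 => simp
  | hadd x y hx hy => simp only [map_add, hx, hy]
  | hh i a ha =>
    by_cases h : i = n
    · subst h; rw [proj_same _ ha, proj_same _ (f.2.1 _ _ ha)]
    · rw [proj_ne _ ha h, proj_ne _ (f.2.1 _ _ ha) h, map_zero]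

end Signs

/-! ### Quasi-isomorphisms -/

/-- The two clauses are injectivity and surjectivity on cohomology, read off on representatives. -/
theorem isQuasiIso_iff {A : DGAlg k} {M N : DGMod A} (f : dgHom M N) :
    IsQuasiIso f ↔
      (∀ m, M.d m = 0 → (∃ n, N.d n = f.1 m) → ∃ m', M.d m' = m) ∧
      (∀ n, N.d n = 0 → ∃ m, M.d m = 0 ∧ ∃ n', N.d n' = n - f.1 m) := by
  unfold IsQuasiIso
  refine and_congr ?_ ?_
  · rw [injective_iff_map_eq_zero]
    constructor
    · rintro h m hm ⟨n, hn⟩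
      have := h (Submodule.Quotient.mk ⟨m, hm⟩) ((Submodule.Quotient.mk_eq_zero _).2 ⟨n, hn⟩)
      exact (Submodule.Quotient.mk_eq_zero _).1 this
    · intro h z hz
      obtain ⟨⟨m, hm⟩, rfl⟩ := Submodule.Quotient.mk_surjective _ z
      exact (Submodule.Quotient.mk_eq_zero _).2
        (h m hm ((Submodule.Quotient.mk_eq_zero _).1 hz))
  · constructor
    · intro h n hn
      obtain ⟨z, hz⟩ := h (Submodule.Quotient.mk ⟨n, hn⟩)
      obtain ⟨⟨m, hm⟩, rfl⟩ := Submodule.Quotient.mk_surjective _ z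
      exact ⟨m, hm, (Submodule.Quotient.eq _).1 hz.symm⟩
    · intro h z
      obtain ⟨⟨n, hn⟩, rfl⟩ := Submodule.Quotient.mk_surjective _ z
      obtain ⟨m, hm, n', hn'⟩ := h n hn
      refine ⟨Submodule.Quotient.mk ⟨m, hm⟩, Eq.symm ?_⟩
      exact (Submodule.Quotient.eq _).2 ⟨n', hn'⟩

/-! ### Free graded modules and free modules with a twisted differential -/

section Free

/-- The grading of a free module with basis elements of the given degrees. -/
def freeGrading (R : GrAlg k) {ι : Type u} (deg : ι → ℤ) (n : ℤ) :
    Submodule k (ι →₀ R.carrier) where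
  carrier := {x | ∀ i, x i ∈ R.grading (n - deg i)}
  zero_mem' := fun _ => Submodule.zero_mem _
  add_mem' := fun hx hy i => Submodule.add_mem _ (hx i) (hy i)
  smul_mem' := fun r _ hx i => Submodule.smul_mem _ r (hx i)

theorem single_mem_free {R : GrAlg k} {ι : Type u} {deg : ι → ℤ} {n : ℤ} (i : ι) {a : R.carrier}
    (ha : a ∈ R.grading n) {m : ℤ} (hm : m = n + deg i) :
    Finsupp.single i a ∈ freeGrading R deg m := by
  classical
  subst hm
  intro j
  by_cases h : i = j
  · subst h; simpa using ha
  · simp [Finsupp.single_eq_of_ne' h]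

theorem smul_mem_free {R : GrAlg k} {ι : Type u} {deg : ι → ℤ} {m n l : ℤ} {a : R.carrier}
    {x : ι →₀ R.carrier} (ha : a ∈ R.grading m) (hx : x ∈ freeGrading R deg n) (h : m + n = l) :
    a • x ∈ freeGrading R deg l := by
  intro i
  have := mul_mem' R ha (hx i)
  rwa [← add_sub_assoc, h] at this

/-- The projection of a free module onto its degree `n` part. -/
def freeProj (R : GrAlg k) {ι : Type u} (deg : ι → ℤ) (n : ℤ) :
    (ι →₀ R.carrier) →ₗ[k] (ι →₀ R.carrier) :=
  Finsupp.lsum k fun i => Finsupp.lsingle i ∘ₗ proj R.grading (n - deg i)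

theorem freeProj_apply (R : GrAlg k) {ι : Type u} (deg : ι → ℤ) (n : ℤ) (x : ι →₀ R.carrier)
    (i : ι) : freeProj R deg n x i = proj R.grading (n - deg i) (x i) := by
  classical
  induction x using Finsupp.induction_linear with
  | zero => simp
  | add x y hx hy => simp only [map_add, Finsupp.add_apply, hx, hy]
  | single j a =>
    rw [freeProj, Finsupp.lsum_single, LinearMap.comp_apply, Finsupp.lsingle_apply]
    by_cases h : j = i
    · subst h; simp
    · simp [Finsupp.single_eq_of_ne' h]

instance (R : GrAlg k) {ι : Type u} (deg : ι → ℤ) :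
    DirectSum.Decomposition (freeGrading R deg) :=
  decompositionOfProj _ (freeProj R deg)
    (fun n x hx => Finsupp.ext fun i => by rw [freeProj_apply, proj_same _ (hx i)])
    (fun j n hjn x hx => Finsupp.ext fun i => by
      rw [freeProj_apply, proj_ne _ (hx i) (by omega)]; rfl)
    (fun x => by
      induction x using Finsupp.induction_linear with
      | zero => exact Submodule.zero_mem _
      | add x y hx hy => exact Submodule.add_mem _ hx hy
      | single i a =>
        induction a using hom_induction R.grading with
        | h0 => rw [Finsupp.single_zero]; exact Submodule.zero_mem _
        | hadd a b ha hb => rw [Finsupp.single_add]; exact Submodule.add_mem _ ha hb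
        | hh n a ha =>
          exact Submodule.mem_iSup_of_mem (n + deg i) (single_mem_free i ha rfl))

theorem proj_free_apply (R : GrAlg k) {ι : Type u} (deg : ι → ℤ) (n : ℤ) (x : ι →₀ R.carrier)
    (i : ι) : proj (freeGrading R deg) n x i = proj R.grading (n - deg i) (x i) := by
  induction x using hom_induction (freeGrading R deg) with
  | h0 => simp
  | hadd x y hx hy => simp only [map_add, Finsupp.add_apply, hx, hy]
  | hh m x hx =>
    by_cases h : m = n
    · subst h; rw [proj_same _ hx, proj_same _ (hx i)]
    · rw [proj_ne _ hx h, proj_ne _ (hx i) (by omega)]; rfl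

/-- The graded free module with basis elements of the given degrees. -/
abbrev GrMod.free (R : GrAlg k) {ι : Type u} (deg : ι → ℤ) : GrMod R where
  carrier := ι →₀ R.carrier
  grading := freeGrading R deg
  smul_mem := fun _ _ _ _ ha hm => smul_mem_free ha hm rfl

variable {A : DGAlg k} {ι : Type u}

/-- The linear map with `a • eᵢ ↦ (-1) ^ |a| • a τᵢ`. -/
def signedLift (A : GrAlg k) {N : Type u} [AddCommGroup N] [Module k N]
    (Θ : A.carrier →ₐ[k] Module.End k N) (τ : ι → N) : (ι →₀ A.carrier) →ₗ[k] N :=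
  Finsupp.lsum k fun i => (Θ.toLinearMap.flip (τ i)) ∘ₗ twist A.grading 1

theorem signedLift_single (A : GrAlg k) {N : Type u} [AddCommGroup N] [Module k N]
    (Θ : A.carrier →ₐ[k] Module.End k N) (τ : ι → N) (i : ι) (a : A.carrier) :
    signedLift A Θ τ (Finsupp.single i a) = Θ (twist A.grading 1 a) (τ i) := by
  simp [signedLift]

theorem signedLift_smul (A : GrAlg k) {N : Type u} [AddCommGroup N] [Module k N]
    (Θ : A.carrier →ₐ[k] Module.End k N) (τ : ι → N) (a : A.carrier) (x : ι →₀ A.carrier) :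
    signedLift A Θ τ (a • x) = Θ (twist A.grading 1 a) (signedLift A Θ τ x) := by
  induction x using Finsupp.induction_linear with
  | zero => simp
  | add x y hx hy => simp only [smul_add, map_add, hx, hy]
  | single i b =>
    rw [Finsupp.smul_single, signedLift_single, signedLift_single, smul_eq_mul, twist_mul, map_mul]
    rfl

/-- The differential of a free module with `eᵢ ↦ δᵢ`. -/
def freeD (A : DGAlg k) (δ : ι → ι →₀ A.carrier) : (ι →₀ A.carrier) →ₗ[k] (ι →₀ A.carrier) :=
  Finsupp.mapRange.linearMap A.d +
    signedLift A.toGrAlg (Algebra.lsmul k k (ι →₀ A.carrier)) δ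

theorem freeD_single (δ : ι → ι →₀ A.carrier) (i : ι) (a : A.carrier) :
    freeD A δ (Finsupp.single i a) =
      Finsupp.single i (A.d a) + twist A.grading 1 a • δ i := by
  rw [freeD, LinearMap.add_apply, signedLift_single, Finsupp.mapRange.linearMap_apply,
    Finsupp.mapRange_single]
  rfl

theorem freeD_smul (δ : ι → ι →₀ A.carrier) (a : A.carrier) (x : ι →₀ A.carrier) :
    freeD A δ (a • x) = A.d a • x + twist A.grading 1 a • freeD A δ x := by
  induction x using Finsupp.induction_linear with
  | zero => simp
  | add x y hx hy => simp only [smul_add, map_add, hx, hy]; abel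
  | single i b =>
    rw [Finsupp.smul_single, freeD_single, freeD_single, smul_eq_mul, twist_mul, leibniz',
      Finsupp.single_add, smul_add, Finsupp.smul_single, Finsupp.smul_single, smul_eq_mul,
      smul_eq_mul, mul_smul, add_assoc]

theorem freeD_single_one (δ : ι → ι →₀ A.carrier) (i : ι) :
    freeD A δ (Finsupp.single i 1) = δ i := by
  rw [freeD_single, d_one, twist_one_zero _ (one_mem' A.toGrAlg)]
  simp

theorem freeD_mem {deg : ι → ℤ} {δ : ι → ι →₀ A.carrier}
    (hδ : ∀ i, δ i ∈ freeGrading A.toGrAlg deg (deg i + 1)) (n : ℤ) (x : ι →₀ A.carrier)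
    (hx : x ∈ freeGrading A.toGrAlg deg n) : freeD A δ x ∈ freeGrading A.toGrAlg deg (n + 1) := by
  rw [← Finsupp.sum_single x, Finsupp.sum, map_sum]
  refine Submodule.sum_mem _ fun i _ => ?_
  rw [freeD_single]
  refine Submodule.add_mem _ (single_mem_free i (A.d_mem _ _ (hx i)) (by ring)) ?_
  exact smul_mem_free (twist_mem A.grading (hx i)) (hδ i) (by ring)

/-- The square of a twisted derivation is linear over the algebra, the mixed terms cancelling
because $d$ anticommutes with `twist`. So it suffices to test it on basis elements. -/
theorem freeD_freeD {δ : ι → ι →₀ A.carrier} (hδδ : ∀ i, freeD A δ (δ i) = 0)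
    (x : ι →₀ A.carrier) : freeD A δ (freeD A δ x) = 0 := by
  induction x using Finsupp.induction_linear with
  | zero => simp
  | add x y hx hy => rw [map_add, map_add, hx, hy, add_zero]
  | single i a =>
    rw [freeD_single, map_add, freeD_single, freeD_smul, hδδ, A.d_d, d_twist]
    simp

/-- The DG module that is graded free with the differential `eᵢ ↦ δᵢ`. -/
abbrev DGMod.free (A : DGAlg k) {ι : Type u} (deg : ι → ℤ) (δ : ι → ι →₀ A.carrier)
    (hδ : ∀ i, δ i ∈ freeGrading A.toGrAlg deg (deg i + 1))
    (hδδ : ∀ i, freeD A δ (δ i) = 0) : DGMod A where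
  toGrMod := GrMod.free A.toGrAlg deg
  d := freeD A δ
  d_mem := freeD_mem hδ
  d_d := freeD_freeD hδδ
  leibniz := by
    intro n a x ha
    rw [freeD_smul, twist_of_mem _ _ ha, one_mul, smul_assoc]

variable {deg : ι → ℤ} {δ : ι → ι →₀ A.carrier}
  {hδ : ∀ i, δ i ∈ freeGrading A.toGrAlg deg (deg i + 1)}
  {hδδ : ∀ i, freeD A δ (δ i) = 0}

/-- The morphism out of a free module given by the images of the basis elements. -/
def freeHom {N : DGMod A} (v : ι → N.carrier) (hv : ∀ i, v i ∈ N.grading (deg i))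
    (hd : ∀ i, Finsupp.linearCombination A.carrier v (δ i) = N.d (v i)) :
    dgHom (DGMod.free A deg δ hδ hδδ) N :=
  ⟨Finsupp.linearCombination A.carrier v, by
    constructor
    · intro n x hx
      rw [Finsupp.linearCombination_apply]
      refine Submodule.sum_mem _ fun i _ => ?_
      have := N.smul_mem _ _ _ _ (hx i) (hv i)
      rwa [sub_add_cancel] at this
    · intro x
      induction x using Finsupp.induction_linear with
      | zero => simp
      | add x y hx hy => simp only [map_add, hx, hy]
      | single i a =>
        rw [freeD_single, map_add, map_smul, hd, Finsupp.linearCombination_single,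
          Finsupp.linearCombination_single, DGMod.d_smul]⟩

/-- The filtration of a free module by the rank of the basis elements. -/
def rankFiltration (A : DGAlg k) (r : ι → ℕ) (n : ℕ) : Submodule A.carrier (ι →₀ A.carrier) :=
  Finsupp.supported A.carrier A.carrier {i | r i < n}

theorem mem_rankFiltration {r : ι → ℕ} {n : ℕ} {x : ι →₀ A.carrier} :
    x ∈ rankFiltration A r n ↔ ∀ i, x i ≠ 0 → r i < n := by
  rw [rankFiltration, Finsupp.mem_supported]
  simp [Set.subset_def]

/-- The index is shifted: stage $n$ holds the cells of rank $<n$ and plays the part of $F(n-1)$. As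
the differential lowers the rank, the cells of rank $n$ become cocycles modulo stage $n$ and freely
generate the next quotient. -/
theorem rankFiltration_isSemifree (r : ι → ℕ)
    (hr : ∀ i, δ i ∈ rankFiltration A r (r i)) :
    IsSemifreeFiltration (DGMod.free A deg δ hδ hδδ) (rankFiltration A r) where
  zero := by
    have : {i | r i < 0} = ∅ := by ext; simp
    rw [rankFiltration, this, Finsupp.supported_empty]
  mono := fun m n hmn => Finsupp.supported_mono fun i (hi : r i < m) => lt_of_lt_of_le hi hmn
  exhaust := by
    intro x
    refine ⟨x.support.sup r + 1, (Finsupp.mem_supported _ _).2 fun i hi => ?_⟩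
    exact Nat.lt_succ_of_le (Finset.le_sup (f := r) hi)
  homogeneous := by
    intro i n x hx
    rw [mem_rankFiltration] at hx ⊢
    intro j hj
    refine hx j fun h => hj ?_
    rw [proj_free_apply, h, map_zero]
  d_mem := by
    intro n x hx
    rw [← Finsupp.sum_single x, Finsupp.sum, map_sum]
    refine Submodule.sum_mem _ fun i hi => ?_
    have hi : r i < n := (Finsupp.mem_supported _ _).1 hx hi
    rw [freeD_single]
    refine Submodule.add_mem _ (Finsupp.single_mem_supported _ _ hi) ?_
    exact Submodule.smul_mem _ _ (Finsupp.supported_mono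
      (fun j (hj : r j < r i) => lt_trans hj hi) (hr i))
  free := by
    classical
    intro n
    refine ⟨{i // r i = n}, fun i => Finsupp.single i.1 1, fun i => ⟨deg i.1, ?_⟩, ?_, ?_, ?_⟩
    · exact single_mem_free i.1 (one_mem' A.toGrAlg) (by simp)
    · rintro ⟨i, rfl⟩
      rw [freeD_single_one]
      exact hr i
    · rw [linearIndependent_iff]
      intro l hl
      have h1 : (rankFiltration A r n).mkQ
          (Finsupp.linearCombination A.carrier (fun i : {i // r i = n} => Finsupp.single i.1 1) l)
          = 0 := by
        rw [Finsupp.apply_linearCombination]; exact hl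
      rw [Submodule.mkQ_apply, Submodule.Quotient.mk_eq_zero, mem_rankFiltration] at h1
      have h2 : Finsupp.linearCombination A.carrier
          (fun i : {i // r i = n} => Finsupp.single i.1 (1 : A.carrier)) l =
          Finsupp.mapDomain Subtype.val l := by
        rw [Finsupp.linearCombination_apply, Finsupp.mapDomain]
        simp
      rw [h2] at h1
      ext i
      -- The combination is supported on cells of rank exactly $n$, while `h1` puts its support in
      -- rank $<n$.
      by_contra hi
      have := h1 i.1
      rw [Finsupp.mapDomain_apply Subtype.val_injective] at this
      exact absurd (this hi) (by rw [i.2]; exact lt_irrefl _)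
    · apply le_antisymm
      · refine sup_le (Finsupp.supported_mono fun i (hi : r i < n) => Nat.lt_succ_of_lt hi) ?_
        rw [Submodule.span_le]
        rintro _ ⟨i, rfl⟩
        exact Finsupp.single_mem_supported _ _ (by
          change r i.1 < n + 1
          rw [i.2]; exact Nat.lt_succ_self n)
      · intro x hx
        rw [← Finsupp.sum_single x, Finsupp.sum]
        refine Submodule.sum_mem _ fun i hi => ?_
        have hi : r i < n + 1 := (Finsupp.mem_supported _ _).1 hx hi
        rcases Nat.lt_succ_iff_lt_or_eq.1 hi with h | h
        · exact Submodule.mem_sup_left (Finsupp.single_mem_supported _ _ h)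
        · refine Submodule.mem_sup_right ?_
          rw [← mul_one (x i), ← smul_eq_mul, ← Finsupp.smul_single]
          exact Submodule.smul_mem _ _ (Submodule.subset_span ⟨⟨i, h⟩, rfl⟩)

/-- The ranks that occur must form an initial segment, which is `hsurj`; a gap would make two
consecutive stages coincide before the top. The actual length may be smaller than $n$, for instance
0 when there are no cells, hence the use of `Nat.find`. -/
theorem dgFreeClass_free_le (r : ι → ℕ) (hr : ∀ i, δ i ∈ rankFiltration A r (r i)) (n : ℕ)
    (hn : ∀ i, r i ≤ n) (hsurj : ∀ i m, m ≤ r i → ∃ j, r j = m) :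
    dgFreeClass (DGMod.free A deg δ hδ hδδ) ≤ n := by
  classical
  have hex : ∃ m, rankFiltration A r (m + 1) = ⊤ :=
    ⟨n, by
      rw [eq_top_iff]
      exact fun x _ => mem_rankFiltration.2 fun i _ => Nat.lt_succ_of_le (hn i)⟩
  have htop : rankFiltration A r (n + 1) = ⊤ := by
    rw [eq_top_iff]
    exact fun x _ => mem_rankFiltration.2 fun i _ => Nat.lt_succ_of_le (hn i)
  refine le_trans (b := ((Nat.find hex : ℕ) : ℕ∞)) (sInf_le ⟨rankFiltration A r, Nat.find hex,
    rankFiltration_isSemifree r hr, ?_, ⟨Nat.find_spec hex, fun m hm => Nat.find_min' hex hm⟩,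
    rfl⟩) (by exact_mod_cast Nat.find_min' hex htop)
  intro m hm heq
  obtain ⟨x, hx⟩ : ∃ x, x ∉ rankFiltration A r m := by
    by_contra! h
    exact hm (eq_top_iff.2 fun x _ => h x)
  rw [mem_rankFiltration] at hx
  push Not at hx
  obtain ⟨i, hi, hmi⟩ := hx
  have : Nontrivial A.carrier := ⟨_, _, hi⟩
  -- A proper stage $m$ misses a cell of rank at least $m$, so there is a cell of rank exactly $m$,
  -- and it separates stage $m$ from stage $m+1$.
  obtain ⟨j, rfl⟩ := hsurj i m hmi
  have h1 : Finsupp.single j (1 : A.carrier) ∈ rankFiltration A r (r j + 1) :=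
    Finsupp.single_mem_supported _ _ (Nat.lt_succ_self _)
  rw [← heq, mem_rankFiltration] at h1
  exact lt_irrefl _ (h1 j (by simp))

end Free
end
end DGA

namespace DGA

noncomputable section

variable {k : Type u} [Field k]

/-! ### The standard resolution of a module over a free algebra -/

section Fox

variable {H : Type u} [AddCommGroup H] [Module k H] (T : FA k →ₐ[k] Module.End k H)

/-- The map `a ⊗ h ↦ a v ⊗ h - a ⊗ v h` for a generator `v`. -/
def koszulMap (i : Fin 2) : FA k ⊗[k] H →ₗ[k] FA k ⊗[k] H :=
  TensorProduct.map (LinearMap.mulRight k (FreeAlgebra.ι k i)) LinearMap.id -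
    TensorProduct.map LinearMap.id (T (FreeAlgebra.ι k i))

theorem koszulMap_tmul (i : Fin 2) (a : FA k) (h : H) : koszulMap T i (a ⊗ₜ h) =
    (a * FreeAlgebra.ι k i) ⊗ₜ h - a ⊗ₜ T (FreeAlgebra.ι k i) h := rfl

theorem koszulMap_smul (i : Fin 2) (a : FA k) (t : FA k ⊗[k] H) :
    koszulMap T i (a • t) = a • koszulMap T i t := by
  induction t with
  | zero => simp
  | add s t hs ht => simp only [smul_add, map_add, hs, ht]
  | tmul b h =>
    rw [TensorProduct.smul_tmul', koszulMap_tmul, koszulMap_tmul, smul_sub,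
      TensorProduct.smul_tmul', TensorProduct.smul_tmul', smul_eq_mul, smul_eq_mul, mul_assoc]

/-- The second map of the standard resolution, with one component for each generator. -/
def koszulSum : (Fin 2 → FA k ⊗[k] H) →ₗ[k] FA k ⊗[k] H :=
  LinearMap.lsum k _ k (koszulMap T)

theorem koszulSum_apply (q : Fin 2 → FA k ⊗[k] H) :
    koszulSum T q = koszulMap T 0 (q 0) + koszulMap T 1 (q 1) := by
  simp [koszulSum, Fin.sum_univ_two]

theorem koszulSum_smul (a : FA k) (q : Fin 2 → FA k ⊗[k] H) :
    koszulSum T (a • q) = a • koszulSum T q := by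
  simp only [koszulSum_apply, Pi.smul_apply, koszulMap_smul, smul_add]

theorem koszulSum_single (i : Fin 2) (t : FA k ⊗[k] H) :
    koszulSum T (Pi.single i t) = koszulMap T i t := by
  rw [koszulSum_apply]
  fin_cases i <;> simp

/-- The action of the free algebra with `v (q, h) = (v q + [1 ⊗ h]_v, v h)`. -/
def foxAct : FA k →ₐ[k] Module.End k ((Fin 2 → FA k ⊗[k] H) × H) :=
  FreeAlgebra.lift k fun i => LinearMap.prodMap (Algebra.lsmul k k _ (FreeAlgebra.ι k i))
      (T (FreeAlgebra.ι k i)) +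
    LinearMap.inl k _ _ ∘ₗ LinearMap.single k _ i ∘ₗ TensorProduct.mk k (FA k) H 1 ∘ₗ
      LinearMap.snd k _ _

theorem foxAct_ι (i : Fin 2) (q : Fin 2 → FA k ⊗[k] H) (h : H) :
    foxAct T (FreeAlgebra.ι k i) (q, h) =
      (FreeAlgebra.ι k i • q + Pi.single i (1 ⊗ₜ h), T (FreeAlgebra.ι k i) h) := by
  rw [foxAct, FreeAlgebra.lift_ι_apply]
  simp

theorem foxAct_snd (a : FA k) (z : (Fin 2 → FA k ⊗[k] H) × H) :
    (foxAct T a z).2 = T a z.2 := by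
  induction a using FreeAlgebra.induction generalizing z with
  | grade0 r => simp
  | grade1 i => obtain ⟨q, h⟩ := z; rw [foxAct_ι]
  | mul a b ha hb => rw [map_mul, Module.End.mul_apply, ha, hb, map_mul, Module.End.mul_apply]
  | add a b ha hb => rw [map_add, LinearMap.add_apply, Prod.snd_add, ha, hb, map_add]; rfl

/-- A telescoping sum: $a\otimes h-1\otimes ah$ is obtained by moving the letters of $a$ across the
tensor sign one at a time. A general first component $q$ is needed because, in a product, the output
of the right factor is fed to the left one. -/
theorem koszulSum_foxAct (a : FA k) (q : Fin 2 → FA k ⊗[k] H) (h : H) :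
    koszulSum T (foxAct T a (q, h)).1 = a • koszulSum T q + a ⊗ₜ h - 1 ⊗ₜ T a h := by
  induction a using FreeAlgebra.induction generalizing q h with
  | grade0 r =>
    simp [Algebra.algebraMap_eq_smul_one, TensorProduct.smul_tmul]
  | grade1 i =>
    rw [foxAct_ι, map_add, koszulSum_smul, koszulSum_single, koszulMap_tmul, one_mul]
    abel
  | mul a b ha hb =>
    have : foxAct T b (q, h) = ((foxAct T b (q, h)).1, T b h) :=
      Prod.ext rfl (foxAct_snd T b (q, h))
    rw [map_mul, Module.End.mul_apply, this, ha, hb, map_mul, Module.End.mul_apply, mul_smul,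
      smul_sub, smul_add, TensorProduct.smul_tmul', TensorProduct.smul_tmul', smul_eq_mul,
      smul_eq_mul, mul_one]
    abel
  | add a b ha hb =>
    rw [map_add, LinearMap.add_apply, Prod.fst_add, map_add, ha, hb, map_add, add_smul,
      LinearMap.add_apply, TensorProduct.add_tmul, TensorProduct.tmul_add]
    abel

theorem foxAct_inl (a : FA k) (q : Fin 2 → FA k ⊗[k] H) : foxAct T a (q, 0) = (a • q, 0) := by
  induction a using FreeAlgebra.induction generalizing q with
  | grade0 r => simp
  | grade1 i => rw [foxAct_ι]; simp
  | mul a b ha hb => rw [map_mul, Module.End.mul_apply, hb, ha, mul_smul]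
  | add a b ha hb => rw [map_add, LinearMap.add_apply, ha, hb, add_smul]; simp

/-- The Fox derivatives `v₁ ⋯ vₙ ⊗ h ↦ ∑ᵢ [v₁ ⋯ vᵢ₋₁ ⊗ vᵢ₊₁ ⋯ vₙ h]` in the component of `vᵢ`. -/
def fox : FA k ⊗[k] H →ₗ[k] (Fin 2 → FA k ⊗[k] H) :=
  TensorProduct.lift (LinearMap.mk₂ k (fun a h => (foxAct T a (0, h)).1)
    (fun a b h => by simp) (fun r a h => by simp)
    (fun a h h' => by
      have : ((0, h + h') : (Fin 2 → FA k ⊗[k] H) × H) = (0, h) + (0, h') := by simp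
      rw [this, map_add]; rfl)
    (fun r a h => by
      have : ((0, r • h) : (Fin 2 → FA k ⊗[k] H) × H) = r • (0, h) := by simp
      rw [this, map_smul]; rfl))

theorem fox_tmul (a : FA k) (h : H) : fox T (a ⊗ₜ h) = (foxAct T a (0, h)).1 := rfl

/-- In the extension `foxAct` of $H$ by the free part, $av(0,h)-a(0,vh)=a([1\otimes h]_v,0)$, and on
the free part the action is plain multiplication. -/
theorem fox_koszulMap (i : Fin 2) (t : FA k ⊗[k] H) :
    fox T (koszulMap T i t) = Pi.single i t := by
  induction t with
  | zero => simp
  | add s t hs ht => rw [map_add, map_add, hs, ht, Pi.single_add]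
  | tmul a h =>
    rw [koszulMap_tmul, map_sub, fox_tmul, fox_tmul, map_mul, Module.End.mul_apply, foxAct_ι,
      ← Prod.fst_sub, ← map_sub]
    have : ((FreeAlgebra.ι k i • (0 : Fin 2 → FA k ⊗[k] H) + Pi.single i (1 ⊗ₜ[k] h),
        T (FreeAlgebra.ι k i) h) - (0, T (FreeAlgebra.ι k i) h) :
        (Fin 2 → FA k ⊗[k] H) × H) = (Pi.single i (1 ⊗ₜ[k] h), 0) := by
      simp
    rw [this, foxAct_inl]
    change a • (Pi.single i (1 ⊗ₜ[k] h) : Fin 2 → FA k ⊗[k] H) = _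
    rw [← Pi.single_smul, TensorProduct.smul_tmul', smul_eq_mul, mul_one]

theorem fox_koszulSum (q : Fin 2 → FA k ⊗[k] H) : fox T (koszulSum T q) = q := by
  rw [koszulSum_apply, map_add, fox_koszulMap, fox_koszulMap]
  ext i
  fin_cases i <;> simp

/-- The action map `a ⊗ h ↦ a h`. -/
def actMap : FA k ⊗[k] H →ₗ[k] H := TensorProduct.lift T.toLinearMap

theorem actMap_tmul (a : FA k) (h : H) : actMap T (a ⊗ₜ h) = T a h := rfl

theorem actMap_koszulSum (q : Fin 2 → FA k ⊗[k] H) : actMap T (koszulSum T q) = 0 := by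
  have h : ∀ i t, actMap T (koszulMap T i t) = 0 := by
    intro i t
    induction t with
    | zero => simp
    | add s t hs ht => rw [map_add, map_add, hs, ht, add_zero]
    | tmul a h => rw [koszulMap_tmul, map_sub, actMap_tmul, actMap_tmul, map_mul]; simp
  rw [koszulSum_apply, map_add, h, h, add_zero]

/-- Together with `fox_koszulSum` this is the contracting homotopy of the standard resolution:
whatever the action map kills comes from `koszulSum`. -/
theorem koszulSum_fox (t : FA k ⊗[k] H) :
    koszulSum T (fox T t) + 1 ⊗ₜ actMap T t = t := by
  induction t with
  | zero => simp
  | add s t hs ht =>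
    rw [map_add, map_add, map_add, TensorProduct.tmul_add]
    nth_rw 3 [← hs, ← ht]
    abel
  | tmul a h => rw [fox_tmul, koszulSum_foxAct, actMap_tmul]; simp

end Fox

/-! ### A criterion for quasi-isomorphisms -/

section Criterion

variable {H : Type u} [AddCommGroup H] [Module k H]

/-- A DG module that is a twisted sum of `A ⊗ H` and of one copy of `A ⊗ H` for each generator,
where `A` is a free algebra, has the cohomology of `H`. -/
theorem isQuasiIso_of_cells {B : DGAlg k} {F M : DGMod B} (f : dgHom F M)
    (T : FA k →ₐ[k] Module.End k H) (dH : H →ₗ[k] H) (i : H →ₗ[k] M.carrier)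
    (c : F.carrier →ₗ[k] FA k ⊗[k] H) (κ : (Fin 2 → FA k ⊗[k] H) →ₗ[k] F.carrier)
    (τ : (Fin 2 → FA k ⊗[k] H) →ₗ[k] (Fin 2 → FA k ⊗[k] H)) (hτ : ∀ q, τ (τ q) = q)
    (η : H →ₗ[k] F.carrier)
    (hc : ∀ z, c z = 0 → ∃ q, κ q = z) (hψ : ∀ q, c (F.d (κ q)) = koszulSum T (τ q))
    (hη : ∀ h, c (η h) = 1 ⊗ₜ h) (hdη : ∀ h, F.d (η h) = η (dH h)) (hf : ∀ h, f.1 (η h) = i h)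
    (hinj : ∀ h, dH h = 0 → (∃ m, M.d m = i h) → ∃ h', dH h' = h)
    (hsurj : ∀ m, M.d m = 0 → ∃ h, dH h = 0 ∧ ∃ m', M.d m' = m - i h) : IsQuasiIso f := by
  rw [isQuasiIso_iff]
  constructor
  · intro z hz hfz
    -- By the contracting homotopy, a boundary and an element of $1\otimes H$ account for the whole
    -- $A\otimes H$ component of $z$; the remainder lies in the other cells.
    obtain ⟨w, hw, hcw⟩ : ∃ w, F.d (κ (τ (fox T (c z)))) + η (actMap T (c z)) + w = z ∧ c w = 0 := by
      refine ⟨z - (F.d (κ (τ (fox T (c z)))) + η (actMap T (c z))), by abel, ?_⟩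
      rw [map_sub, map_add, hψ, hη, hτ, koszulSum_fox, sub_self]
    obtain ⟨q, rfl⟩ := hc w hcw
    set h := actMap T (c z)
    have h1 : η (dH h) + F.d (κ q) = 0 := by
      rw [← hw, map_add, map_add, F.d_d, hdη, zero_add] at hz
      exact hz
    -- Projecting to $A\otimes H$ gives a relation in the standard resolution. The action map
    -- isolates `dH h`, and then injectivity of `koszulSum` forces $q=0$.
    have h2 : 1 ⊗ₜ dH h + koszulSum T (τ q) = 0 := by
      rw [← hη, ← hψ, ← map_add, h1, map_zero]
    have h3 : dH h = 0 := by
      have := congrArg (actMap T) h2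
      rw [map_add, actMap_koszulSum, actMap_tmul, map_one] at this
      simpa using this
    have h4 : τ q = 0 := by
      rw [h3, TensorProduct.tmul_zero, zero_add] at h2
      rw [← fox_koszulSum T (τ q), h2, map_zero]
    have h5 : κ q = 0 := by rw [← hτ q, h4, map_zero, map_zero]
    rw [h5, add_zero] at hw
    generalize κ (τ (fox T (c z))) = w₀ at hw
    obtain ⟨n, hn⟩ := hfz
    obtain ⟨h', hh'⟩ := hinj h h3 ⟨n - f.1 w₀, by
      rw [map_sub, hn, ← hw, map_add, f.2.2, hf, add_sub_cancel_left]⟩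
    exact ⟨w₀ + η h', by rw [map_add, hdη, hh', hw]⟩
  · intro m hm
    obtain ⟨h, hh, m', hm'⟩ := hsurj m hm
    exact ⟨η h, by rw [hdη, hh, map_zero], m', by rw [hf, hm']⟩

end Criterion

end
end DGA

namespace DGA

noncomputable section

variable {k : Type u} [Field k]

/-! ### Free modules on cells -/

section Cells

variable {B : DGAlg k} {J : Type u}

/-- The part of a free module in the cells of kind `o`. -/
def compCell (B : DGAlg k) (J : Type u) (o : Option (Fin 2)) :
    (Option (Fin 2) × J →₀ B.carrier) →ₗ[B.carrier] (J →₀ B.carrier) :=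
  Finsupp.lcomapDomain (fun j => (o, j)) (Prod.mk_right_injective o)

/-- The inclusion of the cells of kind `o`. -/
def inclCell (B : DGAlg k) (J : Type u) (o : Option (Fin 2)) :
    (J →₀ B.carrier) →ₗ[B.carrier] (Option (Fin 2) × J →₀ B.carrier) :=
  Finsupp.lmapDomain B.carrier B.carrier (fun j => (o, j))

theorem compCell_apply (o : Option (Fin 2)) (x : Option (Fin 2) × J →₀ B.carrier) (j : J) :
    compCell B J o x j = x (o, j) := rfl

theorem inclCell_single (o : Option (Fin 2)) (j : J) (b : B.carrier) :
    inclCell B J o (Finsupp.single j b) = Finsupp.single (o, j) b := by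
  simp [inclCell]

theorem inclCell_apply_same (o : Option (Fin 2)) (x : J →₀ B.carrier) (j : J) :
    inclCell B J o x (o, j) = x j :=
  Finsupp.mapDomain_apply (Prod.mk_right_injective o) x j

theorem inclCell_apply_ne {o o' : Option (Fin 2)} (h : o ≠ o') (x : J →₀ B.carrier) (j : J) :
    inclCell B J o x (o', j) = 0 := by
  refine Finsupp.mapDomain_of_notMem_range _ _ ?_
  rintro ⟨j', hj'⟩
  exact h (Prod.ext_iff.1 hj').1

theorem compCell_inclCell (o : Option (Fin 2)) (x : J →₀ B.carrier) :
    compCell B J o (inclCell B J o x) = x :=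
  Finsupp.ext fun j => inclCell_apply_same o x j

theorem compCell_inclCell_ne {o o' : Option (Fin 2)} (h : o ≠ o') (x : J →₀ B.carrier) :
    compCell B J o' (inclCell B J o x) = 0 :=
  Finsupp.ext fun j => inclCell_apply_ne h x j

theorem compCell_single_ne {o o' : Option (Fin 2)} (h : o ≠ o') (j : J) (b : B.carrier) :
    compCell B J o' (Finsupp.single (o, j) b) = 0 := by
  rw [← inclCell_single, compCell_inclCell_ne h]

theorem compCell_single (o : Option (Fin 2)) (j : J) (b : B.carrier) :
    compCell B J o (Finsupp.single (o, j) b) = Finsupp.single j b := by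
  rw [← inclCell_single, compCell_inclCell]

theorem sum_inclCell (x : Option (Fin 2) × J →₀ B.carrier) :
    ∑ o, inclCell B J o (compCell B J o x) = x := by
  ext ⟨o, j⟩
  rw [Finsupp.finsetSum_apply, Finset.sum_eq_single o, inclCell_apply_same, compCell_apply]
  · intro o' _ h; exact inclCell_apply_ne h _ _
  · intro h; exact absurd (Finset.mem_univ o) h

/-- The rank of the cells. -/
def cellRank : Option (Fin 2) → ℕ
  | none => 0
  | some 0 => 2
  | some 1 => 1

/-- Only the components of the differential in the cells of kind `none` enter the criterion; those
between the other two kinds are unconstrained. This is why the lower-order terms of the $x$-cells do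
no harm. -/
theorem isQuasiIso_of_free_cells {H : Type u} [AddCommGroup H] [Module k H]
    (T : FA k →ₐ[k] Module.End k H) (dH : H →ₗ[k] H)
    {deg : Option (Fin 2) × J → ℤ} {δ : Option (Fin 2) × J → Option (Fin 2) × J →₀ B.carrier}
    {hδ : ∀ i, δ i ∈ freeGrading B.toGrAlg deg (deg i + 1)}
    {hδδ : ∀ i, freeD B δ (δ i) = 0} {M : DGMod B} (f : dgHom (DGMod.free B deg δ hδ hδδ) M)
    (i : H →ₗ[k] M.carrier) (θ : (J →₀ B.carrier) ≃ₗ[k] FA k ⊗[k] H)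
    (hθ : ∀ l j b, θ (compCell B J none (twist B.grading 1 b • δ (some l, j))) =
      koszulMap T l (TensorProduct.map (twist (faGrading k) 1) LinearMap.id
        (θ (Finsupp.single j b))))
    (hdη : ∀ h, freeD B δ (inclCell B J none (θ.symm (1 ⊗ₜ h))) =
      inclCell B J none (θ.symm (1 ⊗ₜ dH h)))
    (hf : ∀ h, f.1 (inclCell B J none (θ.symm (1 ⊗ₜ h))) = i h)
    (hinj : ∀ h, dH h = 0 → (∃ m, M.d m = i h) → ∃ h', dH h' = h)
    (hsurj : ∀ m, M.d m = 0 → ∃ h, dH h = 0 ∧ ∃ m', M.d m' = m - i h) : IsQuasiIso f := by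
  set τ₀ : FA k ⊗[k] H →ₗ[k] FA k ⊗[k] H :=
    TensorProduct.map (twist (faGrading k) 1) LinearMap.id with hτ₀
  have hττ : ∀ t, τ₀ (τ₀ t) = t := by
    intro t
    induction t with
    | zero => simp
    | add s t hs ht => rw [map_add, map_add, hs, ht]
    | tmul a h =>
      change twist (faGrading k) 1 (twist (faGrading k) 1 a) ⊗ₜ[k] h = a ⊗ₜ h
      rw [show twist (faGrading k) 1 (twist (faGrading k) 1 a) = a from twist_twist (exDG k) a]
  set κ : (Fin 2 → FA k ⊗[k] H) →ₗ[k] (Option (Fin 2) × J →₀ B.carrier) :=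
    LinearMap.lsum k _ k fun l => ((inclCell B J (some l)).restrictScalars k) ∘ₗ
      θ.symm.toLinearMap with hκ
  have κ_apply : ∀ q, κ q = inclCell B J (some 0) (θ.symm (q 0)) +
      inclCell B J (some 1) (θ.symm (q 1)) := by
    intro q
    simp [hκ, Fin.sum_univ_two]
  -- The term that differentiates the coefficient stays in the cells of kind `some l`, so the
  -- twisted image of the cell alone contributes.
  have key : ∀ l x, θ (compCell B J none (freeD B δ (inclCell B J (some l) x))) =
      koszulMap T l (τ₀ (θ x)) := by
    intro l x
    induction x using Finsupp.induction_linear with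
    | zero => simp
    | add x y hx hy => simp only [map_add, hx, hy]
    | single j b =>
      rw [inclCell_single, freeD_single, map_add, compCell_single_ne (by simp), zero_add, hθ]
  refine isQuasiIso_of_cells f T dH i
    (θ.toLinearMap ∘ₗ ((compCell B J none).restrictScalars k)) κ
    (LinearMap.pi fun l => τ₀ ∘ₗ LinearMap.proj l) ?_
    (((inclCell B J none).restrictScalars k) ∘ₗ θ.symm.toLinearMap ∘ₗ
      TensorProduct.mk k (FA k) H 1) ?_ ?_ ?_ hdη hf hinj hsurj
  · intro q
    ext l : 1
    exact hττ (q l)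
  · intro z hz
    have hz : compCell B J none z = 0 := θ.map_eq_zero_iff.1 hz
    refine ⟨fun l => θ (compCell B J (some l) z), ?_⟩
    rw [κ_apply, LinearEquiv.symm_apply_apply, LinearEquiv.symm_apply_apply]
    conv_rhs => rw [← sum_inclCell z]
    rw [Fintype.sum_option, hz, map_zero, zero_add, Fin.sum_univ_two]
  · intro q
    change θ (compCell B J none (freeD B δ (κ q))) = _
    rw [κ_apply, map_add, map_add, map_add, key, key, koszulSum_apply,
      LinearEquiv.apply_symm_apply, LinearEquiv.apply_symm_apply]
    rfl
  · intro h
    change θ (compCell B J none (inclCell B J none (θ.symm (1 ⊗ₜ h)))) = _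
    rw [compCell_inclCell, LinearEquiv.apply_symm_apply]

end Cells

/-! ### Splittings of complexes over a field -/

section Splitting

/-- A homogeneous basis of the cohomology of a DG module with a contraction onto it. -/
structure Splitting {A : DGAlg k} (M : DGMod A) where
  J : Type u
  deg : J → ℤ
  e : J → M.carrier
  p : M.carrier →ₗ[k] (J →₀ k)
  s : M.carrier →ₗ[k] M.carrier
  e_mem : ∀ j, e j ∈ M.grading (deg j)
  p_mem : ∀ n, ∀ m ∈ M.grading n, ∀ j, p m j ≠ 0 → deg j = n
  s_mem : ∀ n, ∀ m ∈ M.grading n, s m ∈ M.grading (n - 1)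
  d_e : ∀ j, M.d (e j) = 0
  p_d : ∀ m, p (M.d m) = 0
  p_e : ∀ j, p (e j) = Finsupp.single j 1
  homotopy : ∀ m, m - Finsupp.linearCombination k e (p m) = M.d (s m) + s (M.d m)

/-- The linear map that is `g n` on the elements of degree `n`. -/
def glue {M N : Type u} [AddCommGroup M] [Module k M] [AddCommGroup N] [Module k N]
    (ℳ : ℤ → Submodule k M) [DirectSum.Decomposition ℳ] (g : ∀ n, ℳ n →ₗ[k] N) : M →ₗ[k] N :=
  DirectSum.toModule k ℤ N g ∘ₗ (DirectSum.decomposeLinearEquiv ℳ).toLinearMap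

theorem glue_apply {M N : Type u} [AddCommGroup M] [Module k M] [AddCommGroup N] [Module k N]
    (ℳ : ℤ → Submodule k M) [DirectSum.Decomposition ℳ] (g : ∀ n, ℳ n →ₗ[k] N) {n : ℤ} {m : M}
    (hm : m ∈ ℳ n) : glue ℳ g m = g n ⟨m, hm⟩ := by
  lift m to ℳ n using hm
  simp [glue]

/-- The part of degree `c` of a linear map. -/
def homPart {M : Type u} [AddCommGroup M] [Module k M]
    (ℳ : ℤ → Submodule k M) [DirectSum.Decomposition ℳ] (c : ℤ) (R : M →ₗ[k] M) : M →ₗ[k] M :=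
  glue ℳ fun n => proj ℳ (n + c) ∘ₗ R ∘ₗ (ℳ n).subtype

theorem homPart_apply {M : Type u} [AddCommGroup M] [Module k M]
    (ℳ : ℤ → Submodule k M) [DirectSum.Decomposition ℳ] (c : ℤ) (R : M →ₗ[k] M) {n : ℤ} {m : M}
    (hm : m ∈ ℳ n) : homPart ℳ c R m = proj ℳ (n + c) (R m) := by
  rw [homPart, glue_apply ℳ _ hm]; rfl

theorem homPart_mem {M : Type u} [AddCommGroup M] [Module k M]
    (ℳ : ℤ → Submodule k M) [DirectSum.Decomposition ℳ] (c : ℤ) (R : M →ₗ[k] M) {n : ℤ} {m : M}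
    (hm : m ∈ ℳ n) : homPart ℳ c R m ∈ ℳ (n + c) := by
  rw [homPart_apply ℳ c R hm]; exact proj_mem _ _ _

/-- A homogeneous subspace is the image of a homogeneous projection. -/
theorem exists_homogeneous_projection {M : Type u} [AddCommGroup M] [Module k M]
    (ℳ : ℤ → Submodule k M) [DirectSum.Decomposition ℳ] (S : Submodule k M)
    (hS : ∀ n, ∀ m ∈ S, proj ℳ n m ∈ S) : ∃ P : M →ₗ[k] M, (∀ n, ∀ m ∈ ℳ n, P m ∈ ℳ n) ∧
      (∀ m, P m ∈ S) ∧ ∀ m ∈ S, P m = m := by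
  obtain ⟨r, hr⟩ := LinearMap.exists_leftInverse_of_injective S.subtype
    (LinearMap.ker_eq_bot.2 S.injective_subtype)
  have hr' : ∀ m (hm : m ∈ S), r m = ⟨m, hm⟩ := fun m hm => LinearMap.congr_fun hr ⟨m, hm⟩
  refine ⟨homPart ℳ 0 (S.subtype ∘ₗ r), fun n m hm => ?_, fun m => ?_, fun m hm => ?_⟩
  · have := homPart_mem ℳ 0 (S.subtype ∘ₗ r) hm
    rwa [add_zero] at this
  · induction m using hom_induction ℳ with
    | h0 => rw [map_zero]; exact S.zero_mem
    | hadd a b ha hb => rw [map_add]; exact S.add_mem ha hb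
    | hh n m hm => rw [homPart_apply ℳ 0 _ hm]; exact hS _ _ (r m).2
  · classical
    have h : ∀ n, homPart ℳ 0 (S.subtype ∘ₗ r) (proj ℳ n m) = proj ℳ n m := by
      intro n
      rw [homPart_apply ℳ 0 _ (proj_mem ℳ n m), LinearMap.comp_apply, hr' _ (hS n m hm), add_zero]
      exact proj_same ℳ (proj_mem ℳ n m)
    conv_lhs => rw [← DirectSum.sum_support_decompose ℳ m]
    conv_rhs => rw [← DirectSum.sum_support_decompose ℳ m]
    rw [map_sum]
    exact Finset.sum_congr rfl fun n _ => h n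

/-- Let $Z$ and $P$ be homogeneous projections onto cocycles and coboundaries, and let $r$ be a
homogeneous section of $d$ over its range. Then $\pi=(1-P)Z$ projects onto representatives of the
cohomology, and $s=(1-Z)rPZ$ is a contracting homotopy for $1-\pi$. -/
theorem exists_splitting {A : DGAlg k} (M : DGMod A) : Nonempty (Splitting M) := by
  obtain ⟨Z, hZ, hZ', hZZ⟩ := exists_homogeneous_projection M.grading (LinearMap.ker M.d)
    (fun n m hm => by
      rw [LinearMap.mem_ker] at hm ⊢
      rw [M.d_proj, hm, map_zero])
  obtain ⟨P, hP, hP', hPP⟩ := exists_homogeneous_projection M.grading (LinearMap.range M.d)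
    (by
      rintro n _ ⟨m, rfl⟩
      refine ⟨proj M.grading (n - 1) m, ?_⟩
      rw [M.d_proj, sub_add_cancel])
  have hZ' : ∀ m, M.d (Z m) = 0 := hZ'
  have hZZ : ∀ m, M.d m = 0 → Z m = m := hZZ
  obtain ⟨R₀, hR₀⟩ := LinearMap.exists_rightInverse_of_surjective M.d.rangeRestrict
    M.d.range_rangeRestrict
  obtain ⟨R, hR⟩ := LinearMap.exists_extend R₀
  have hdR : ∀ m, M.d (R (M.d m)) = M.d m := by
    intro m
    have h1 := congrArg Subtype.val (LinearMap.congr_fun hR₀ ⟨M.d m, m, rfl⟩)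
    have h2 := LinearMap.congr_fun hR ⟨M.d m, m, rfl⟩
    change R (M.d m) = _ at h2
    rw [h2]; exact h1
  -- The extension `R` of a linear section need not be homogeneous. Its part of degree $-1$ is still
  -- a section, because $d$ has degree 1.
  let r := homPart M.grading (-1) R
  have hr : ∀ n, ∀ m ∈ M.grading n, r m ∈ M.grading (n - 1) :=
    fun n m hm => homPart_mem M.grading (-1) R hm
  have hdr : ∀ m, M.d (r (M.d m)) = M.d m := by
    intro m
    induction m using hom_induction M.grading with
    | h0 => simp
    | hadd a b ha hb => simp only [map_add, ha, hb]
    | hh n m hm =>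
      rw [homPart_apply M.grading (-1) R (M.d_mem n m hm), M.d_proj, hdR]
      exact proj_same _ (by simpa using M.d_mem n m hm)
  have hPd : ∀ m, P (M.d m) = M.d m := fun m => hPP _ ⟨m, rfl⟩
  have hdrP : ∀ m, M.d (r (P m)) = P m := by
    intro m
    obtain ⟨n, hn⟩ := hP' m
    rw [← hn, hdr]
  have hdP : ∀ m, M.d (P m) = 0 := by
    intro m
    obtain ⟨n, hn⟩ := hP' m
    rw [← hn, M.d_d]
  let s : M.carrier →ₗ[k] M.carrier := (LinearMap.id - Z) ∘ₗ r ∘ₗ P ∘ₗ Z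
  let π : M.carrier →ₗ[k] M.carrier := (LinearMap.id - P) ∘ₗ Z
  have hs : ∀ m, s m = r (P (Z m)) - Z (r (P (Z m))) := fun m => rfl
  have hπ : ∀ m, π m = Z m - P (Z m) := fun m => rfl
  -- Here $ds(m)=PZm$. Also $s(dm)=(1-Z)r(dm)=(1-Z)m$, since $r(dm)-m$ is a cocycle.
  have hhom : ∀ m, m - π m = M.d (s m) + s (M.d m) := by
    intro m
    have h1 : Z (r (M.d m) - m) = r (M.d m) - m := hZZ _ (by rw [map_sub, hdr, sub_self])
    rw [map_sub, sub_eq_iff_eq_add] at h1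
    rw [hπ, hs, hs, map_sub, hZ', sub_zero, hdrP, hZZ _ (M.d_d m), hPd, h1]
    abel
  have hdπ : ∀ m, M.d (π m) = 0 := fun m => by rw [hπ, map_sub, hZ', hdP, sub_zero]
  have hπd : ∀ m, π (M.d m) = 0 := fun m => by rw [hπ, hZZ _ (M.d_d m), hPd, sub_self]
  have hππ : ∀ m, π (π m) = π m := by
    intro m
    rw [hπ (π m), hZZ _ (hdπ m)]
    have : P (π m) = 0 := by
      rw [hπ, map_sub]
      obtain ⟨n, hn⟩ := hP' (Z m)
      rw [← hn, hPd, hn, sub_self]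
    rw [this, sub_zero]
  have hπ_mem : ∀ n, ∀ m ∈ M.grading n, π m ∈ M.grading n :=
    fun n m hm => Submodule.sub_mem _ (hZ _ _ hm) (hP _ _ (hZ _ _ hm))
  -- Since $\pi$ is a homogeneous idempotent, its image in each degree represents the cohomology
  -- there, and bases may be chosen degree by degree.
  let H : ℤ → Submodule k M.carrier := fun n => (M.grading n).map π
  let b : ∀ n, Module.Basis (Module.Basis.ofVectorSpaceIndex k (H n)) k (H n) :=
    fun n => Module.Basis.ofVectorSpace k (H n)
  have hH : ∀ n (x : H n), x.1 ∈ M.grading n ∧ π x.1 = x.1 := by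
    rintro n ⟨_, m, hm, rfl⟩
    exact ⟨hπ_mem n m hm, hππ m⟩
  let J := Σ n, Module.Basis.ofVectorSpaceIndex k (H n)
  let g : ∀ n, M.grading n →ₗ[k] (J →₀ k) := fun n =>
    Finsupp.lmapDomain k k (Sigma.mk n) ∘ₗ (b n).repr.toLinearMap ∘ₗ
      (π ∘ₗ (M.grading n).subtype).codRestrict (H n) (fun m => ⟨m.1, m.2, rfl⟩)
  let e : J → M.carrier := fun j => (b j.1 j.2).1
  let p := glue M.grading g
  have hp : ∀ n m (hm : m ∈ M.grading n), p m =
      Finsupp.mapDomain (Sigma.mk n) ((b n).repr ⟨π m, m, hm, rfl⟩) :=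
    fun n m hm => glue_apply M.grading g hm
  have hpe : ∀ j, p (e j) = Finsupp.single j 1 := by
    rintro ⟨n, j⟩
    rw [hp n _ (hH n (b n j)).1]
    have : (⟨π (e ⟨n, j⟩), e ⟨n, j⟩, (hH n (b n j)).1, rfl⟩ : H n) = b n j :=
      Subtype.ext (hH n (b n j)).2
    rw [this, Module.Basis.repr_self, Finsupp.mapDomain_single]
  have hep : ∀ m, Finsupp.linearCombination k e (p m) = π m := by
    intro m
    induction m using hom_induction M.grading with
    | h0 => simp
    | hadd a b ha hb => simp only [map_add, ha, hb]
    | hh n m hm =>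
      rw [hp n m hm, Finsupp.linearCombination_mapDomain]
      have := congrArg (H n).subtype ((b n).linearCombination_repr ⟨π m, m, hm, rfl⟩)
      rw [Finsupp.apply_linearCombination] at this
      exact this
  have hpI : ∀ h, p (Finsupp.linearCombination k e h) = h := by
    intro h
    induction h using Finsupp.induction_linear with
    | zero => simp
    | add x y hx hy => simp only [map_add, hx, hy]
    | single j r => rw [Finsupp.linearCombination_single, map_smul, hpe]; simp
  exact ⟨{ J := J, deg := Sigma.fst, e := e, p := p, s := s
           e_mem := fun j => (hH j.1 _).1
           p_mem := by
            rintro n m hm ⟨i, j⟩ hj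
            rw [hp n m hm] at hj
            by_contra hne
            refine hj (Finsupp.mapDomain_of_notMem_range _ _ ?_)
            rintro ⟨l, hl⟩
            exact hne (congrArg Sigma.fst hl).symm
           s_mem := fun n m hm => by
            have := hr n _ (hP _ _ (hZ _ _ hm))
            exact Submodule.sub_mem _ this (hZ _ _ this)
           d_e := fun j => by
            have := hdπ (e j)
            rwa [(hH j.1 (b j.1 j.2)).2] at this
           p_d := fun m => by rw [← hpI (p (M.d m)), hep, hπd, map_zero]
           p_e := hpe
           homotopy := fun m => by rw [hep]; exact hhom m }⟩

end Splitting

end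
end DGA

namespace DGA

noncomputable section

variable {k : Type u} [Field k]

/-! ### The three-step semi-free resolution of a DG module over `k⟨x, y⟩` -/

section Resolution

variable (k) in
/-- A reducible copy of the DG algebra `exDG k`. -/
abbrev exA : DGAlg k where
  carrier := FA k
  grading := faGrading k
  d := faD k
  d_mem := faD_mem
  d_d := faD_faD
  leibniz := faD_mul

instance (M : DGMod (exA k)) : Module (FA k) M.carrier := M.mod
instance (M : DGMod (exA k)) : IsScalarTower k (FA k) M.carrier := M.tower

theorem gx_mem : gx k ∈ faGrading k 1 := ι_mem 0
theorem gy_mem : gy k ∈ faGrading k 1 := ι_mem 1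

variable {M : DGMod (exA k)}

theorem d_gx_smul (m : M.carrier) : M.d (gx k • m) = gy k • gy k • m - gx k • M.d m := by
  rw [M.leibniz 1 (gx k) m gx_mem]
  change faD k (gx k) • m + _ = _
  rw [faD_x, pow_two, mul_smul]
  simp [sub_eq_add_neg]

theorem d_gy_smul (m : M.carrier) : M.d (gy k • m) = - (gy k • M.d m) := by
  rw [M.leibniz 1 (gy k) m gy_mem]
  change faD k (gy k) • m + _ = _
  rw [faD_y]
  simp

variable (S : Splitting M)

namespace Splitting

/-- The inclusion of the chosen cohomology. -/
def incl : (S.J →₀ k) →ₗ[k] M.carrier := Finsupp.linearCombination k S.e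

theorem d_incl (h : S.J →₀ k) : M.d (S.incl h) = 0 := by
  rw [incl, Finsupp.apply_linearCombination]
  have : ⇑M.d ∘ S.e = 0 := funext S.d_e
  rw [this, Finsupp.linearCombination_zero]
  rfl

theorem p_incl (h : S.J →₀ k) : S.p (S.incl h) = h := by
  rw [incl, Finsupp.apply_linearCombination]
  have : ⇑S.p ∘ S.e = fun j => Finsupp.single j 1 := funext S.p_e
  rw [this]
  induction h using Finsupp.induction_linear with
  | zero => simp
  | add x y hx hy => rw [map_add, hx, hy]
  | single j r => simp

theorem incl_p (m : M.carrier) (hm : M.d m = 0) : S.incl (S.p m) = m - M.d (S.s m) := by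
  have := S.homotopy m
  rw [hm, map_zero, add_zero] at this
  rw [← this, incl, sub_sub_cancel]

/-- The operator induced by `y` on the cohomology. -/
def opY : (S.J →₀ k) →ₗ[k] (S.J →₀ k) := S.p ∘ₗ Algebra.lsmul k k M.carrier (gy k) ∘ₗ S.incl

/-- The map `x + y s y` on the cohomology. -/
def xMap : (S.J →₀ k) →ₗ[k] M.carrier :=
  (Algebra.lsmul k k M.carrier (gx k) + Algebra.lsmul k k M.carrier (gy k) ∘ₗ S.s ∘ₗ
    Algebra.lsmul k k M.carrier (gy k)) ∘ₗ S.incl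

/-- The operator induced by `x + y s y` on the cohomology. -/
def opX : (S.J →₀ k) →ₗ[k] (S.J →₀ k) := S.p ∘ₗ S.xMap

theorem opY_apply (h : S.J →₀ k) : S.opY h = S.p (gy k • S.incl h) := rfl

theorem xMap_apply (h : S.J →₀ k) :
    S.xMap h = gx k • S.incl h + gy k • S.s (gy k • S.incl h) := rfl

theorem opX_apply (h : S.J →₀ k) : S.opX h = S.p (S.xMap h) := rfl

theorem d_gy_incl (h : S.J →₀ k) : M.d (gy k • S.incl h) = 0 := by
  rw [d_gy_smul, d_incl, smul_zero, neg_zero]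

/-- This is where $\partial x=y^2$ enters. The representative of the class of $yh$ is $yh-d\,s(yh)$,
and multiplying it by $y$ gives $d\bigl(xh+y\,s(yh)\bigr)$, a coboundary. -/
theorem opY_opY (h : S.J →₀ k) : S.opY (S.opY h) = 0 := by
  have : gy k • S.incl (S.opY h) = M.d (S.xMap h) := by
    rw [opY_apply, S.incl_p _ (S.d_gy_incl h), xMap_apply, map_add, d_gx_smul, d_gy_smul,
      S.d_incl, smul_sub]
    simp [sub_eq_add_neg]
  rw [opY_apply, this, S.p_d]

/-- The value of `xMap` is thus not a cocycle in general. Its defect is what the $y$-cells in the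
differential of the $x$-cells compensate. -/
theorem d_xMap (h : S.J →₀ k) : M.d (S.xMap h) = gy k • S.incl (S.opY h) := by
  rw [opY_apply, S.incl_p _ (S.d_gy_incl h), xMap_apply, map_add, d_gx_smul, d_gy_smul,
    S.d_incl, smul_sub]
  simp [sub_eq_add_neg]

/-- The `k`-span of the cells of kind `o`. -/
def cells (o : Option (Fin 2)) : (S.J →₀ k) →ₗ[k] (Option (Fin 2) × S.J →₀ (exA k).carrier) :=
  ((inclCell (exA k) S.J o).restrictScalars k) ∘ₗ
    Finsupp.mapRange.linearMap (Algebra.linearMap k (FA k))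

theorem cells_single (o : Option (Fin 2)) (j : S.J) (r : k) :
    S.cells o (Finsupp.single j r) = r • Finsupp.single (o, j) 1 := by
  rw [cells, LinearMap.comp_apply, Finsupp.mapRange.linearMap_apply, Finsupp.mapRange_single]
  change inclCell (exA k) S.J o _ = _
  rw [inclCell_single, Finsupp.smul_single, Algebra.linearMap_apply,
    Algebra.algebraMap_eq_smul_one]

theorem cells_single_one (o : Option (Fin 2)) (j : S.J) :
    S.cells o (Finsupp.single j 1) = Finsupp.single (o, j) 1 := by
  rw [cells_single, one_smul]

/-- The differential of the resolution on the cells. -/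
def diff : Option (Fin 2) × S.J → Option (Fin 2) × S.J →₀ (exA k).carrier
  | (none, _) => 0
  | (some 1, j) => Finsupp.single (none, j) (gy k) - S.cells none (S.opY (Finsupp.single j 1))
  | (some 0, j) => Finsupp.single (none, j) (gx k) - S.cells none (S.opX (Finsupp.single j 1)) +
      (Finsupp.single (some 1, j) (gy k) - S.cells (some 1) (S.opY (Finsupp.single j 1)))

/-- The degrees of the cells. -/
def cellDeg (i : Option (Fin 2) × S.J) : ℤ := S.deg i.2

theorem s_mem' {n m : ℤ} {z : M.carrier} (hz : z ∈ M.grading n) (h : n = m + 1) :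
    S.s z ∈ M.grading m := by
  have := S.s_mem n z hz
  rwa [h, add_sub_cancel_right] at this

theorem gy_smul_mem {n : ℤ} {z : M.carrier} (hz : z ∈ M.grading n) :
    gy k • z ∈ M.grading (n + 1) := by
  rw [add_comm]; exact M.smul_mem 1 n _ z gy_mem hz

theorem gx_smul_mem {n : ℤ} {z : M.carrier} (hz : z ∈ M.grading n) :
    gx k • z ∈ M.grading (n + 1) := by
  rw [add_comm]; exact M.smul_mem 1 n _ z gx_mem hz

theorem incl_single (j : S.J) : S.incl (Finsupp.single j 1) = S.e j := by
  rw [incl, Finsupp.linearCombination_single, one_smul]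

theorem xMap_single_mem (j : S.J) :
    S.xMap (Finsupp.single j 1) ∈ M.grading (S.deg j + 1) := by
  rw [xMap_apply, incl_single]
  exact Submodule.add_mem _ (gx_smul_mem (S.e_mem j))
    (gy_smul_mem (S.s_mem' (gy_smul_mem (S.e_mem j)) rfl))

theorem cells_mem (o : Option (Fin 2)) (n : ℤ) (m : M.carrier) (hm : m ∈ M.grading n) :
    S.cells o (S.p m) ∈ freeGrading (exA k).toGrAlg S.cellDeg n := by
  have h := S.p_mem n m hm
  generalize S.p m = x at h
  rw [← Finsupp.sum_single x, Finsupp.sum, map_sum]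
  refine Submodule.sum_mem _ fun j hj => ?_
  rw [cells_single]
  refine Submodule.smul_mem _ _ (single_mem_free _ (one_mem' (exA k).toGrAlg) ?_)
  rw [zero_add]
  exact (h j (Finsupp.mem_support_iff.1 hj)).symm

theorem diff_mem (i : Option (Fin 2) × S.J) :
    S.diff i ∈ freeGrading (exA k).toGrAlg S.cellDeg (S.cellDeg i + 1) := by
  have hy : ∀ o j, Finsupp.single (o, j) (gy k) - S.cells o (S.opY (Finsupp.single j 1)) ∈
      freeGrading (exA k).toGrAlg S.cellDeg (S.deg j + 1) := by
    intro o j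
    refine Submodule.sub_mem _ (single_mem_free _ gy_mem (add_comm _ _)) (S.cells_mem o _ _ ?_)
    refine gy_smul_mem ?_
    rw [incl_single]
    exact S.e_mem j
  obtain ⟨o, j⟩ := i
  match o with
  | none => exact Submodule.zero_mem _
  | some 1 => exact hy none j
  | some 0 =>
    refine Submodule.add_mem _ (Submodule.sub_mem _ (single_mem_free _ gx_mem (add_comm _ _))
      (S.cells_mem none _ _ (S.xMap_single_mem j))) (hy (some 1) j)

theorem freeD_cells_none (h : S.J →₀ k) : freeD (exA k) S.diff (S.cells none h) = 0 := by
  induction h using Finsupp.induction_linear with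
  | zero => simp
  | add x y hx hy => simp only [map_add, hx, hy, add_zero]
  | single j r => rw [cells_single, map_smul, freeD_single_one, diff, smul_zero]

theorem freeD_cells_some (h : S.J →₀ k) : freeD (exA k) S.diff (S.cells (some 1) h) =
    gy k • S.cells none h - S.cells none (S.opY h) := by
  induction h using Finsupp.induction_linear with
  | zero => simp
  | add x y hx hy => simp only [map_add, hx, hy, smul_add]; abel
  | single j r =>
    rw [← Finsupp.smul_single_one, map_smul, map_smul, cells_single_one, freeD_single_one, diff,
      map_smul, map_smul, map_smul, cells_single_one, smul_sub]
    simp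

/-- On an $x$-cell the term $y^2e$ coming from $\partial x$ cancels the one coming from $y\,d(e^y)$,
the two terms $y\,e_{Yh}$ cancel, and what remains is $e_{Y^2h}=0$. -/
theorem freeD_diff (i : Option (Fin 2) × S.J) : freeD (exA k) S.diff (S.diff i) = 0 := by
  have hty : twist (exA k).grading 1 (gy k) = - gy k := twist_one_one _ gy_mem
  have htx : twist (exA k).grading 1 (gx k) = - gx k := twist_one_one _ gx_mem
  have hdy : (exA k).d (gy k) = 0 := faD_y
  have hdx : (exA k).d (gx k) = gy k ^ 2 := faD_x
  obtain ⟨o, j⟩ := i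
  match o with
  | none => rw [diff, map_zero]
  | some 1 =>
    rw [diff, map_sub, freeD_cells_none, freeD_single, hdy, diff, smul_zero]
    simp
  | some 0 =>
    rw [diff, map_add, map_sub, map_sub, freeD_cells_none, freeD_cells_some, freeD_single,
      freeD_single, opY_opY, hdy, hdx, hty, htx, diff, diff, map_zero, smul_zero,
      neg_smul, smul_sub, Finsupp.smul_single, smul_eq_mul, pow_two]
    simp

/-- The free resolution attached to a splitting. -/
abbrev resolution : DGMod (exA k) :=
  DGMod.free (exA k) S.cellDeg S.diff S.diff_mem S.freeD_diff

/-- The images of the cells under the augmentation of the resolution. -/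
def cellVal : Option (Fin 2) × S.J → M.carrier
  | (none, j) => S.e j
  | (some 1, j) => S.s (gy k • S.incl (Finsupp.single j 1))
  | (some 0, j) => S.s (S.xMap (Finsupp.single j 1))

theorem cellVal_cells_none (h : S.J →₀ k) :
    Finsupp.linearCombination (exA k).carrier S.cellVal (S.cells none h) = S.incl h := by
  induction h using Finsupp.induction_linear with
  | zero => simp
  | add x y hx hy => simp only [map_add, hx, hy]
  | single j r =>
    rw [cells_single, Finsupp.smul_single, Finsupp.linearCombination_single, smul_assoc, one_smul,
      incl, Finsupp.linearCombination_single, cellVal]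

theorem cellVal_cells_some (h : S.J →₀ k) :
    Finsupp.linearCombination (exA k).carrier S.cellVal (S.cells (some 1) h) =
      S.s (gy k • S.incl h) := by
  induction h using Finsupp.induction_linear with
  | zero => simp
  | add x y hx hy => simp only [map_add, hx, hy, smul_add]
  | single j r =>
    rw [cells_single, Finsupp.smul_single, Finsupp.linearCombination_single, smul_assoc, one_smul,
      cellVal]
    conv_rhs => rw [← Finsupp.smul_single_one j r, LinearMap.map_smul S.incl,
      smul_algebra_smul_comm, LinearMap.map_smul S.s]

/-- The augmentation of the resolution attached to a splitting. -/
def augmentation : dgHom S.resolution M :=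
  freeHom S.cellVal
    (by
      rintro ⟨o, j⟩
      match o with
      | none => exact S.e_mem j
      | some 1 =>
        refine S.s_mem' (gy_smul_mem ?_) rfl
        rw [incl_single]; exact S.e_mem j
      | some 0 => exact S.s_mem' (S.xMap_single_mem j) rfl)
    (by
      rintro ⟨o, j⟩
      match o with
      | none => rw [diff, map_zero, cellVal, S.d_e]
      | some 1 =>
        rw [diff, map_sub, cellVal_cells_none, Finsupp.linearCombination_single, cellVal, cellVal,
          opY_apply, S.incl_p _ (S.d_gy_incl _), incl_single, sub_sub_cancel]
      | some 0 =>
        -- The homotopy formula at `xMap`, with its differential rewritten by `d_xMap`, is the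
        -- required equation: the term $s\,d$ is the value on the $y$-cells of $Yh$.
        have h := S.homotopy (S.xMap (Finsupp.single j 1))
        rw [d_xMap] at h
        rw [diff, map_add, map_sub, map_sub, cellVal_cells_none, cellVal_cells_some,
          Finsupp.linearCombination_single, Finsupp.linearCombination_single, cellVal, cellVal,
          cellVal, ← incl_single, opX_apply]
        rw [← sub_eq_iff_eq_add] at h
        rw [← h, xMap_apply, incl]
        abel)

/-- The action of the free algebra on the cohomology. -/
def act : FA k →ₐ[k] Module.End k (S.J →₀ k) := FreeAlgebra.lift k ![S.opX, S.opY]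

/-- The operators `opX` and `opY` define an action on the cohomology without any relation to check,
since the algebra is free. The criterion is then applied with zero differential on $H$. -/
theorem augmentation_isQuasiIso : IsQuasiIso S.augmentation := by
  classical
  let θ : (S.J →₀ FA k) ≃ₗ[k] FA k ⊗[k] (S.J →₀ k) :=
    (TensorProduct.finsuppScalarRight k k (FA k) S.J).symm
  have hθ : ∀ j a, θ (Finsupp.single j a) = a ⊗ₜ Finsupp.single j 1 :=
    fun j a => TensorProduct.finsuppScalarRight_symm_apply_single _ _
  have hθ' : ∀ (a : FA k) h, θ.symm (a ⊗ₜ h) =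
      a • Finsupp.mapRange.linearMap (Algebra.linearMap k (FA k)) h := by
    intro a h
    rw [LinearEquiv.symm_apply_eq]
    induction h using Finsupp.induction_linear with
    | zero => simp
    | add x y hx hy => simp only [TensorProduct.tmul_add, smul_add, map_add, hx, hy]
    | single j r =>
      rw [Finsupp.mapRange.linearMap_apply, Finsupp.mapRange_single, Finsupp.smul_single, hθ,
        Algebra.linearMap_apply, smul_eq_mul, ← Algebra.commutes, ← Algebra.smul_def,
        TensorProduct.smul_tmul, Finsupp.smul_single_one]
  have hcomp : ∀ a h, θ (compCell (exA k) S.J none (a • S.cells none h)) = a ⊗ₜ h := by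
    intro a h
    rw [map_smul, ← LinearEquiv.eq_symm_apply, hθ']
    congr 1
    exact compCell_inclCell _ _
  refine isQuasiIso_of_free_cells S.act 0 S.augmentation S.incl θ ?_ ?_ ?_ ?_ ?_
  · intro l j b
    have hcell : ∀ v h, θ (compCell (exA k) S.J none (twist (faGrading k) 1 b •
        (Finsupp.single (none, j) v - S.cells none h))) =
        (twist (faGrading k) 1 b * v) ⊗ₜ[k] Finsupp.single j 1 - twist (faGrading k) 1 b ⊗ₜ h := by
      intro v h
      rw [smul_sub, map_sub, map_sub, hcomp, Finsupp.smul_single, compCell_single, hθ]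
      rfl
    rw [hθ, TensorProduct.map_tmul, koszulMap_tmul]
    match l with
    | 1 => rw [diff, hcell, act, FreeAlgebra.lift_ι_apply]; rfl
    | 0 =>
      have h0 : ∀ h, compCell (exA k) S.J none (S.cells (some 1) h) = 0 :=
        fun h => compCell_inclCell_ne (by simp) _
      rw [diff, smul_add, map_add, map_add, hcell, map_smul (compCell (exA k) S.J none) _ (_ - _),
        map_sub, h0, compCell_single_ne (by simp), sub_zero, smul_zero, map_zero, add_zero, act,
        FreeAlgebra.lift_ι_apply]
      rfl
  · intro h
    rw [hθ', one_smul, LinearMap.zero_apply, TensorProduct.tmul_zero, map_zero, map_zero]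
    exact S.freeD_cells_none h
  · intro h
    rw [hθ', one_smul]
    exact S.cellVal_cells_none h
  · rintro h - ⟨m, hm⟩
    refine ⟨0, ?_⟩
    rw [← S.p_incl h, ← hm, S.p_d]
    rfl
  · intro m hm
    refine ⟨S.p m, rfl, S.s m, ?_⟩
    rw [S.incl_p m hm, sub_sub_cancel]

theorem diff_mem_rankFiltration (i : Option (Fin 2) × S.J) :
    S.diff i ∈ rankFiltration (exA k) (fun i => cellRank i.1) (cellRank i.1) := by
  have h : ∀ o n, cellRank o < n → ∀ h,
      S.cells o h ∈ rankFiltration (exA k) (fun i => cellRank i.1) n := by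
    intro o n hn h
    induction h using Finsupp.induction_linear with
    | zero => rw [map_zero]; exact Submodule.zero_mem _
    | add x y hx hy => rw [map_add]; exact Submodule.add_mem _ hx hy
    | single j r =>
      rw [cells_single, Finsupp.smul_single]
      exact Finsupp.single_mem_supported _ _ hn
  obtain ⟨o, j⟩ := i
  match o with
  | none => exact Submodule.zero_mem _
  | some 1 =>
    exact Submodule.sub_mem _ (Finsupp.single_mem_supported _ _ Nat.zero_lt_one)
      (h none _ Nat.zero_lt_one _)
  | some 0 =>
    exact Submodule.add_mem _ (Submodule.sub_mem _
      (Finsupp.single_mem_supported _ _ Nat.zero_lt_two) (h none _ Nat.zero_lt_two _))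
      (Submodule.sub_mem _ (Finsupp.single_mem_supported _ _ Nat.one_lt_two)
        (h (some 1) _ Nat.one_lt_two _))

theorem augmentation_isSemifreeResolution : IsSemifreeResolution S.augmentation :=
  ⟨⟨_, rankFiltration_isSemifree _ S.diff_mem_rankFiltration⟩, S.augmentation_isQuasiIso⟩

end Splitting

theorem cellRank_le (o : Option (Fin 2)) : cellRank o ≤ 2 := by
  match o with
  | none => simp [cellRank]
  | some 0 => simp [cellRank]
  | some 1 => simp [cellRank]

theorem exists_cellRank_eq (m : ℕ) (hm : m ≤ 2) : ∃ o, cellRank o = m := by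
  match m with
  | 0 => exact ⟨none, rfl⟩
  | 1 => exact ⟨some 1, rfl⟩
  | 2 => exact ⟨some 0, rfl⟩

theorem coneLength_le_two (M : DGMod (exA k)) : coneLength M ≤ 2 := by
  obtain ⟨S⟩ := exists_splitting M
  refine le_trans (sInf_le ⟨S.resolution, S.augmentation,
    S.augmentation_isSemifreeResolution, rfl⟩) ?_
  refine dgFreeClass_free_le _ S.diff_mem_rankFiltration 2 (fun i => cellRank_le i.1) ?_
  rintro ⟨o, j⟩ m hm
  obtain ⟨o', ho'⟩ := exists_cellRank_eq m (hm.trans (cellRank_le o))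
  exact ⟨(o', j), ho'⟩

end Resolution

end
end DGA

namespace DGA

noncomputable section

variable {k : Type u} [Field k]

/-! ### The Koszul property -/

section Koszul

theorem exA_connected : IsConnected (exA k).toGrAlg := exDG_connected

variable (k) in
/-- The trivial module over `k⟨x, y⟩`. -/
abbrev exTrivial : DGMod (exA k) := DGMod.trivial exA_connected

theorem exTrivial_smul {n : ℤ} (hn : n ≠ 0) {a : FA k} (ha : a ∈ faGrading k n)
    (m : (exTrivial k).carrier) : a • m = 0 := by
  change augFun exA_connected a * (show k from m) = (0 : k)
  rw [augFun_of_ne exA_connected hn ha, zero_mul]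

variable (k) in
/-- The splitting of the trivial module. -/
def trivialSplitting : Splitting (exTrivial k) where
  J := PUnit
  deg := fun _ => 0
  e := fun _ => (1 : k)
  p := (Finsupp.lsingle PUnit.unit : k →ₗ[k] PUnit →₀ k)
  s := 0
  e_mem := fun _ => (Submodule.mem_top : (1 : k) ∈ (⊤ : Submodule k k))
  p_mem := by
    intro n (m : k) hm j hj
    by_contra h
    have hm : m ∈ (if n = 0 then (⊤ : Submodule k k) else ⊥) := hm
    rw [if_neg (Ne.symm h), Submodule.mem_bot] at hm
    rw [hm] at hj
    exact hj (DFunLike.congr_fun (Finsupp.single_zero PUnit.unit) j)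
  s_mem := fun _ _ _ => Submodule.zero_mem _
  d_e := fun _ => rfl
  p_d := fun _ => map_zero _
  p_e := fun _ => rfl
  homotopy := by
    intro (m : k)
    change m - Finsupp.linearCombination k (fun _ => (1 : k)) (Finsupp.single PUnit.unit m) = 0 + 0
    rw [Finsupp.linearCombination_single, smul_eq_mul, mul_one, sub_self, add_zero]

theorem trivialSplitting_opY : (trivialSplitting k).opY = 0 := by
  ext j : 1
  ext : 1
  change (trivialSplitting k).p (gy k • _) = 0
  rw [exTrivial_smul one_ne_zero gy_mem, map_zero]

theorem trivialSplitting_opX : (trivialSplitting k).opX = 0 := by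
  ext j : 1
  ext : 1
  change (trivialSplitting k).p (gx k • _ + gy k • _) = 0
  rw [exTrivial_smul one_ne_zero gy_mem, exTrivial_smul one_ne_zero gx_mem, add_zero, map_zero]

theorem smul_mem_maximal {A : DGAlg k} (hA : IsConnected A.toGrAlg) {F : DGMod A} (a : A.carrier)
    {x : F.carrier} (hx : x ∈ Submodule.span k {y : F.carrier |
      ∃ n > 0, ∃ a ∈ A.grading n, ∃ z, y = a • z}) :
    a • x ∈ Submodule.span k {y : F.carrier | ∃ n > 0, ∃ a ∈ A.grading n, ∃ z, y = a • z} := by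
  induction a using hom_induction A.grading with
  | h0 => rw [zero_smul]; exact Submodule.zero_mem _
  | hadd a b ha hb => rw [add_smul]; exact Submodule.add_mem _ ha hb
  | hh i a ha =>
    rcases lt_or_ge i 0 with hi | hi
    · rw [hA.neg i hi, Submodule.mem_bot] at ha
      rw [ha, zero_smul]; exact Submodule.zero_mem _
    induction hx using Submodule.span_induction with
    | mem x h =>
      obtain ⟨n, hn, b, hb, z, rfl⟩ := h
      exact Submodule.subset_span ⟨i + n, by omega, a * b, mul_mem' _ ha hb, z,
        (mul_smul a b z).symm⟩
    | zero => rw [smul_zero]; exact Submodule.zero_mem _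
    | add x y _ _ hx hy => rw [smul_add]; exact Submodule.add_mem _ hx hy
    | smul r x _ hx => rw [smul_algebra_smul_comm]; exact Submodule.smul_mem _ _ hx

/-- Over a connected algebra the differential of a coefficient has positive degree, so minimality
needs to be tested on the cells only. -/
theorem isMinimalDG_free {A : DGAlg k} (hA : IsConnected A.toGrAlg) {ι : Type u} {deg : ι → ℤ}
    {δ : ι → ι →₀ A.carrier} {hδ : ∀ i, δ i ∈ freeGrading A.toGrAlg deg (deg i + 1)}
    {hδδ : ∀ i, freeD A δ (δ i) = 0}
    (h : ∀ i, δ i ∈ Submodule.span k {y : ι →₀ A.carrier |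
      ∃ n > 0, ∃ a ∈ A.grading n, ∃ z, y = a • z}) :
    IsMinimalDG (DGMod.free A deg δ hδ hδδ) := by
  intro x
  induction x using Finsupp.induction_linear with
  | zero => rw [map_zero]; exact Submodule.zero_mem _
  | add x y hx hy => rw [map_add]; exact Submodule.add_mem _ hx hy
  | single i a =>
    rw [freeD_single]
    refine Submodule.add_mem _ ?_ (smul_mem_maximal (F := DGMod.free A deg δ hδ hδδ) hA _ (h i))
    induction a using hom_induction A.grading with
    | h0 => simp
    | hadd a b ha hb => rw [map_add, Finsupp.single_add]; exact Submodule.add_mem _ ha hb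
    | hh n a ha =>
      rcases lt_or_ge n 0 with hn | hn
      · rw [hA.neg n hn, Submodule.mem_bot] at ha
        rw [ha, map_zero, Finsupp.single_zero]; exact Submodule.zero_mem _
      · exact Submodule.subset_span ⟨n + 1, by omega, A.d a, A.d_mem n a ha, Finsupp.single i 1,
          by rw [Finsupp.smul_single, smul_eq_mul, mul_one]⟩

/-- On $k$ both induced operators vanish, so the cells have differentials with coefficients $x$ and
$y$ only. The degree 1 of these coefficients equals that of $d$, which keeps all cells in degree 0.
-/
theorem exA_isKoszul : IsKoszul (exA_connected (k := k)) := by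
  refine ⟨(trivialSplitting k).resolution, (trivialSplitting k).augmentation,
    (trivialSplitting k).augmentation_isSemifreeResolution, isMinimalDG_free exA_connected ?_,
    _, Finsupp.basisSingleOne, fun i => cellRank i.1, ⟨fun i => ⟨0, ?_⟩, fun i => ?_⟩,
    fun i => ?_⟩
  · have h : ∀ (i : Option (Fin 2) × (trivialSplitting k).J), ∀ v ∈ faGrading k 1,
        Finsupp.single i v ∈ Submodule.span k
        {y : Option (Fin 2) × (trivialSplitting k).J →₀ FA k |
          ∃ n > 0, ∃ a ∈ faGrading k n, ∃ z, y = a • z} := by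
      intro i v hv
      exact Submodule.subset_span ⟨1, one_pos, v, hv, Finsupp.single i 1,
        by rw [Finsupp.smul_single, smul_eq_mul, mul_one]⟩
    rintro ⟨o, j⟩
    match o with
    | none => exact Submodule.zero_mem _
    | some 1 =>
      rw [Splitting.diff, trivialSplitting_opY, LinearMap.zero_apply, map_zero, sub_zero]
      exact h _ _ gy_mem
    | some 0 =>
      rw [Splitting.diff, trivialSplitting_opY, trivialSplitting_opX, LinearMap.zero_apply,
        map_zero, map_zero, sub_zero, sub_zero]
      exact Submodule.add_mem _ (h _ _ gx_mem) (h _ _ gy_mem)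
  · rw [Finsupp.coe_basisSingleOne]
    exact single_mem_free i (one_mem' (exA k).toGrAlg) rfl
  · rw [Finsupp.coe_basisSingleOne, freeD_single_one]
    have := (trivialSplitting k).diff_mem_rankFiltration i
    rw [rankFiltration, Finsupp.supported_eq_span_single] at this
    refine Submodule.span_mono ?_ this
    rintro _ ⟨j, hj, rfl⟩
    exact ⟨j, hj, rfl⟩
  · rw [Finsupp.coe_basisSingleOne]
    exact single_mem_free i (one_mem' (exA k).toGrAlg) rfl

end Koszul

/-! ### The lower bound for cone lengths -/

section Ghost

/-- A morphism out of a semi-free module of class at most one that vanishes on cohomology and takes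
values in a part of the target where cocycles bound is null-homotopic. -/
theorem exists_homotopy_of_ghost {B : DGAlg k} {F : DGMod B}
    {G : ℕ → Submodule B.carrier F.carrier} (hG : IsSemifreeFiltration F G) (h2 : G 2 = ⊤)
    {N : Type u} [AddCommGroup N] [Module k N] (Θ : B.carrier →ₐ[k] Module.End k N)
    (dN : N →ₗ[k] N) (hdN : ∀ b v, dN (Θ b v) = Θ (B.d b) v + Θ (twist B.grading 1 b) (dN v))
    (φ : F.carrier →ₗ[k] N) (hφ : ∀ b z, φ (b • z) = Θ b (φ z)) (hφd : ∀ z, φ (F.d z) = dN (φ z))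
    (S : Submodule k N) (hS : ∀ b, ∀ v ∈ S, Θ b v ∈ S) (hφS : ∀ z, φ z ∈ S)
    (hφ0 : ∀ z, F.d z = 0 → ∃ v ∈ S, dN v = φ z) (hS0 : ∀ v ∈ S, dN v = 0 → ∃ w, dN w = v) :
    ∃ σ : F.carrier →ₗ[k] N, (∀ b z, σ (b • z) = Θ (twist B.grading 1 b) (σ z)) ∧
      ∀ z, φ z = dN (σ z) + σ (F.d z) := by
  -- As `G i` is $F(i-1)$, the condition `G 2 = ⊤` leaves two layers: cocycles `e` spanning `G 1`,
  -- and elements `g` completing them to a basis, with differentials in `G 1`.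
  obtain ⟨ι₀, e, -, he, hei, hes⟩ := hG.free 0
  obtain ⟨ι₁, g, -, hg, hgi, hgs⟩ := hG.free 1
  rw [hG.zero, bot_sup_eq] at hes
  have he0 : ∀ j, F.d (e j) = 0 := fun j => by
    have := he j
    rwa [hG.zero, Submodule.mem_bot] at this
  have heG : ∀ j, e j ∈ G 1 := fun j => by
    rw [← hes]; exact Submodule.subset_span ⟨j, rfl⟩
  have hei' : LinearIndependent B.carrier e := by
    refine LinearIndependent.of_comp (G 0).mkQ hei
  have hli : LinearIndependent B.carrier (Sum.elim e g) := by
    have := LinearIndependent.sumElim_of_quotient (M' := G 1) (f := fun j => ⟨e j, heG j⟩)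
      (LinearIndependent.of_comp (G 1).subtype hei') g hgi
    exact this
  have hsp : ⊤ ≤ Submodule.span B.carrier (Set.range (Sum.elim e g)) := by
    rw [Set.Sum.elim_range, Submodule.span_union, hes]
    change ⊤ ≤ G 1 ⊔ _
    rw [hgs, h2]
  let bas := Module.Basis.mk hli hsp
  let lift : (ι₀ ⊕ ι₁ → N) → F.carrier →ₗ[k] N := fun τ =>
    signedLift B.toGrAlg Θ τ ∘ₗ bas.repr.toLinearMap.restrictScalars k
  have lift_smul : ∀ τ (b : B.carrier) z, lift τ (b • z) = Θ (twist B.grading 1 b) (lift τ z) := by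
    intro τ b z
    change signedLift B.toGrAlg Θ τ (bas.repr (b • z)) = _
    rw [map_smul, signedLift_smul]
    rfl
  have lift_bas : ∀ τ i, lift τ (Sum.elim e g i) = τ i := by
    intro τ i
    change signedLift B.toGrAlg Θ τ (bas.repr (Sum.elim e g i)) = _
    have : Sum.elim e g i = bas i := by simp [bas]
    rw [this, Module.Basis.repr_self, signedLift_single,
      twist_one_zero _ (one_mem' B.toGrAlg), map_one]
    rfl
  choose τ₀ hτ₀S hτ₀ using fun j => hφ0 (e j) (he0 j)
  -- the identity `φ = d σ + σ d` is linear in the module variable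
  have hclosed : ∀ τ (b : B.carrier) z, φ z = dN (lift τ z) + lift τ (F.d z) →
      φ (b • z) = dN (lift τ (b • z)) + lift τ (F.d (b • z)) := by
    intro τ b z hz
    rw [hφ, hz, lift_smul, hdN, F.d_smul, map_add, map_add, lift_smul, lift_smul, d_twist,
      twist_twist, map_neg, LinearMap.neg_apply]
    abel
  have hspan : ∀ τ (T : Set F.carrier), (∀ z ∈ T, φ z = dN (lift τ z) + lift τ (F.d z)) →
      ∀ z ∈ Submodule.span B.carrier T, φ z = dN (lift τ z) + lift τ (F.d z) := by
    intro τ T hT z hz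
    induction hz using Submodule.span_induction with
    | mem z h => exact hT z h
    | zero => simp
    | add x y _ _ hx hy => simp only [map_add, hx, hy]; abel
    | smul b z _ hz => exact hclosed τ b z hz
  have hG1 : ∀ τ₁, ∀ z ∈ G 1, φ z = dN (lift (Sum.elim τ₀ τ₁) z) +
      lift (Sum.elim τ₀ τ₁) (F.d z) := by
    intro τ₁
    rw [← hes]
    refine hspan _ _ ?_
    rintro _ ⟨j, rfl⟩
    rw [he0, map_zero, add_zero, ← hτ₀]
    exact congrArg dN (lift_bas (Sum.elim τ₀ τ₁) (Sum.inl j)).symm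
  -- The values on the second layer are chosen in terms of $\sigma$ on the first, so $\sigma$ on `G
  -- 1` must not depend on them. It takes values in $S$ there because $S$ is stable under the
  -- action.
  have hindep : ∀ τ₁, ∀ z ∈ G 1, lift (Sum.elim τ₀ τ₁) z = lift (Sum.elim τ₀ 0) z ∧
      lift (Sum.elim τ₀ 0) z ∈ S := by
    intro τ₁ z hz
    rw [← hes] at hz
    induction hz using Submodule.span_induction with
    | mem z h =>
      obtain ⟨j, rfl⟩ := h
      have h := fun τ => lift_bas (Sum.elim τ₀ τ) (Sum.inl j)
      simp only [Sum.elim_inl] at h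
      rw [h, h]
      exact ⟨rfl, hτ₀S j⟩
    | zero => simp
    | add x y _ _ hx hy =>
      rw [map_add, map_add, hx.1, hy.1]
      exact ⟨rfl, S.add_mem hx.2 hy.2⟩
    | smul b z _ hz =>
      rw [lift_smul, lift_smul, hz.1]
      exact ⟨rfl, hS _ _ hz.2⟩
  -- The obstruction $\varphi(g)-\sigma(dg)$ is a cocycle in $S$, by the homotopy identity on `G 1`.
  -- It therefore bounds in $N$, though possibly not inside $S$.
  have hτ₁ : ∀ l, ∃ w, dN w = φ (g l) - lift (Sum.elim τ₀ 0) (F.d (g l)) := by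
    intro l
    refine hS0 _ (S.sub_mem (hφS _) (hindep 0 _ (hg l)).2) ?_
    have := hG1 0 _ (hg l)
    rw [F.d_d, map_zero, add_zero] at this
    rw [map_sub, ← hφd, this, sub_self]
  choose τ₁ hτ₁ using hτ₁
  refine ⟨lift (Sum.elim τ₀ τ₁), lift_smul _, fun z => ?_⟩
  refine hspan _ _ ?_ z (hsp Submodule.mem_top)
  rintro _ ⟨j | l, rfl⟩
  · exact hG1 τ₁ _ (heG j)
  · have := lift_bas (Sum.elim τ₀ τ₁) (Sum.inr l)
    rw [this]
    simp only [Sum.elim_inr]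
    rw [hτ₁, (hindep τ₁ _ (hg l)).1, sub_add_cancel]

variable (k) in
/-- The differential `p ↦ n`, `p' ↦ q` on the space with basis `n, p, q, p', r`. -/
def ghostD : (Fin 5 → k) →ₗ[k] (Fin 5 → k) where
  toFun v := ![v 1, 0, v 3, 0, 0]
  map_add' v w := by ext i; fin_cases i <;> simp
  map_smul' c v := by ext i; fin_cases i <;> simp

variable (k) in
/-- The operator `p ↦ q`, `p' ↦ r` on the space with basis `n, p, q, p', r`. -/
def ghostY : (Fin 5 → k) →ₗ[k] (Fin 5 → k) where
  toFun v := ![0, 0, v 1, 0, v 3]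
  map_add' v w := by ext i; fin_cases i <;> simp
  map_smul' c v := by ext i; fin_cases i <;> simp

theorem ghostD_apply (v : Fin 5 → k) : ghostD k v = ![v 1, 0, v 3, 0, 0] := rfl

theorem ghostY_apply (v : Fin 5 → k) : ghostY k v = ![0, 0, v 1, 0, v 3] := rfl

variable (k) in
/-- The action of `k⟨x, y⟩` on the space with basis `n, p, q, p', r`. -/
def ghostAct : FA k →ₐ[k] Module.End k (Fin 5 → k) := FreeAlgebra.lift k ![0, ghostY k]

theorem ghostAct_x : ghostAct k (gx k) = 0 := by
  rw [ghostAct, FreeAlgebra.lift_ι_apply]; rfl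

theorem ghostAct_y : ghostAct k (gy k) = ghostY k := by
  rw [ghostAct, FreeAlgebra.lift_ι_apply]; rfl

/-- The vector $n$ spans a copy of the trivial module, so a linear map to $k$ that is compatible
with the augmentation yields a map to the test module. -/
theorem ghostAct_n (a : FA k) (c : k) : ghostAct k a ![c, 0, 0, 0, 0] =
    ![aug exA_connected a * c, 0, 0, 0, 0] := by
  induction a using FreeAlgebra.induction generalizing c with
  | grade0 r =>
    rw [AlgHom.commutes]
    have := (aug (exA_connected (k := k))).commutes r
    erw [this]
    ext i; fin_cases i <;> simp
  | grade1 i =>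
    have : aug exA_connected (FreeAlgebra.ι k i) = (0 : k) :=
      augFun_of_ne exA_connected one_ne_zero (ι_mem i)
    rw [this, zero_mul]
    fin_cases i
    · change ghostAct k (gx k) _ = _
      rw [ghostAct_x]; ext i; fin_cases i <;> simp
    · change ghostAct k (gy k) _ = _
      rw [ghostAct_y, ghostY_apply]; rfl
  | mul a b ha hb => rw [map_mul, Module.End.mul_apply, hb, ha]; erw [map_mul]; rw [mul_assoc]
  | add a b ha hb =>
    rw [map_add, LinearMap.add_apply, ha, hb]
    erw [map_add]
    ext i; fin_cases i <;> simp [add_mul]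

/-- On generators this says that the operator of $y$ has square zero, since $x$ acts as 0, and that
it composes to zero with the differential in both orders. Both sides obey the same product rule. -/
theorem ghostD_ghostAct (a : FA k) (v : Fin 5 → k) : ghostD k (ghostAct k a v) =
    ghostAct k (faD k a) v + ghostAct k (twist (faGrading k) 1 a) (ghostD k v) := by
  induction a using FreeAlgebra.induction generalizing v with
  | grade0 r =>
    have h1 : twist (faGrading k) 1 (1 : FA k) = 1 :=
      twist_one_zero (faGrading k) (one_mem' (exA k).toGrAlg)
    rw [Algebra.algebraMap_eq_smul_one, map_smul (faD k), map_smul (twist (faGrading k) 1), faD_one,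
      h1]
    simp
  | grade1 i =>
    rw [twist_one_one (faGrading k) (ι_mem i)]
    fin_cases i
    · change ghostD k (ghostAct k (gx k) v) = ghostAct k (faD k (gx k)) v +
        ghostAct k (-gx k) (ghostD k v)
      rw [faD_x, map_neg, map_pow, ghostAct_x, ghostAct_y, pow_two, Module.End.mul_apply,
        ghostY_apply, ghostY_apply]
      ext i; fin_cases i <;> simp
    · change ghostD k (ghostAct k (gy k) v) = ghostAct k (faD k (gy k)) v +
        ghostAct k (-gy k) (ghostD k v)
      rw [faD_y, map_neg, ghostAct_y, map_zero, LinearMap.neg_apply, ghostY_apply, ghostY_apply,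
        ghostD_apply, ghostD_apply]
      ext i; fin_cases i <;> simp
  | mul a b ha hb =>
    have h1 : faD k (a * b) = faD k a * b + twist (faGrading k) 1 a * faD k b :=
      leibniz' (exA k) a b
    have h2 : twist (faGrading k) 1 (a * b) = _ := twist_mul (exA k).toGrAlg a b
    rw [map_mul, Module.End.mul_apply, ha, hb, h1, h2]
    simp only [map_add, map_mul, LinearMap.add_apply, Module.End.mul_apply]
    abel
  | add a b ha hb => simp only [map_add, LinearMap.add_apply, ha, hb]; abel

/-- Stated over a general $B$ mapping to `k⟨x, y⟩`, with `ξ` and `η` in the roles of $x$ and $y$, so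
that it serves both $k$ over $A$ and $A$ over $A^e$. Class at most 1 would make the map $F\to M\to
k\to\langle n\rangle$ null-homotopic, and a Massey-type chain of elements of $F$ excludes that. -/
theorem two_le_coneLength {B : DGAlg k} (M : DGMod B) (π : B.carrier →ₐ[k] FA k)
    (hπt : ∀ b, π (twist B.grading 1 b) = twist (faGrading k) 1 (π b))
    (hπd : ∀ b, π (B.d b) = faD k (π b)) (ξ η : B.carrier) (hξ : ξ ∈ B.grading 1)
    (hη : η ∈ B.grading 1) (hdη : B.d η = 0) (hdξ : B.d ξ = η * η) (hπξ : π ξ = gx k)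
    (hπη : π η = gy k) (ε : M.carrier →ₗ[k] k)
    (hε : ∀ b m, ε (b • m) = aug exA_connected (π b) * ε m) (hεd : ∀ m, ε (M.d m) = 0)
    (m₀ : M.carrier) (hm₀ : m₀ ∈ M.grading 0) (hdm₀ : M.d m₀ = 0) (hεm₀ : ε m₀ = 1)
    (hneg : M.grading (-1) = ⊥) (hξm₀ : ξ • m₀ = 0) (hηm : ∀ m ∈ M.grading 0, η • m = 0) :
    2 ≤ coneLength M := by
  refine le_sInf ?_
  rintro _ ⟨F, f, ⟨-, hf⟩, rfl⟩
  refine le_sInf ?_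
  rintro _ ⟨G, n, hG, -, ⟨hn, -⟩, rfl⟩
  by_contra! hlt
  have hn1 : n + 1 ≤ 2 := by
    have : n < 2 := by exact_mod_cast hlt
    omega
  have h2 : G 2 = ⊤ := top_le_iff.1 (hn.symm.le.trans (hG.mono hn1))
  rw [isQuasiIso_iff] at hf
  have hηtw : twist B.grading 1 η = -η := twist_one_one _ hη
  have hξtw : twist B.grading 1 ξ = -ξ := twist_one_one _ hξ
  -- the cells of a resolution that is a priori longer
  obtain ⟨u, hu, hdu, hfu⟩ : ∃ u ∈ F.grading 0, F.d u = 0 ∧ f.1 u = m₀ := by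
    obtain ⟨u, hdu, m', hm'⟩ := hf.2 m₀ hdm₀
    refine ⟨proj F.grading 0 u, proj_mem _ _ _, by rw [F.d_proj, hdu, map_zero], ?_⟩
    -- With nothing in degree $-1$ there are no coboundaries in degree 0, so $u$ lifts $m_0$ exactly
    -- and not just up to a coboundary.
    have h1 := proj_mem M.grading (-1) m'
    rw [hneg, Submodule.mem_bot] at h1
    have h := congrArg (proj M.grading 0) hm'
    rw [map_sub, ← dgHom_proj, proj_same _ hm₀, ← neg_add_cancel (1 : ℤ), ← M.d_proj, h1,
      map_zero] at h
    exact (sub_eq_zero.1 h.symm).symm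
  obtain ⟨v, hv, hdv⟩ : ∃ v ∈ F.grading 0, F.d v = η • u := by
    obtain ⟨v, hv⟩ := hf.1 (η • u) (by rw [F.d_smul, hdη, hdu]; simp)
      ⟨0, by rw [map_smul, hfu, hηm _ hm₀, map_zero]⟩
    -- Taking $v$ in degree 0 makes `hηm` applicable to its image, which is needed to produce $w$.
    refine ⟨proj F.grading 0 v, proj_mem _ _ _, ?_⟩
    rw [F.d_proj, hv]
    exact proj_same _ (F.smul_mem 1 0 _ _ hη hu)
  obtain ⟨w, hdw⟩ := hf.1 (ξ • u + η • v)
    (by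
      rw [map_add, F.d_smul, F.d_smul, hdη, hdξ, hdu, hdv, hηtw, mul_smul, neg_smul]
      simp)
    ⟨0, by rw [map_add, map_smul, map_smul, hfu, hξm₀, hηm _ (f.2.1 _ _ hv), map_zero, add_zero]⟩
  let φ : F.carrier →ₗ[k] (Fin 5 → k) :=
    LinearMap.single k (fun _ => k) 0 ∘ₗ ε ∘ₗ f.1.restrictScalars k
  have hφ : ∀ z, φ z = ![ε (f.1 z), 0, 0, 0, 0] := by
    intro z
    change (Pi.single 0 (ε (f.1 z)) : Fin 5 → k) = _
    ext i; fin_cases i <;> simp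
  -- This is the span of $n,p,q$. In it $n$ is the differential of $p$, and its cocycles, spanned by
  -- $n$ and $q$, are all coboundaries in the whole test module.
  let S : Submodule k (Fin 5 → k) :=
    LinearMap.ker (LinearMap.proj (R := k) (φ := fun _ : Fin 5 => k) 3) ⊓
      LinearMap.ker (LinearMap.proj (R := k) (φ := fun _ : Fin 5 => k) 4)
  have hS : ∀ v, v ∈ S ↔ v 3 = 0 ∧ v 4 = 0 := fun v => Iff.rfl
  obtain ⟨σ, hσ, hσd⟩ := exists_homotopy_of_ghost hG h2 ((ghostAct k).comp π) (ghostD k)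
    (by
      intro b v
      change ghostD k (ghostAct k (π b) v) = ghostAct k (π (B.d b)) v +
        ghostAct k (π (twist B.grading 1 b)) (ghostD k v)
      rw [ghostD_ghostAct, hπd, hπt])
    φ
    (by
      intro b z
      change _ = ghostAct k (π b) (φ z)
      rw [hφ, hφ, ghostAct_n, map_smul, hε])
    (by
      intro z
      rw [hφ, hφ, f.2.2, hεd, ghostD_apply]
      ext i; fin_cases i <;> simp)
    S
    (by
      intro b v hv
      change ghostAct k (π b) v ∈ S
      generalize π b = a
      induction a using FreeAlgebra.induction generalizing v with
      | grade0 r =>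
        rw [AlgHom.commutes]
        exact S.smul_mem r hv
      | grade1 i =>
        fin_cases i
        · change ghostAct k (gx k) v ∈ S
          rw [ghostAct_x]; exact S.zero_mem
        · change ghostAct k (gy k) v ∈ S
          rw [ghostAct_y, hS, ghostY_apply]
          exact ⟨rfl, ((hS v).1 hv).1⟩
      | mul a b ha hb => rw [map_mul]; exact ha _ (hb v hv)
      | add a b ha hb => rw [map_add]; exact S.add_mem (ha v hv) (hb v hv))
    (by intro z; rw [hφ, hS]; exact ⟨rfl, rfl⟩)
    (by
      intro z _
      refine ⟨![0, ε (f.1 z), 0, 0, 0], (hS _).2 ⟨rfl, rfl⟩, ?_⟩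
      rw [hφ, ghostD_apply]
      rfl)
    (by
      intro v hv hdv
      rw [ghostD_apply] at hdv
      have h1 := (hS v).1 hv
      have h2 : v 1 = 0 := congrFun hdv 0
      refine ⟨![0, v 0, 0, v 2, 0], ?_⟩
      rw [ghostD_apply]
      ext i; fin_cases i <;> simp [h1, h2])
  have hση : ∀ z, σ (η • z) = - ghostY k (σ z) := by
    intro z
    rw [hσ, hηtw]
    change ghostAct k (π (-η)) _ = _
    rw [map_neg, hπη, map_neg, ghostAct_y]; rfl
  have hσξ : ∀ z, σ (ξ • z) = 0 := by
    intro z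
    rw [hσ, hξtw]
    change ghostAct k (π (-ξ)) _ = _
    rw [map_neg, hπξ, map_neg, ghostAct_x]; simp
  have h1 := hσd u
  have h2 := hσd v
  have h3 := hσd w
  rw [hdu, map_zero, add_zero, hφ, hfu, hεm₀, ghostD_apply] at h1
  rw [hdv, hση, hφ, ghostD_apply, ghostY_apply] at h2
  rw [hdw, map_add, hσξ, hση, zero_add, hφ, ghostD_apply, ghostY_apply] at h3
  -- The coordinate $n$ at $u$ gives $\sigma(u)_p=1$, the coordinate $q$ at $v$ gives
  -- $\sigma(v)_{p'}=\sigma(u)_p$, and the coordinate $r$ at $w$ gives $\sigma(v)_{p'}=0$.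
  have e1 := congrFun h1 0
  have e2 := congrFun h2 2
  have e3 := congrFun h3 4
  simp at e1 e2 e3
  rw [← e1, e3] at e2
  simp at e2

theorem coneLength_trivial : coneLength (exTrivial k) = 2 := by
  refine le_antisymm (coneLength_le_two _) ?_
  refine two_le_coneLength (exTrivial k) (AlgHom.id k _) (fun _ => rfl) (fun _ => rfl) (gx k) (gy k)
    gx_mem gy_mem faD_y (faD_x.trans (pow_two _)) rfl rfl (LinearMap.id : k →ₗ[k] k)
    (fun _ _ => rfl) (fun _ => rfl) (1 : k)
    (Submodule.mem_top : (1 : k) ∈ (⊤ : Submodule k k)) rfl rfl rfl ?_ ?_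
  · exact exTrivial_smul one_ne_zero gx_mem _
  · exact fun m _ => exTrivial_smul one_ne_zero gy_mem m

theorem leftGlobalDim_exA : leftGlobalDim (exA k) = 2 :=
  le_antisymm (iSup_le coneLength_le_two)
    (coneLength_trivial.symm.le.trans (le_iSup (fun M => coneLength M) (exTrivial k)))

end Ghost

end
end DGA

namespace DGA

noncomputable section

variable {k : Type u} [Field k]

/-! ### Compactness of finite free modules -/

section Compact

variable {A : DGAlg k}

/-- The projection onto a summand. -/
def sumProj {I : Type u} (N : I → DGMod A) (i : I) : dgHom (DGMod.sum N) (N i) :=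
  ⟨DirectSum.component A.carrier I (fun i => (N i).carrier) i, fun _ _ hm => hm i, fun m => by
    exact DirectSum.lmap_apply (fun i => (N i).d) m i⟩

/-- The composition of morphisms of DG modules. -/
def dgComp {M N P : DGMod A} (g : dgHom N P) (f : dgHom M N) : dgHom M P :=
  ⟨g.1 ∘ₗ f.1, fun n m hm => g.2.1 n _ (f.2.1 n m hm), fun m => by
    change g.1 (f.1 (M.d m)) = P.d (g.1 (f.1 m))
    rw [f.2.2, g.2.2]⟩

theorem HoHom.comp_mk (M : DGMod A) {N N' : DGMod A} (g : dgHom N N') (f : dgHom M N) :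
    HoHom.comp M g (QuotientAddGroup.mk f) = QuotientAddGroup.mk (dgComp g f) := rfl

open scoped Classical in
theorem sumProj_incl {I : Type u} (N : I → DGMod A) (i j : I) (m : (N i).carrier) :
    (sumProj N j).1 ((DGMod.incl N i).1 m) = DirectSum.of (fun i => (N i).carrier) i m j := rfl

open scoped Classical in
theorem comp_sumProj_coprodMap (F : DGMod A) {I : Type u} (N : I → DGMod A) (j : I)
    (x : ⨁ i, HoHom F (N i)) : HoHom.comp F (sumProj N j) (coprodMap F N x) = x j := by
  induction x using DirectSum.induction_on with
  | zero => rw [map_zero, map_zero]; rfl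
  | add x y hx hy => rw [map_add, map_add, hx, hy]; rfl
  | of i y =>
    obtain ⟨f, rfl⟩ := QuotientAddGroup.mk_surjective y
    rw [coprodMap, DirectSum.toAddMonoid_of, HoHom.comp_mk, HoHom.comp_mk]
    by_cases h : i = j
    · subst h
      rw [DirectSum.of_eq_same]
      congr 1
      refine Subtype.ext (LinearMap.ext fun m => ?_)
      change (sumProj N i).1 ((DGMod.incl N i).1 (f.1 m)) = _
      rw [sumProj_incl, DirectSum.of_eq_same]
    · rw [DirectSum.of_eq_of_ne _ _ _ (Ne.symm h), ← QuotientAddGroup.mk_zero]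
      congr 1
      refine Subtype.ext (LinearMap.ext fun m => ?_)
      change (sumProj N j).1 ((DGMod.incl N i).1 (f.1 m)) = _
      rw [sumProj_incl, DirectSum.of_eq_of_ne _ _ _ (Ne.symm h)]
      rfl

/-- The projections to the summands give injectivity. For surjectivity, the images of finitely many
basis elements meet finitely many summands, so a morphism equals the finite sum of its components,
already before passing to homotopy classes. -/
theorem coprodMap_bijective_of_finite {ι : Type u} [Finite ι] (F : DGMod A)
    (b : Module.Basis ι A.carrier F.carrier) {I : Type u} (N : I → DGMod A) :
    Function.Bijective (coprodMap F N) := by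
  classical
  constructor
  · rw [injective_iff_map_eq_zero]
    intro x hx
    refine DFinsupp.ext fun j => ?_
    rw [← comp_sumProj_coprodMap, hx, map_zero]
    rfl
  · intro y
    obtain ⟨f, rfl⟩ := QuotientAddGroup.mk_surjective y
    have := Fintype.ofFinite ι
    let s : Finset I := Finset.univ.biUnion fun l => DFinsupp.support (show ⨁ i, (N i).carrier from f.1 (b l))
    let g : dgHom F (DGMod.sum N) := ∑ i ∈ s, dgComp (DGMod.incl N i) (dgComp (sumProj N i) f)
    have hg : g = f := by
      refine Subtype.ext (b.ext fun l => ?_)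
      refine DFinsupp.ext fun j => ?_
      rw [AddSubgroup.val_finsetSum, LinearMap.sum_apply]
      change (sumProj N j).1 _ = _
      rw [map_sum]
      have h : ∀ i, (sumProj N j).1 ((dgComp (DGMod.incl N i) (dgComp (sumProj N i) f)).1 (b l)) =
          DirectSum.of (fun i => (N i).carrier) i ((show ⨁ i, (N i).carrier from f.1 (b l)) i) j :=
        fun i => rfl
      simp only [h]
      rw [Finset.sum_eq_single j, DirectSum.of_eq_same]
      · intro i _ hij; exact DirectSum.of_eq_of_ne _ _ _ (Ne.symm hij)
      · intro hj
        rw [DirectSum.of_eq_same]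
        by_contra h
        exact hj (Finset.mem_biUnion.2 ⟨l, Finset.mem_univ l, DFinsupp.mem_support_iff.2 h⟩)
    refine ⟨∑ i ∈ s, DirectSum.of (fun i => HoHom F (N i)) i
      (QuotientAddGroup.mk (dgComp (sumProj N i) f)), ?_⟩
    rw [map_sum]
    simp only [coprodMap, DirectSum.toAddMonoid_of, HoHom.comp_mk]
    conv_rhs => rw [← hg]
    exact (map_sum (QuotientAddGroup.mk' (nullHomotopic F (DGMod.sum N))) _ s).symm

end Compact

/-! ### The bimodule resolution -/

section Bimodule

variable (k) in
/-- The enveloping algebra of `k⟨x, y⟩`. -/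
def exE : DGAlg k := (exA k).env

/-- The tensor `a ⊗ b` in the enveloping algebra. -/
abbrev et (a b : FA k) : (exE k).carrier :=
  GradedTensorProduct.tmul k (𝒜 := (exA k).grading) (ℬ := (exA k).op.grading) a b

theorem one_mem_fa : (1 : FA k) ∈ faGrading k 0 := one_mem' (exA k).toGrAlg

theorem et_mul {i j : ℤ} (a : FA k) {b : FA k} (hb : b ∈ faGrading k j) {a' : FA k}
    (ha' : a' ∈ faGrading k i) (b' : FA k) : et a b * et a' b' =
      (-1 : k) ^ (j * i) • et (a * a') (opMul (exA k).toGrAlg b b') :=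
  tmul_mul_tmul (exA k).toGrAlg (exA k).op.toGrAlg a hb ha' b'

theorem et_mem {i j n : ℤ} {a b : FA k} (ha : a ∈ faGrading k i) (hb : b ∈ faGrading k j)
    (h : i + j = n) : et a b ∈ (exE k).grading n := by
  rw [← h]; exact tmul_mem (exA k).toGrAlg (exA k).op.toGrAlg ha hb

theorem exE_d {i : ℤ} {a : FA k} (ha : a ∈ faGrading k i) (b : FA k) :
    (exE k).d (et a b) = et (faD k a) b + (-1 : k) ^ i • et a (faD k b) :=
  tDiff_tmul (exA k) (exA k).op ha b

theorem exE_induction {p : (exE k).carrier → Prop} (h0 : p 0)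
    (hadd : ∀ s t, p s → p t → p (s + t))
    (hh : ∀ i j, ∀ a ∈ faGrading k i, ∀ b ∈ faGrading k j, p (et a b)) (t) : p t :=
  t_induction (exA k).toGrAlg (exA k).op.toGrAlg h0 hadd hh t

/-- The commutator element `v ⊗ 1 - 1 ⊗ v`. -/
def comm (v : FA k) : (exE k).carrier := et v 1 - et 1 v

theorem comm_mem {v : FA k} (hv : v ∈ faGrading k 1) : comm v ∈ (exE k).grading 1 :=
  Submodule.sub_mem _ (et_mem hv one_mem_fa (by norm_num)) (et_mem one_mem_fa hv (by norm_num))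

theorem et_zero_left (b : FA k) : et 0 b = 0 :=
  congrArg (GradedTensorProduct.of k (exA k).grading (exA k).op.grading)
    (TensorProduct.zero_tmul (FA k) (show OpCarrier (exA k).toGrAlg from b))

theorem et_zero_right (a : FA k) : et a 0 = 0 :=
  congrArg (GradedTensorProduct.of k (exA k).grading (exA k).op.grading)
    (TensorProduct.tmul_zero (OpCarrier (exA k).toGrAlg) a)

theorem et_smul_right (r : k) (a b : FA k) : et a (r • b) = r • et a b :=
  congrArg (GradedTensorProduct.of k (exA k).grading (exA k).op.grading)
    ((TensorProduct.mk k (FA k) (OpCarrier (exA k).toGrAlg) a).map_smul r b)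

theorem exE_d_comm_y : (exE k).d (comm (gy k)) = 0 := by
  rw [comm, map_sub, exE_d gy_mem, exE_d one_mem_fa, faD_y, faD_one]
  simp only [et_zero_left, et_zero_right, smul_zero, add_zero, sub_zero]

/-- By the Koszul sign the two cross terms $y\otimes y$ cancel, and $(1\otimes y)^2=-1\otimes y^2$
in the opposite algebra. -/
theorem comm_y_mul_comm_y : comm (gy k) * comm (gy k) = et (gy k ^ 2) 1 - et 1 (gy k ^ 2) := by
  rw [comm, sub_mul, mul_sub, mul_sub, et_mul _ one_mem_fa gy_mem, et_mul _ one_mem_fa one_mem_fa,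
    et_mul _ gy_mem gy_mem, et_mul _ gy_mem one_mem_fa, opMul_one_left, opMul_one_left,
    opMul_one_right, opMul_eq _ gy_mem gy_mem, pow_two, et_smul_right]
  simp
  abel

theorem exE_d_comm_x : (exE k).d (comm (gx k)) = comm (gy k) * comm (gy k) := by
  rw [comm, map_sub, exE_d gx_mem, exE_d one_mem_fa, faD_x, faD_one, comm_y_mul_comm_y]
  simp only [et_zero_left, et_zero_right, smul_zero, add_zero, zero_add, zpow_zero, one_smul]

/-- The operator of left multiplication on the algebra as a space of right coefficients. -/
def opAct : FA k →ₐ[k] Module.End k (OpCarrier (exA k).toGrAlg) := Algebra.lmul k (FA k)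

/-- The enveloping algebra as a tensor product. -/
def untwist : (exE k).carrier ≃ₗ[k] FA k ⊗[k] OpCarrier (exA k).toGrAlg :=
  (GradedTensorProduct.of k (exA k).grading (exA k).op.grading).symm

theorem untwist_et (a b : FA k) :
    untwist (et a b) = a ⊗ₜ[k] (show OpCarrier (exA k).toGrAlg from b) := rfl

/-- Moving the generator past $b$ costs $(-1)^{|b|}$ in both terms of the commutator. This cancels
the share of $b$ in the twist and leaves the twist of the left factor alone, as the criterion for
cells requires. -/
theorem untwist_mul_comm (l : Fin 2) (t : (exE k).carrier) :
    untwist (twist (exE k).grading 1 t * comm (FreeAlgebra.ι k l)) =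
      koszulMap opAct l (TensorProduct.map (twist (faGrading k) 1) LinearMap.id (untwist t)) := by
  induction t using exE_induction with
  | h0 => simp
  | hadd s t hs ht => simp only [map_add, add_mul, hs, ht]
  | hh i j a ha b hb =>
    rw [twist_of_mem _ _ (et_mem ha hb rfl), comm, smul_mul_assoc, mul_sub,
      et_mul _ hb (ι_mem l), et_mul _ hb one_mem_fa, opMul_one_right, opMul_eq _ hb (ι_mem l),
      et_smul_right, mul_one, untwist_et, TensorProduct.map_tmul, koszulMap_tmul,
      twist_of_mem _ _ ha, mul_zero, zpow_zero, one_smul, one_mul, one_mul,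
      smul_mul_assoc, ← TensorProduct.smul_tmul', ← TensorProduct.smul_tmul', ← smul_sub,
      smul_smul, sgn_add, mul_assoc, sgn_sq, mul_one, map_smul, map_sub, untwist_et, untwist_et,
      mul_one, smul_sub]
    rfl

variable (k) in
/-- The differential of the bimodule resolution on the cells. -/
def envDiff : Option (Fin 2) × PUnit.{u + 1} → Option (Fin 2) × PUnit.{u + 1} →₀ (exE k).carrier
  | (none, _) => 0
  | (some 1, j) => Finsupp.single (none, j) (comm (gy k))
  | (some 0, j) => Finsupp.single (none, j) (comm (gx k)) +
      Finsupp.single (some 1, j) (comm (gy k))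

theorem envDiff_mem (i : Option (Fin 2) × PUnit.{u + 1}) :
    envDiff k i ∈ freeGrading (exE k).toGrAlg (fun _ => (0 : ℤ)) (0 + 1) := by
  obtain ⟨o, j⟩ := i
  match o with
  | none => exact Submodule.zero_mem _
  | some 1 => exact single_mem_free _ (comm_mem gy_mem) (by norm_num)
  | some 0 =>
    exact Submodule.add_mem _ (single_mem_free _ (comm_mem gx_mem) (by norm_num))
      (single_mem_free _ (comm_mem gy_mem) (by norm_num))

theorem freeD_envDiff (i : Option (Fin 2) × PUnit.{u + 1}) :
    freeD (exE k) (envDiff k) (envDiff k i) = 0 := by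
  obtain ⟨o, j⟩ := i
  match o with
  | none => rw [envDiff, map_zero]
  | some 1 => rw [envDiff, freeD_single, exE_d_comm_y, envDiff]; simp
  | some 0 =>
    rw [envDiff, map_add, freeD_single, freeD_single, exE_d_comm_y, exE_d_comm_x, envDiff, envDiff,
      twist_one_one _ (comm_mem gy_mem)]
    simp

variable (k) in
/-- The bimodule resolution. -/
abbrev envResolution : DGMod (exE k) :=
  DGMod.free (exE k) (fun _ => 0) (envDiff k) envDiff_mem freeD_envDiff

variable (k) in
/-- The algebra as a bimodule. -/
def exDiag : DGMod (exE k) := DGMod.diag (exA k)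

theorem et_smul (a b m : FA k) : et a b • (show (exDiag k).carrier from m) =
    a * opMul (exA k).toGrAlg b m := rfl

theorem et_smul_one (a b : FA k) : et a b • (show (exDiag k).carrier from (1 : FA k)) = a * b := by
  rw [et_smul, opMul_one_right]

theorem comm_smul_one (v : FA k) : comm v • (show (exDiag k).carrier from (1 : FA k)) = 0 := by
  rw [comm, sub_smul, et_smul_one, et_smul_one, one_mul, mul_one]
  exact sub_self v

variable (k) in
/-- The images of the cells of the bimodule resolution. -/
def envVal : Option (Fin 2) × PUnit.{u + 1} → (exDiag k).carrier
  | (none, _) => (1 : FA k)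
  | (some _, _) => 0

variable (k) in
/-- The augmentation of the bimodule resolution. -/
def envAugmentation : dgHom (envResolution k) (exDiag k) :=
  freeHom (envVal k)
    (by
      rintro ⟨o, j⟩
      match o with
      | none => exact one_mem_fa
      | some _ => exact Submodule.zero_mem _)
    (by
      rintro ⟨o, j⟩
      match o with
      | none => rw [envDiff, map_zero]; exact faD_one.symm
      | some 1 =>
        rw [envDiff, Finsupp.linearCombination_single, envVal, comm_smul_one, envVal, map_zero]
      | some 0 =>
        rw [envDiff, map_add, Finsupp.linearCombination_single, Finsupp.linearCombination_single,
          envVal, comm_smul_one, envVal, envVal, smul_zero, map_zero, add_zero])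

/-- As a left module $A^e$ is $A\otimes A$, and the commutators act as the maps of the standard
resolution of $A$. The criterion is used with $H=A$ carrying its own differential, so its two
comparison hypotheses on cohomology are trivial. -/
theorem envAugmentation_isQuasiIso : IsQuasiIso (envAugmentation k) := by
  let θ : (PUnit.{u + 1} →₀ (exE k).carrier) ≃ₗ[k] FA k ⊗[k] OpCarrier (exA k).toGrAlg :=
    (Finsupp.uniqueLinearEquiv k (exE k).carrier PUnit.unit.{u + 1}).trans untwist
  have hθ : ∀ j t, θ (Finsupp.single j t) = untwist t := by
    intro j t
    simp [θ]
  have hθ' : ∀ a b : FA k, θ.symm (a ⊗ₜ[k] (show OpCarrier (exA k).toGrAlg from b)) =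
      Finsupp.single PUnit.unit (et a b) := by
    intro a b
    rw [LinearEquiv.symm_apply_eq, hθ, untwist_et]
  refine isQuasiIso_of_free_cells opAct (show FA k →ₗ[k] FA k from faD k) (envAugmentation k)
    (LinearMap.id : FA k →ₗ[k] FA k) θ ?_ ?_ ?_ ?_ ?_
  · intro l j t
    rw [hθ]
    match l with
    | 1 =>
      rw [envDiff, Finsupp.smul_single, compCell_single, hθ]
      exact untwist_mul_comm 1 t
    | 0 =>
      rw [envDiff, smul_add, map_add, Finsupp.smul_single, Finsupp.smul_single, compCell_single,
        compCell_single_ne (by simp), add_zero, hθ]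
      exact untwist_mul_comm 0 t
  · intro (h : FA k)
    erw [hθ', hθ']
    rw [inclCell_single, inclCell_single, freeD_single, exE_d one_mem_fa, envDiff, smul_zero,
      faD_one, et_zero_left]
    simp
    rfl
  · intro (h : FA k)
    erw [hθ']
    rw [inclCell_single]
    change Finsupp.linearCombination (exE k).carrier (envVal k) _ = h
    rw [Finsupp.linearCombination_single, envVal, et_smul_one, one_mul]
  · rintro h - ⟨m, hm⟩
    exact ⟨m, hm⟩
  · intro m hm
    refine ⟨m, hm, 0, ?_⟩
    rw [map_zero]
    exact (sub_self m).symm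

theorem envDiff_mem_rankFiltration (i : Option (Fin 2) × PUnit.{u + 1}) :
    envDiff k i ∈ rankFiltration (exE k) (fun i => cellRank i.1) (cellRank i.1) := by
  obtain ⟨o, j⟩ := i
  match o with
  | none => exact Submodule.zero_mem _
  | some 1 => exact Finsupp.single_mem_supported _ _ Nat.zero_lt_one
  | some 0 =>
    exact Submodule.add_mem _ (Finsupp.single_mem_supported _ _ Nat.zero_lt_two)
      (Finsupp.single_mem_supported _ _ Nat.one_lt_two)

theorem envAugmentation_isSemifreeResolution : IsSemifreeResolution (envAugmentation k) :=
  ⟨⟨_, rankFiltration_isSemifree _ envDiff_mem_rankFiltration⟩, envAugmentation_isQuasiIso⟩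

theorem exA_isHomologicallySmooth : IsHomologicallySmooth (exA k) :=
  ⟨envResolution k, envAugmentation k, envAugmentation_isSemifreeResolution,
    fun _ N => coprodMap_bijective_of_finite _ Finsupp.basisSingleOne N⟩

theorem coneLength_diag_le : coneLength (exDiag k) ≤ 2 := by
  refine le_trans (sInf_le ⟨envResolution k, envAugmentation k,
    envAugmentation_isSemifreeResolution, rfl⟩) ?_
  refine dgFreeClass_free_le _ envDiff_mem_rankFiltration 2 (fun i => cellRank_le i.1) ?_
  rintro ⟨o, j⟩ m hm
  obtain ⟨o', ho'⟩ := exists_cellRank_eq m (hm.trans (cellRank_le o))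
  exact ⟨(o', j), ho'⟩

theorem aug_of_ne {n : ℤ} (hn : n ≠ 0) {a : FA k} (ha : a ∈ faGrading k n) :
    aug exA_connected a = (0 : k) :=
  augFun_of_ne exA_connected hn ha

theorem aug_faD (a : FA k) : aug exA_connected (faD k a) = (0 : k) := by
  induction a using hom_induction (faGrading k) with
  | h0 => rw [map_zero]; exact map_zero _
  | hadd a b ha hb => rw [map_add]; erw [map_add]; rw [ha, hb, add_zero]
  | hh n a ha =>
    by_cases hn : n + 1 = 0
    · have : a ∈ (exA k).grading n := ha
      rw [exA_connected.neg n (by omega), Submodule.mem_bot] at this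
      rw [this, map_zero]; exact map_zero _
    · exact aug_of_ne hn (faD_mem n a ha)

/-- The sign is trivial when the left factor has degree 0, and otherwise the augmentation kills that
factor. -/
theorem aug_opMul (a b : FA k) : aug exA_connected (opMul (exA k).toGrAlg a b) =
    aug exA_connected a * aug exA_connected b := by
  induction a using hom_induction (faGrading k) with
  | h0 => simp
  | hadd x y hx hy => simp only [map_add, LinearMap.add_apply, hx, hy, add_mul]
  | hh i a ha =>
    induction b using hom_induction (faGrading k) with
    | h0 => simp
    | hadd x y hx hy => simp only [map_add, hx, hy, mul_add]
    | hh j b hb =>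
      rw [opMul_eq _ ha hb, map_smul, map_mul, smul_eq_mul]
      by_cases hi : i = 0
      · subst hi; simp [mul_comm]
      · rw [aug_of_ne hi ha]; simp

variable (k) in
/-- The augmentation of the opposite algebra. -/
def opAug : OpCarrier (exA k).toGrAlg →ₐ[k] k :=
  AlgHom.ofLinearMap (show FA k →ₗ[k] k from (aug exA_connected).toLinearMap)
    (map_one (aug (exA_connected (k := k)))) aug_opMul

variable (k) in
/-- The map `a ⊗ b ↦ ε(b) a` from the enveloping algebra. -/
def envAug : (exE k).carrier →ₐ[k] FA k :=
  GradedTensorProduct.lift (exA k).grading (exA k).op.grading (AlgHom.id k (FA k))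
    ((Algebra.ofId k (FA k)).comp (opAug k))
    (by
      rintro i j ⟨a, ha⟩ ⟨(b : FA k), (hb : b ∈ faGrading k j)⟩
      change a * algebraMap k (FA k) (aug exA_connected b) =
        (-1 : ℤˣ) ^ (j * i) • (algebraMap k (FA k) (aug exA_connected b) * a)
      by_cases hj : j = 0
      · subst hj; rw [zero_mul, zpow_zero, one_smul, Algebra.commutes]
      · rw [aug_of_ne hj hb]; simp)

theorem envAug_et (a b : FA k) : envAug k (et a b) = aug exA_connected b • a := by
  rw [Algebra.smul_def, Algebra.commutes]
  exact GradedTensorProduct.lift_tmul _ _ _ _ _ _ _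

/-- Under $a\otimes b\mapsto\varepsilon(b)a$ the commutators map to $x$ and $y$. They kill $1$,
hence all of $A^0=k$. -/
theorem two_le_coneLength_diag : 2 ≤ coneLength (exDiag k) := by
  refine two_le_coneLength (exDiag k) (envAug k) ?_ ?_ (comm (gx k)) (comm (gy k))
    (comm_mem gx_mem) (comm_mem gy_mem) exE_d_comm_y exE_d_comm_x ?_ ?_
    (show FA k →ₗ[k] k from (aug exA_connected).toLinearMap) ?_ aug_faD (1 : FA k) one_mem_fa
    faD_one (map_one (aug (exA_connected (k := k)))) ?_ ?_ ?_
  · intro t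
    induction t using exE_induction with
    | h0 => simp
    | hadd s t hs ht => simp only [map_add, hs, ht]
    | hh i j a ha b hb =>
      rw [twist_of_mem _ _ (et_mem ha hb rfl), map_smul, envAug_et, map_smul, twist_of_mem _ _ ha]
      by_cases hj : j = 0
      · subst hj; rw [add_zero, smul_comm]
      · rw [aug_of_ne hj hb]; simp
  · intro t
    induction t using exE_induction with
    | h0 => simp
    | hadd s t hs ht => simp only [map_add, hs, ht]
    | hh i j a ha b hb =>
      rw [exE_d ha, map_add, map_smul, envAug_et, envAug_et, envAug_et, aug_faD, map_smul]
      simp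
  · rw [comm, map_sub, envAug_et, envAug_et, aug_of_ne one_ne_zero gx_mem, zero_smul, sub_zero]
    erw [map_one]
    rw [one_smul]
  · rw [comm, map_sub, envAug_et, envAug_et, aug_of_ne one_ne_zero gy_mem, zero_smul, sub_zero]
    erw [map_one]
    rw [one_smul]
  · intro t (m : FA k)
    change aug exA_connected (show FA k from t • (show (exDiag k).carrier from m)) =
      aug exA_connected (envAug k t) * aug exA_connected m
    induction t using exE_induction with
    | h0 => rw [zero_smul, map_zero, map_zero, zero_mul]; exact map_zero _
    | hadd s t hs ht => rw [add_smul, map_add, map_add, add_mul, ← hs, ← ht]; exact map_add _ _ _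
    | hh i j a ha b hb =>
      rw [et_smul, envAug_et]
      erw [map_mul, map_smul]
      rw [aug_opMul, smul_eq_mul]
      ring
  · exact exA_connected.neg (-1) (by norm_num)
  · exact comm_smul_one _
  · intro (m : FA k) (hm : m ∈ (exA k).grading 0)
    rw [exA_connected.zero, Submodule.mem_span_singleton] at hm
    obtain ⟨r, rfl⟩ := hm
    change comm (gy k) • (r • (show (exDiag k).carrier from (1 : FA k))) = 0
    rw [smul_algebra_smul_comm, comm_smul_one, smul_zero]

theorem coneLength_diag : coneLength (exDiag k) = 2 :=
  le_antisymm coneLength_diag_le two_le_coneLength_diag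

end Bimodule

end
end DGA

namespace DGA

noncomputable section

variable {k : Type u} [Field k]

/-! ### The cohomology of `k⟨x, y⟩` -/

section FreeAlgebraCohomology

/-- The action of the free algebra with `v (c, q) = (v c, [c]_v)`. -/
def stripAct : FA k →ₐ[k] Module.End k (FA k × (Fin 2 → FA k)) :=
  FreeAlgebra.lift k fun i => LinearMap.inl k _ _ ∘ₗ LinearMap.mulLeft k (FreeAlgebra.ι k i) ∘ₗ
    LinearMap.fst k _ _ + LinearMap.inr k _ _ ∘ₗ LinearMap.single k (fun _ => FA k) i ∘ₗ
      LinearMap.fst k _ _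

theorem stripAct_ι (i : Fin 2) (z : FA k × (Fin 2 → FA k)) :
    stripAct (FreeAlgebra.ι k i) z = (FreeAlgebra.ι k i * z.1, Pi.single i z.1) := by
  rw [stripAct, FreeAlgebra.lift_ι_apply]
  simp

theorem stripAct_fst (a : FA k) (z : FA k × (Fin 2 → FA k)) : (stripAct a z).1 = a * z.1 := by
  induction a using FreeAlgebra.induction generalizing z with
  | grade0 r => simp [Algebra.smul_def]
  | grade1 i => rw [stripAct_ι]
  | mul a b ha hb => rw [map_mul, Module.End.mul_apply, ha, hb, mul_assoc]
  | add a b ha hb => rw [map_add, LinearMap.add_apply, Prod.fst_add, ha, hb, add_mul]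

/-- The linear map that removes the first letter `i` from a word. -/
def strip (i : Fin 2) : FA k →ₗ[k] FA k :=
  LinearMap.proj i ∘ₗ LinearMap.snd k _ _ ∘ₗ LinearMap.applyₗ (1, 0) ∘ₗ
    (stripAct (k := k)).toLinearMap

theorem strip_ι_mul (i j : Fin 2) (a : FA k) :
    strip i (FreeAlgebra.ι k j * a) = (Pi.single j a : Fin 2 → FA k) i := by
  change (stripAct (FreeAlgebra.ι k j * a) (1, 0)).2 i = _
  rw [map_mul, Module.End.mul_apply, stripAct_ι, stripAct_fst, mul_one]

theorem strip_x (a b : FA k) : strip 0 (gx k * a + gy k * b) = a := by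
  rw [map_add, strip_ι_mul, strip_ι_mul]; simp

theorem strip_y (a b : FA k) : strip 1 (gx k * a + gy k * b) = b := by
  rw [map_add, strip_ι_mul, strip_ι_mul]; simp

theorem exists_eq_gx_mul_add_gy_mul {n : ℤ} (hn : 0 ≤ n) {z : FA k}
    (hz : z ∈ faGrading k (n + 1)) :
    ∃ a ∈ faGrading k n, ∃ b ∈ faGrading k n, z = gx k * a + gy k * b := by
  rw [faGrading] at hz
  induction hz using Submodule.span_induction with
  | mem w h =>
    obtain ⟨l, hl, rfl⟩ := h
    match l with
    | [] => simp at hl; omega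
    | i :: l =>
      have hl' : (l.map (FreeAlgebra.ι k)).prod ∈ faGrading k n :=
        Submodule.subset_span ⟨l, by simpa using hl, rfl⟩
      rw [List.map_cons, List.prod_cons]
      match i with
      | 0 => exact ⟨_, hl', 0, Submodule.zero_mem _, by simp⟩
      | 1 => exact ⟨0, Submodule.zero_mem _, _, hl', by simp⟩
  | zero => exact ⟨0, Submodule.zero_mem _, 0, Submodule.zero_mem _, by simp⟩
  | add z w _ _ hz hw =>
    obtain ⟨a, ha, b, hb, rfl⟩ := hz
    obtain ⟨a', ha', b', hb', rfl⟩ := hw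
    refine ⟨_, Submodule.add_mem _ ha ha', _, Submodule.add_mem _ hb hb', ?_⟩
    rw [mul_add, mul_add]; abel
  | smul r z _ hz =>
    obtain ⟨a, ha, b, hb, rfl⟩ := hz
    refine ⟨_, Submodule.smul_mem _ r ha, _, Submodule.smul_mem _ r hb, ?_⟩
    rw [mul_smul_comm, mul_smul_comm, smul_add]

theorem faD_gx_mul (a : FA k) : faD k (gx k * a) = gy k * (gy k * a) - gx k * faD k a := by
  rw [faD_mul 1 _ _ gx_mem, faD_x, pow_two, mul_assoc, zpow_one, neg_smul, one_smul, sub_eq_add_neg]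

theorem faD_gy_mul (a : FA k) : faD k (gy k * a) = - (gy k * faD k a) := by
  rw [faD_mul 1 _ _ gy_mem, faD_y, zero_mul, zero_add, zpow_one, neg_smul, one_smul]

/-- In the coordinates $(a,b)$ the differential is that of a mapping cone of left multiplication by
$y$: $xa+yb$ is a cocycle exactly when $da=0$ and $ya=db$. The inductive computation of the
cohomology rests on this. -/
theorem faD_eq_iff (a b c e : FA k) : faD k (gx k * a + gy k * b) = gx k * c + gy k * e ↔
    - faD k a = c ∧ gy k * a - faD k b = e := by
  have h : faD k (gx k * a + gy k * b) = gx k * (- faD k a) + gy k * (gy k * a - faD k b) := by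
    rw [map_add, faD_gx_mul, faD_gy_mul]; noncomm_ring
  rw [h]
  refine ⟨fun h => ⟨?_, ?_⟩, fun h => by rw [h.1, h.2]⟩
  · rw [← strip_x (- faD k a), h, strip_x]
  · rw [← strip_y (- faD k a) (gy k * a - faD k b), h, strip_y]

theorem exists_homogeneous_primitive {n : ℤ} {z b : FA k} (hz : z ∈ faGrading k (n + 1))
    (h : faD k b = z) : ∃ b' ∈ faGrading k n, faD k b' = z :=
  ⟨proj (faGrading k) n b, proj_mem _ _ _, by
    have := d_proj (exA k) n b
    change faD k _ = proj (faGrading k) (n + 1) (faD k b) at this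
    rw [this, h, proj_same _ hz]⟩

/-- Every cocycle of degree `n` is cohomologous to a multiple of `w`. -/
def SpansCohomology (n : ℤ) (w : FA k) : Prop :=
  ∀ z ∈ faGrading k n, faD k z = 0 → ∃ (r : k) (b : FA k), z = r • w + faD k b

/-- No non-zero multiple of `w` is a coboundary. -/
def IsNonExact (w : FA k) : Prop := ∀ (r : k) (b : FA k), faD k b = r • w → r = 0

variable (k) in
/-- The cocycle `x y + y x`. -/
abbrev gv : FA k := gx k * gy k + gy k * gx k

theorem faD_gv : faD k (gv k) = 0 := exDG_d_v

theorem gv_mem : gv k ∈ faGrading k 2 := by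
  have h1 := SetLike.GradedMul.mul_mem (gx_mem (k := k)) gy_mem
  have h2 := SetLike.GradedMul.mul_mem (gy_mem (k := k)) gx_mem
  exact Submodule.add_mem _ h1 h2

theorem gv_mul (w : FA k) : gv k * w = gx k * (gy k * w) + gy k * (gx k * w) := by
  rw [gv, add_mul, mul_assoc, mul_assoc]

/-- For a cocycle $xa+ya'$ write $a=rw+db$. As $ya$ is exact and $yw$ is not, $r=0$. Then $a'+yb$ is
a cocycle, so it equals $sw+de$, and the given cocycle is $s\,yw$ up to $d(-xb-ye)$. -/
theorem SpansCohomology.gy_mul {n : ℤ} (hn : 0 ≤ n) {w : FA k}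
    (h : SpansCohomology n w) (hy : IsNonExact (gy k * w)) :
    SpansCohomology (n + 1) (gy k * w) := by
  intro z hz hdz
  obtain ⟨a, ha, a', ha', rfl⟩ := exists_eq_gx_mul_add_gy_mul hn hz
  have h0 := (faD_eq_iff a a' 0 0).1 (by rw [hdz]; simp)
  rw [neg_eq_zero, sub_eq_zero] at h0
  obtain ⟨r, b, hb⟩ := h a ha h0.1
  have hr : r = 0 := by
    refine hy r (a' + gy k * b) ?_
    rw [map_add, ← h0.2, faD_gy_mul, hb, mul_add, mul_smul_comm]
    abel
  rw [hr, zero_smul, zero_add] at hb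
  obtain ⟨b, hb', rfl⟩ := exists_homogeneous_primitive (n := n - 1) (by rwa [sub_add_cancel]) hb.symm
  have hc : a' + gy k * b ∈ faGrading k n := by
    refine Submodule.add_mem _ ha' ?_
    have := SetLike.GradedMul.mul_mem (gy_mem (k := k)) hb'
    rwa [add_sub_cancel] at this
  obtain ⟨s, e, hs⟩ := h _ hc (by rw [map_add, faD_gy_mul, ← h0.2, add_neg_cancel])
  refine ⟨s, - (gx k * b) - gy k * e, ?_⟩
  rw [map_sub, map_neg, faD_gx_mul, faD_gy_mul, ← mul_smul_comm, eq_sub_of_add_eq hs]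
  noncomm_ring

/-- Now $a=r\,yw+db$ with $r$ arbitrary, since $y\cdot yw=d(xw)$ is exact. Subtracting $r\,vw$
accounts for this term, and the multiple of $yw$ left over in $a'$ contributes the exact element
$s\,y^2w$. -/
theorem SpansCohomology.gv_mul {n : ℤ} (hn : 0 ≤ n) {w : FA k} (hw : faD k w = 0)
    (hwn : w ∈ faGrading k (n - 1)) (h : SpansCohomology n (gy k * w)) :
    SpansCohomology (n + 1) (gv k * w) := by
  intro z hz hdz
  obtain ⟨a, ha, a', ha', rfl⟩ := exists_eq_gx_mul_add_gy_mul hn hz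
  have h0 := (faD_eq_iff a a' 0 0).1 (by rw [hdz]; simp)
  rw [neg_eq_zero, sub_eq_zero] at h0
  obtain ⟨r, b, hb⟩ := h a ha h0.1
  have hyw : gy k * w ∈ faGrading k n := by
    have := SetLike.GradedMul.mul_mem (gy_mem (k := k)) hwn
    rwa [add_sub_cancel] at this
  have hxw : gx k * w ∈ faGrading k n := by
    have := SetLike.GradedMul.mul_mem (gx_mem (k := k)) hwn
    rwa [add_sub_cancel] at this
  have hdb : faD k b ∈ faGrading k n := by
    rw [← sub_eq_iff_eq_add'.2 hb]
    exact Submodule.sub_mem _ ha (Submodule.smul_mem _ _ hyw)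
  obtain ⟨b', hb', hbb⟩ := exists_homogeneous_primitive (n := n - 1)
    (by rwa [sub_add_cancel]) (rfl : faD k b = _)
  rw [← hbb] at hb
  have hc : a' - r • (gx k * w) + gy k * b' ∈ faGrading k n := by
    refine Submodule.add_mem _ (Submodule.sub_mem _ ha' (Submodule.smul_mem _ _ hxw)) ?_
    have := SetLike.GradedMul.mul_mem (gy_mem (k := k)) hb'
    rwa [add_sub_cancel] at this
  obtain ⟨s, e, hs⟩ := h _ hc (by
    rw [map_add, map_sub, map_smul, faD_gx_mul, faD_gy_mul, ← h0.2, hw, hb, mul_add,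
      mul_smul_comm]
    simp)
  refine ⟨r, - (gx k * b') + s • (gx k * w) - gy k * e, ?_⟩
  have ha'' : a' = r • (gx k * w) - gy k * b' + (s • (gy k * w) + faD k e) := by
    rw [← hs]; abel
  rw [map_sub, map_add, map_smul, map_neg, faD_gx_mul, faD_gx_mul, faD_gy_mul, hw, ha'', hb,
    DGA.gv_mul]
  simp only [mul_add, mul_sub, mul_smul_comm, smul_add, mul_zero, smul_sub, smul_zero]
  abel

/-- The $x$-coordinate of $vw$ is $yw$, so a primitive of a multiple of $vw$ yields one of the same
multiple of $yw$. -/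
theorem IsNonExact.gv_mul {n : ℤ} (hn : 0 ≤ n) {w : FA k} (hwn : w ∈ faGrading k n)
    (h : IsNonExact (gy k * w)) : IsNonExact (gv k * w) := by
  intro r b hb
  have hm : r • (gv k * w) ∈ faGrading k (n + 1 + 1) := by
    have := SetLike.GradedMul.mul_mem (gv_mem (k := k)) hwn
    rw [show n + 1 + 1 = 2 + n by ring]
    exact Submodule.smul_mem _ _ this
  obtain ⟨b, hb', hb⟩ := exists_homogeneous_primitive hm hb
  obtain ⟨a, ha, a', ha', rfl⟩ := exists_eq_gx_mul_add_gy_mul hn hb'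
  rw [DGA.gv_mul, smul_add, ← mul_smul_comm r (gx k), ← mul_smul_comm r (gy k) (gx k * w),
    faD_eq_iff] at hb
  exact h r (-a) (by rw [map_neg, hb.1])

/-- A primitive $xa+ya'$ has $da=0$ and $ya-da'=r\,vw$. Since $a=s\,yw+dc$, the product
$ya=d(s\,xw-yc)$ is exact, and hence so is $r\,vw$. -/
theorem IsNonExact.gy_mul_gv_mul {n : ℤ} (hn : 0 ≤ n) {w : FA k} (hw : faD k w = 0)
    (hwn : w ∈ faGrading k n) (hs : SpansCohomology (n + 1) (gy k * w))
    (h : IsNonExact (gv k * w)) : IsNonExact (gy k * (gv k * w)) := by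
  intro r b hb
  have hm : r • (gy k * (gv k * w)) ∈ faGrading k (n + 1 + 1 + 1) := by
    have := SetLike.GradedMul.mul_mem (gy_mem (k := k))
      (SetLike.GradedMul.mul_mem (gv_mem (k := k)) hwn)
    rw [show n + 1 + 1 + 1 = 1 + (2 + n) by ring]
    exact Submodule.smul_mem _ _ this
  obtain ⟨b, hb', hb⟩ := exists_homogeneous_primitive hm hb
  obtain ⟨a, ha, a', ha', rfl⟩ := exists_eq_gx_mul_add_gy_mul (by omega) hb'
  have e : r • (gy k * (gv k * w)) = gx k * 0 + gy k * (r • (gv k * w)) := by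
    rw [mul_zero, zero_add, mul_smul_comm]
  rw [e, faD_eq_iff, neg_eq_zero] at hb
  obtain ⟨s, c, hc⟩ := hs a ha hb.1
  refine h r (s • (gx k * w) - gy k * c - a') ?_
  rw [← hb.2, map_sub, map_sub, map_smul, faD_gx_mul, faD_gy_mul, hw, hc, mul_add, mul_smul_comm]
  simp

theorem isNonExact_one : IsNonExact (1 : FA k) := by
  intro r b hb
  have := aug_faD b
  rw [hb, map_smul] at this
  erw [map_one] at this
  simpa using this

theorem isNonExact_gy : IsNonExact (gy k) := by
  intro r b hb
  obtain ⟨b, hb', hb⟩ := exists_homogeneous_primitive (n := 0)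
    (Submodule.smul_mem _ r gy_mem) hb
  have hb'' : b ∈ (exA k).grading 0 := hb'
  rw [exA_connected.zero, Submodule.mem_span_singleton] at hb''
  obtain ⟨s, rfl⟩ := hb''
  have h1 : faD k (s • (1 : FA k)) = 0 := by rw [map_smul, faD_one, smul_zero]
  have h2 : r • gy k = 0 := hb.symm.trans h1
  have h3 := congrArg (strip 1) h2
  rw [map_smul, map_zero, ← mul_one (gy k), strip_ι_mul, Pi.single_eq_same] at h3
  simpa using h3

theorem faD_gv_pow (m : ℕ) : faD k (gv k ^ m) = 0 :=
  (cocycles (exA k)).pow_mem (x := gv k) faD_gv m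

theorem gv_pow_mem (m : ℕ) : gv k ^ m ∈ faGrading k (2 * m) := by
  have := SetLike.pow_mem_graded m (gv_mem (k := k))
  rwa [nsmul_eq_mul, mul_comm] at this

/-- The four statements are proved together: spanning in one degree uses non-exactness in the next,
and non-exactness of $yv^{m+1}$ uses spanning by $yv^m$. -/
theorem cohomology_gv_pow (m : ℕ) :
    SpansCohomology (2 * m) (gv k ^ m) ∧ IsNonExact (gv k ^ m) ∧
    SpansCohomology (2 * m + 1) (gy k * gv k ^ m) ∧ IsNonExact (gy k * gv k ^ m) := by
  induction m with
  | zero =>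
    have h0 : SpansCohomology 0 (1 : FA k) := by
      intro z hz _
      have hz' : z ∈ (exA k).grading 0 := hz
      rw [exA_connected.zero, Submodule.mem_span_singleton] at hz'
      obtain ⟨r, rfl⟩ := hz'
      exact ⟨r, 0, by rw [map_zero, add_zero]⟩
    have hy : IsNonExact (gy k * 1) := by rw [mul_one]; exact isNonExact_gy
    rw [pow_zero]
    exact ⟨h0, isNonExact_one, h0.gy_mul le_rfl hy, hy⟩
  | succ m ih =>
    obtain ⟨-, -, h3, h4⟩ := ih
    have hm : (0 : ℤ) ≤ 2 * m := by positivity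
    have e : (2 * (m + 1 : ℕ) : ℤ) = 2 * m + 1 + 1 := by push_cast; ring
    have h1 : SpansCohomology (2 * (m + 1 : ℕ)) (gv k ^ (m + 1)) := by
      rw [e, pow_succ']
      exact h3.gv_mul (by omega) (faD_gv_pow m) (by rw [add_sub_cancel_right]; exact gv_pow_mem m)
    have h2 : IsNonExact (gv k ^ (m + 1)) := by
      rw [pow_succ']
      exact h4.gv_mul hm (gv_pow_mem m)
    have h5 : IsNonExact (gy k * gv k ^ (m + 1)) := by
      rw [pow_succ'] at h2 ⊢
      exact h2.gy_mul_gv_mul hm (faD_gv_pow m) (gv_pow_mem m) h3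
    exact ⟨h1, h2, h1.gy_mul (by positivity) h5, h5⟩

/-- The cocycle `y ^ (n % 2) * v ^ (n / 2)` representing the cohomology in degree `n`. -/
def hRep (n : ℕ) : FA k := gy k ^ (n % 2) * gv k ^ (n / 2)

theorem hRep_two_mul (m : ℕ) : hRep (2 * m) = gv k ^ m := by
  rw [hRep, Nat.mul_mod_right, Nat.mul_div_cancel_left _ two_pos, pow_zero, one_mul]

theorem hRep_two_mul_add_one (m : ℕ) : hRep (2 * m + 1) = gy k * gv k ^ m := by
  rw [hRep, Nat.mul_add_mod, Nat.mul_add_div two_pos]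
  simp

theorem spansCohomology_hRep (n : ℕ) : SpansCohomology n (hRep n : FA k) := by
  obtain ⟨m, rfl | rfl⟩ := Nat.even_or_odd' n
  · rw [hRep_two_mul]; exact_mod_cast (cohomology_gv_pow m).1
  · rw [hRep_two_mul_add_one]; exact_mod_cast (cohomology_gv_pow m).2.2.1

theorem isNonExact_hRep (n : ℕ) : IsNonExact (hRep n : FA k) := by
  obtain ⟨m, rfl | rfl⟩ := Nat.even_or_odd' n
  · rw [hRep_two_mul]; exact (cohomology_gv_pow m).2.1
  · rw [hRep_two_mul_add_one]; exact (cohomology_gv_pow m).2.2.2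

theorem faD_hRep (n : ℕ) : faD k (hRep n) = 0 :=
  (cocycles (exA k)).mul_mem ((cocycles (exA k)).pow_mem (x := gy k) faD_y _)
    ((cocycles (exA k)).pow_mem (x := gv k) faD_gv _)

end FreeAlgebraCohomology

end
end DGA

namespace DGA

noncomputable section

variable {k : Type u} [Field k]

/-! ### The isomorphism of the cohomology algebra with `k[Y, V] / (Y²)` -/

section PolynomialCohomology

variable (k) in
/-- The class of `y`. -/
abbrev clsY : HCarrier (exDG k) := cls (A := exDG k) (gy k) exDG_d_y

variable (k) in
/-- The class of `x y + y x`. -/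
abbrev clsV : HCarrier (exDG k) := cls (A := exDG k) (gv k) exDG_d_v

theorem clsY_mem : clsY k ∈ hGrading (exDG k) 1 := ⟨⟨gy k, faD_y⟩, gy_mem, rfl⟩

theorem clsV_mem : clsV k ∈ hGrading (exDG k) 2 := ⟨⟨gv k, faD_gv⟩, gv_mem, rfl⟩

theorem clsY_pow_mul_clsV_pow_mem (a b : ℕ) :
    (clsY k ^ a * clsV k ^ b : HCarrier (exDG k)) ∈ hGrading (exDG k) (a + 2 * b) := by
  have := SetLike.GradedMul.mul_mem (SetLike.pow_mem_graded a (clsY_mem (k := k)))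
    (SetLike.pow_mem_graded b (clsV_mem (k := k)))
  rwa [nsmul_eq_mul, nsmul_eq_mul, mul_one, mul_comm (b : ℤ)] at this

theorem clsY_mul_clsY : (clsY k * clsY k : HCarrier (exDG k)) = 0 :=
  Ideal.Quotient.eq_zero_iff_mem.2 ⟨gx k, faD_x.trans (pow_two _)⟩

/-- The commutator $yv-vy=y^2x-xy^2$ is the differential of $x^2$. -/
theorem commute_clsY_clsV : Commute (clsY k) (clsV k) := by
  refine Ideal.Quotient.eq.2 ⟨gx k * gx k, ?_⟩
  change faD k (gx k * gx k) = gy k * gv k - gv k * gy k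
  rw [faD_gx_mul, faD_x, gv]
  noncomm_ring

theorem mk_hRep (n : ℕ) (h : faD k (hRep n) = 0) :
    Ideal.Quotient.mk (coboundaries (exDG k)) ⟨hRep n, h⟩ = clsY k ^ (n % 2) * clsV k ^ (n / 2) :=
  rfl

variable (k) in
/-- The linear map onto the cohomology given by the representatives. -/
def hLin : (ℕ →₀ k) →ₗ[k] HCarrier (exDG k) :=
  Finsupp.linearCombination k fun n => clsY k ^ (n % 2) * clsV k ^ (n / 2)

theorem hLin_surjective : Function.Surjective (hLin k) := by
  intro h
  rw [← LinearMap.mem_range]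
  induction h using hom_induction (hGrading (exDG k)) with
  | h0 => exact Submodule.zero_mem _
  | hadd a b ha hb => exact Submodule.add_mem _ ha hb
  | hh i h hh =>
    obtain ⟨⟨z, hz⟩, hzi, rfl⟩ := hh
    by_cases hi : i < 0
    · have hz0 : z ∈ (exDG k).grading i := hzi
      rw [exDG_connected.neg i hi, Submodule.mem_bot] at hz0
      subst hz0
      exact Submodule.zero_mem _
    · lift i to ℕ using not_lt.1 hi
      obtain ⟨r, b, hb⟩ := spansCohomology_hRep i z hzi hz
      refine ⟨Finsupp.single i r, ?_⟩
      rw [hLin, Finsupp.linearCombination_single, ← mk_hRep i (faD_hRep i)]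
      refine (Ideal.Quotient.eq.2 ⟨b, ?_⟩ : Ideal.Quotient.mk (coboundaries (exDG k)) ⟨z, hz⟩ =
        Ideal.Quotient.mk _ (r • ⟨hRep i, faD_hRep i⟩)).symm
      exact eq_sub_of_add_eq' hb.symm

theorem proj_hLin (n : ℕ) (f : ℕ →₀ k) :
    proj (hGrading (exDG k)) n (hLin k f) = f n • (clsY k ^ (n % 2) * clsV k ^ (n / 2)) := by
  induction f using Finsupp.induction_linear with
  | zero => simp
  | add f g hf hg => rw [map_add, map_add, hf, hg, Finsupp.add_apply, add_smul]
  | single m r =>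
    have hm : (clsY k ^ (m % 2) * clsV k ^ (m / 2) : HCarrier (exDG k)) ∈ hGrading (exDG k) m := by
      have := clsY_pow_mul_clsV_pow_mem (k := k) (m % 2) (m / 2)
      rwa [show ((m % 2 : ℕ) : ℤ) + 2 * (m / 2 : ℕ) = m by omega] at this
    rw [hLin, Finsupp.linearCombination_single, map_smul]
    by_cases h : m = n
    · subst h; rw [proj_same _ hm, Finsupp.single_eq_same]
    · rw [proj_ne _ hm (by exact_mod_cast h), Finsupp.single_eq_of_ne (Ne.symm h)]
      simp

theorem hLin_injective : Function.Injective (hLin k) := by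
  rw [injective_iff_map_eq_zero]
  intro f hf
  ext n
  have h := proj_hLin n f
  rw [hf, map_zero, ← mk_hRep n (faD_hRep n)] at h
  obtain ⟨b, hb⟩ := Ideal.Quotient.eq_zero_iff_mem.1 (h.symm : Ideal.Quotient.mk
    (coboundaries (exDG k)) (f n • ⟨hRep n, faD_hRep n⟩) = 0)
  exact isNonExact_hRep n (f n) b hb

/-- The cohomology is spanned by monomials in two commuting classes. Commutativity is needed before
polynomials can be evaluated in it. -/
theorem hCarrier_mul_comm (g h : HCarrier (exDG k)) : g * h = h * g := by
  obtain ⟨g, rfl⟩ := hLin_surjective g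
  obtain ⟨h, rfl⟩ := hLin_surjective h
  induction g using Finsupp.induction_linear with
  | zero => simp
  | add f g hf hg => rw [map_add, add_mul, mul_add, hf, hg]
  | single n r =>
    induction h using Finsupp.induction_linear with
    | zero => simp
    | add f g hf hg => rw [map_add, add_mul, mul_add, hf, hg]
    | single m s =>
      rw [hLin, Finsupp.linearCombination_single, Finsupp.linearCombination_single,
        smul_mul_smul_comm, smul_mul_smul_comm, mul_comm r s]
      congr 1
      have h : Commute (clsY k) (clsV k) := commute_clsY_clsV
      exact ((((Commute.refl _).pow_pow _ _).mul_right (h.pow_pow _ _)).mul_left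
        ((h.symm.pow_pow _ _).mul_right ((Commute.refl _).pow_pow _ _))).eq

/-- The cohomology as a commutative ring. -/
abbrev hCommRing : CommRing (HCarrier (exDG k)) :=
  { (inferInstance : Ring (HCarrier (exDG k))) with mul_comm := hCarrier_mul_comm }

attribute [local instance] hCommRing

variable (k) in
/-- The graded polynomial algebra `k[Y, V] / (Y²)`. -/
abbrev PolyQuot : Type u :=
  MvPolynomial (Fin 2) k ⧸ Ideal.span {(MvPolynomial.X 0 ^ 2 : MvPolynomial (Fin 2) k)}

variable (k) in
/-- The algebra map `k[Y, V] / (Y²) → H(A)`. -/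
def polyMap : PolyQuot k →ₐ[k] HCarrier (exDG k) :=
  Ideal.Quotient.liftₐ _ (MvPolynomial.aeval ![clsY k, clsV k]) (by
    intro a ha
    have : Ideal.span {(MvPolynomial.X 0 ^ 2 : MvPolynomial (Fin 2) k)} ≤
        RingHom.ker (MvPolynomial.aeval (R := k) ![clsY k, clsV k]) := by
      rw [Ideal.span_singleton_le_iff_mem, RingHom.mem_ker, map_pow, MvPolynomial.aeval_X, pow_two]
      exact clsY_mul_clsY (k := k)
    exact this ha)

theorem polyMap_X0 : polyMap k (Ideal.Quotient.mk _ (MvPolynomial.X 0)) = clsY k :=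
  MvPolynomial.aeval_X _ _

theorem polyMap_X1 : polyMap k (Ideal.Quotient.mk _ (MvPolynomial.X 1)) = clsV k :=
  MvPolynomial.aeval_X _ _

theorem monomial_eq_smul_X_pow (u : Fin 2 →₀ ℕ) (r : k) : MvPolynomial.monomial u r =
    r • (MvPolynomial.X 0 ^ u 0 * MvPolynomial.X 1 ^ u 1) := by
  rw [MvPolynomial.monomial_eq, Finsupp.prod_fintype _ _ (by simp), Fin.prod_univ_two,
    MvPolynomial.C_mul']

theorem polyMap_monomial (u : Fin 2 →₀ ℕ) (r : k) :
    polyMap k (Ideal.Quotient.mk _ (MvPolynomial.monomial u r)) =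
      r • (clsY k ^ u 0 * clsV k ^ u 1) := by
  rw [monomial_eq_smul_X_pow, ← Ideal.Quotient.mkₐ_eq_mk k, map_smul, map_mul, map_pow, map_pow,
    map_smul, map_mul, map_pow, map_pow]
  erw [polyMap_X0, polyMap_X1]

variable (k) in
/-- The linear map onto `k[Y, V] / (Y²)` given by the normal monomials. -/
def polyLin : (ℕ →₀ k) →ₗ[k] PolyQuot k :=
  Finsupp.linearCombination k fun n => Ideal.Quotient.mk _
    (MvPolynomial.X 0 ^ (n % 2) * MvPolynomial.X 1 ^ (n / 2))

theorem polyLin_surjective : Function.Surjective (polyLin k) := by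
  intro q
  obtain ⟨p, rfl⟩ := Ideal.Quotient.mk_surjective q
  rw [← LinearMap.mem_range]
  induction p using MvPolynomial.induction_on' with
  | add p q hp hq => rw [map_add]; exact Submodule.add_mem _ hp hq
  | monomial u r =>
    rw [monomial_eq_smul_X_pow, ← Ideal.Quotient.mkₐ_eq_mk k, map_smul, Ideal.Quotient.mkₐ_eq_mk]
    refine Submodule.smul_mem _ _ ?_
    by_cases h : u 0 < 2
    · refine ⟨Finsupp.single (u 0 + 2 * u 1) 1, ?_⟩
      rw [polyLin, Finsupp.linearCombination_single, one_smul,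
        show (u 0 + 2 * u 1) % 2 = u 0 by omega, show (u 0 + 2 * u 1) / 2 = u 1 by omega]
    · obtain ⟨c, hc⟩ := Nat.exists_eq_add_of_le (not_lt.1 h)
      convert Submodule.zero_mem _ using 1
      rw [hc, pow_add, mul_assoc]
      exact Ideal.Quotient.eq_zero_iff_mem.2 (Ideal.mul_mem_right _ _
        (Ideal.subset_span (Set.mem_singleton _)))

theorem polyMap_polyLin (f : ℕ →₀ k) : polyMap k (polyLin k f) = hLin k f := by
  induction f using Finsupp.induction_linear with
  | zero => simp
  | add f g hf hg => rw [map_add, map_add, map_add, hf, hg]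
  | single n r =>
    rw [polyLin, hLin, Finsupp.linearCombination_single, Finsupp.linearCombination_single, map_smul,
      map_mul, map_mul, map_pow, map_pow, map_pow, map_pow, polyMap_X0, polyMap_X1]

/-- The normal monomials span the quotient and map to a basis of the cohomology. So their
independence in the quotient need not be proved separately. -/
theorem polyMap_bijective : Function.Bijective (polyMap k) := by
  constructor
  · rw [injective_iff_map_eq_zero]
    intro q hq
    obtain ⟨f, rfl⟩ := polyLin_surjective q
    rw [polyMap_polyLin] at hq
    rw [(injective_iff_map_eq_zero _).1 hLin_injective f hq, map_zero]
  · intro h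
    obtain ⟨f, rfl⟩ := hLin_surjective h
    exact ⟨_, polyMap_polyLin f⟩

variable (k) in
/-- The isomorphism `k[Y, V] / (Y²) ≃ H(A)`. -/
def polyEquiv : PolyQuot k ≃ₐ[k] HCarrier (exDG k) := AlgEquiv.ofBijective (polyMap k) polyMap_bijective

theorem polyEquiv_apply (q : PolyQuot k) : polyEquiv k q = polyMap k q := rfl

theorem polyEquiv_mem (n : ℕ) (p : MvPolynomial (Fin 2) k)
    (hp : MvPolynomial.IsWeightedHomogeneous (![1, 2] : Fin 2 → ℕ) p n) :
    polyEquiv k (Ideal.Quotient.mk _ p) ∈ hGrading (exDG k) n := by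
  rw [← p.support_sum_monomial_coeff, map_sum, map_sum]
  refine Submodule.sum_mem _ fun u hu => ?_
  have h := hp (MvPolynomial.mem_support_iff.1 hu)
  rw [polyEquiv_apply, polyMap_monomial]
  refine Submodule.smul_mem _ _ ?_
  have h' : u 0 + 2 * u 1 = n := by
    rw [← h, Finsupp.weight_apply, Finsupp.sum_fintype _ _ (by simp), Fin.sum_univ_two]
    simp [mul_comm]
  rw [← h']
  exact_mod_cast clsY_pow_mul_clsV_pow_mem (u 0) (u 1)

end PolynomialCohomology

end
end DGA

namespace DGA

noncomputable section

variable {k : Type u} [Field k]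

/-! ### Infinite global dimension -/

section InfiniteGlobalDimension

variable {R : GrAlg k}

/-- The kernel of `Y` on `M` is contained in its image. -/
def IsExactAt (Y : R.carrier) (M : Type u) [AddCommGroup M] [Module R.carrier M] : Prop :=
  ∀ m : M, Y • m = 0 → ∃ m', m = Y • m'

theorem IsExactAt.finsupp {Y : R.carrier} (h : IsExactAt Y R.carrier) (ι : Type u) :
    IsExactAt Y (ι →₀ R.carrier) := by
  intro x hx
  have h1 : ∀ i, ∃ c, x i = Y • c := fun i => h (x i) (by
    rw [← Finsupp.smul_apply, hx, Finsupp.zero_apply])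
  choose c hc using h1
  refine ⟨x.sum fun i _ => Finsupp.single i (c i), ?_⟩
  simp only [Finsupp.smul_sum, Finsupp.smul_single, ← hc]
  exact (Finsupp.sum_single x).symm

/-- The free graded module on the homogeneous elements of `M` maps onto `M`. -/
def freeCover (M : GrMod R) :
    (GrMod.free R (fun s : Σ n, M.grading n => s.1)).carrier →ₗ[R.carrier] M.carrier :=
  Finsupp.linearCombination R.carrier fun s => (s.2 : M.carrier)

theorem freeCover_isGrHom (M : GrMod R) : IsGrHom (freeCover M) := by
  intro n (x : (Σ n, M.grading n) →₀ R.carrier) hx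
  rw [freeCover, Finsupp.linearCombination_apply]
  refine Submodule.sum_mem _ fun s _ => ?_
  have := M.smul_mem _ _ _ _ (hx s) s.2.2
  rwa [sub_add_cancel] at this

theorem freeCover_surjective (M : GrMod R) : Function.Surjective (freeCover M) := by
  intro m
  rw [← LinearMap.mem_range]
  induction m using hom_induction M.grading with
  | h0 => exact Submodule.zero_mem _
  | hadd a b ha hb => exact Submodule.add_mem _ ha hb
  | hh n m hm =>
    refine ⟨Finsupp.single ⟨n, m, hm⟩ 1, ?_⟩
    rw [freeCover, Finsupp.linearCombination_single, one_smul]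

/-- A projective is a retract of the free module on its homogeneous elements, and the property
passes from a free module to its retracts. -/
theorem IsGrProjective.isExactAt {P : GrMod R} (hP : IsGrProjective P) {Y : R.carrier}
    (hY : IsExactAt Y R.carrier) : IsExactAt Y P.carrier := by
  obtain ⟨h, -, hh⟩ := hP _ P (freeCover P) LinearMap.id (freeCover_isGrHom P)
    (fun _ _ hm => hm) (freeCover_surjective P)
  intro m hm
  obtain ⟨c, hc⟩ := hY.finsupp _ (h m) (by rw [← map_smul, hm, map_zero])
  refine ⟨freeCover P c, ?_⟩
  rw [← map_smul]
  exact (LinearMap.congr_fun hh m).symm.trans (congrArg (freeCover P) hc)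

/-- Induction along $0\to K\to P\to M\to0$: lift $m$ to $p$, so that $Yp$ comes from some $c\in K$
with $Yc=0$ because $Y^2=0$. Then $c=Yc'$, and correcting $p$ by $c'$ gives an element of $P$ killed
by $Y$, hence in its image. -/
theorem HasGrProjDimLE.isExactAt {Y : R.carrier} (hY : IsExactAt Y R.carrier) (hYY : Y * Y = 0)
    {n : ℕ} {M : GrMod R} (hM : HasGrProjDimLE n M) : IsExactAt Y M.carrier := by
  induction n generalizing M with
  | zero => exact IsGrProjective.isExactAt hM hY
  | succ n ih =>
    obtain ⟨K, P, i, q, hP, -, -, hi, hiq, hq, hK⟩ := hM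
    intro m hm
    obtain ⟨p, rfl⟩ := hq m
    obtain ⟨c, hc⟩ := (hiq (Y • p)).1 (by rw [map_smul, hm])
    obtain ⟨c, rfl⟩ := ih hK c (hi (by
      rw [map_smul, hc, smul_smul, hYY, zero_smul, map_zero]))
    obtain ⟨p', hp'⟩ := hP.isExactAt hY (p - i c) (by rw [smul_sub, ← map_smul, hc, sub_self])
    refine ⟨q p', ?_⟩
    rw [← map_smul, ← hp', map_sub, (hiq (i c)).2 ⟨c, rfl⟩, sub_zero]

/-- A graded algebra as a DG algebra with zero differential. -/
abbrev GrAlg.toDGAlg (R : GrAlg k) : DGAlg k where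
  toGrAlg := R
  d := 0
  d_mem := fun _ _ _ => Submodule.zero_mem _
  d_d := fun _ => rfl
  leibniz := fun _ _ _ _ => by simp

theorem grGlobalDim_eq_top (hR : IsConnected R) {Y : R.carrier} {n : ℤ} (hn : n ≠ 0)
    (hYn : Y ∈ R.grading n) (hY : IsExactAt Y R.carrier) (hYY : Y * Y = 0) :
    grGlobalDim R = ⊤ := by
  rw [eq_top_iff]
  -- The trivial graded module is the one underlying the trivial DG module for the zero
  -- differential. No finite projective dimension is possible for it, so the set whose infimum is
  -- taken is empty.
  refine le_trans ?_ (le_iSup _ (DGMod.trivial (A := R.toDGAlg) hR).toGrMod)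
  rw [grProjDim]
  refine le_sInf ?_
  rintro _ ⟨m, hm, rfl⟩
  have hsmul : ∀ c : k, aug hR Y * c = 0 := fun c => by
    rw [show aug hR Y = 0 from augFun_of_ne hR hn hYn, zero_mul]
  obtain ⟨(c : k), (hc : (1 : k) = aug hR Y * c)⟩ := hm.isExactAt hY hYY (1 : k) (hsmul 1)
  rw [hsmul] at hc
  exact absurd hc one_ne_zero

theorem isConnected_H : IsConnected (exDG k).H where
  nontrivial := by
    refine ⟨1, 0, fun h => ?_⟩
    obtain ⟨b, hb⟩ := Ideal.Quotient.eq_zero_iff_mem.1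
      (h : Ideal.Quotient.mk (coboundaries (exDG k)) 1 = 0)
    exact one_ne_zero (isNonExact_one 1 b (hb.trans (one_smul k _).symm))
  neg := by
    intro n hn
    refine (Submodule.eq_bot_iff _).2 ?_
    rintro _ ⟨⟨z, hz⟩, hzn, rfl⟩
    have hz0 : z ∈ (exDG k).grading n := hzn
    rw [exDG_connected.neg n hn, Submodule.mem_bot] at hz0
    subst hz0
    exact map_zero _
  zero := by
    refine le_antisymm ?_ ?_
    · rintro _ ⟨⟨z, hz⟩, hzn, rfl⟩
      have hz0 : z ∈ (exDG k).grading 0 := hzn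
      rw [exDG_connected.zero, Submodule.mem_span_singleton] at hz0
      obtain ⟨r, rfl⟩ := hz0
      exact Submodule.mem_span_singleton.2 ⟨r, rfl⟩
    · rw [Submodule.span_singleton_le_iff_mem]
      exact one_mem' (exDG k).H

/-- In the polynomial ring, $Y^2\mid Yp$ forces $Y\mid p$. -/
theorem isExactAt_clsY : IsExactAt (R := (exDG k).H) (clsY k) (HCarrier (exDG k)) := by
  intro c hc
  obtain ⟨q, rfl⟩ := polyMap_bijective.2 c
  obtain ⟨p, rfl⟩ := Ideal.Quotient.mk_surjective q
  have h0 : polyMap k (Ideal.Quotient.mk _ (MvPolynomial.X 0 * p)) = 0 := by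
    rw [map_mul, map_mul, polyMap_X0]
    exact hc
  have h1 := polyMap_bijective.1 (h0.trans (map_zero (polyMap k)).symm)
  rw [Ideal.Quotient.eq_zero_iff_mem, Ideal.mem_span_singleton, pow_two,
    mul_dvd_mul_iff_left (MvPolynomial.X_ne_zero 0)] at h1
  obtain ⟨p, rfl⟩ := h1
  refine ⟨polyMap k (Ideal.Quotient.mk _ p), ?_⟩
  rw [map_mul, map_mul, polyMap_X0]
  rfl

theorem grGlobalDim_H : grGlobalDim (exDG k).H = ⊤ :=
  grGlobalDim_eq_top isConnected_H one_ne_zero clsY_mem isExactAt_clsY clsY_mul_clsY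

end InfiniteGlobalDimension

end
end DGA

/-! ### The main theorem -/

theorem mainTheorem11 (k : Type u) [Field k] :
    IsKoszul (exDG_connected (k := k)) ∧
    IsHomologicallySmooth (exDG k) ∧
    leftGlobalDim (exDG k) = 2 ∧
    coneLength (DGMod.trivial (exDG_connected (k := k))) = 2 ∧
    coneLength (DGMod.diag (exDG k)) = 2 ∧
    (∃ e : (MvPolynomial (Fin 2) k ⧸ Ideal.span {(MvPolynomial.X 0 ^ 2 : MvPolynomial (Fin 2) k)})
        ≃ₐ[k] (exDG k).H.carrier,
      e (Ideal.Quotient.mk _ (MvPolynomial.X 0)) = cls (A := exDG k) (gy k) exDG_d_y ∧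
      e (Ideal.Quotient.mk _ (MvPolynomial.X 1)) =
        cls (A := exDG k) (gx k * gy k + gy k * gx k) exDG_d_v ∧
      ∀ (n : ℕ) (p : MvPolynomial (Fin 2) k),
        MvPolynomial.IsWeightedHomogeneous (![1, 2] : Fin 2 → ℕ) p n →
        e (Ideal.Quotient.mk _ p) ∈ (exDG k).H.grading n) ∧
    grGlobalDim (exDG k).H = ⊤ := by
  -- The structures `exA k` and `exDG k` agree by unfolding, so the results for the reducible copy
  -- apply as they stand.
  exact ⟨exA_isKoszul, exA_isHomologicallySmooth, leftGlobalDim_exA, coneLength_trivial,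
    coneLength_diag, ⟨polyEquiv k, polyMap_X0, polyMap_X1, polyEquiv_mem⟩, grGlobalDim_H⟩
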